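/- Let $f$ be holomorphic in the half-plane $\operatorname{Re} z>0$ except for a single simple pole at $z_p$ $(\operatorname{Re} z_p>0)$ with residue $R_p\neq 0$, where $z_p\neq N+\tfrac12$ for every $N\in\mathbb N=\{0,1,2,\dots\}$, and let $f$ be continuous up to the line $\operatorname{Re} z=0$. Write $f_N=f(N+\tfrac12)$ and suppose that: (a) (Carlson's bound) $f$ has order at most one in $\operatorname{Re} z\ge 0$, i.e. for every $\rho>1$, $f(z)=O(e^{|z|^{\rho}})$ as $|z|\to\infty$, $\operatorname{Re} z\ge 0$ (in particular this holds if $f$ is of exponential type there), and there is $b<\pi$ such that $$h_f(\theta)=\limsup_{r\to\infty}\frac{\log|f(re^{i\theta})|}{r}\le b\,|\sin\theta|\qquad\text{for all } -\tfrac{\pi}{2}\le\theta\le\tfrac{\pi}{2};$$ (b) $y\mapsto f(iy)$ belongs to $L^2(-\infty,+\infty)$; (c) $\sum_{N=1}^\infty |f_N|/N<\infty$. Let $P_n=P_n^{(1/2)}$ be the Meixner–Pollaczek polynomials given by $P_{-1}=0$, $P_0=1$, $(n+1)P_{n+1}(z)=2zP_n(z)-nP_{n-1}(z)$, equivalently $P_n(z)=i^n\,{}_2F_1(-n,\tfrac12+iz;1;2)$;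 let $$\psi_n(y)=\frac1{\sqrt\pi}\,\Gamma\!\left(\tfrac12+iy\right)P_n(y)\qquad(n\in\mathbb N,\ y\in\mathbb R),$$ and let $$c_n^{(p)}=2\sqrt\pi\left\{\sum_{N=0}^\infty\frac{(-1)^N}{N!}\,f_N\,P_n\!\left[-i\left(N+\tfrac12\right)\right]-R_p\,\Gamma\!\left(\tfrac12-z_p\right)P_n(-iz_p)\right\}\qquad(n\in\mathbb N).$$ Then the series defining every $c_n^{(p)}$ converges absolutely, the series $\sum_{n=0}^\infty c_n^{(p)}\psi_n$ converges in $L^2(-\infty,+\infty)$, and for every real $x>-\tfrac12$ with $x+\tfrac12\neq z_p$, $$f\!\left(x+\tfrac12\right)=\sum_{N=0}^\infty f_N\,\operatorname{sinc}(x-N)-\frac{R_p}{\cos(\pi z_p)}\,\frac{\sin\pi x}{x+\frac12-z_p}-\frac{\sin\pi x}{2\pi}\int_{-\infty}^{+\infty}\frac{\sum_{n=0}^\infty c_n^{(p)}\psi_n(y)}{\left(x+\frac12-iy\right)\cosh\pi y}\,dy,$$ where $\operatorname{sinc}(t)=\frac{\sin\pi t}{\pi t}$ for $t\ne0$, $\operatorname{sinc}(0)=1$,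 the first series converges absolutely, the sum under the integral is the $L^2$-sum, and the integral converges absolutely. -/

import Mathlib

open Filter Topology MeasureTheory

noncomputable section

namespace PoleInterpolation

/-- The Meixner--Pollaczek polynomials `P_n = P_n^{(1/2)}` (angle `π/2`), defined by their three-term
recurrence `(n+1) P_{n+1}(z) = 2 z P_n(z) - n P_{n-1}(z)`, `P_{-1} = 0`, `P_0 = 1`. -/
def P : ℕ → ℂ → ℂ
  | 0, _ => 1
  | 1, z => 2 * z
  | n + 2, z => (2 * z * P (n + 1) z - (n + 1) * P n z) / (n + 2)

/-- Terms of the hypergeometric series, without the binomial coefficient. -/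
def hypTerm (b : ℂ) (k : ℕ) : ℂ := (-2) ^ k * (ascPochhammer ℂ k).eval b / k.factorial

/-- The finite sum `₂F₁(-n, b; 1; 2)`. -/
def hypSum (b : ℂ) (n : ℕ) : ℂ := ∑ k ∈ Finset.range (n + 1), (n.choose k : ℂ) * hypTerm b k

theorem hypSum_eq (b : ℂ) (n : ℕ) :
    ordinaryHypergeometric (-(n : ℂ)) b 1 (2 : ℂ) = hypSum b n := by
  rw [ordinaryHypergeometric_eq_tsum]
  simp only [smul_eq_mul]
  rw [tsum_eq_sum (s := Finset.range (n + 1))]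
  · unfold hypSum
    refine Finset.sum_congr rfl fun k _ => ?_
    have h1 : (ascPochhammer ℂ k).eval (-(n : ℂ)) =
        (-1) ^ k * ((k.factorial : ℂ) * (n.choose k : ℂ)) := by
      rw [ascPochhammer_eval_neg_eq_descPochhammer, descPochhammer_eval_eq_descFactorial,
        Nat.descFactorial_eq_factorial_mul_choose]
      push_cast
      ring
    have h2 : (ascPochhammer ℂ k).eval (1 : ℂ) = k.factorial := ascPochhammer_eval_one ℂ k
    have h3 : (k.factorial : ℂ) ≠ 0 := by exact_mod_cast k.factorial_ne_zero
    rw [h1, h2, hypTerm, show (-2 : ℂ) = (-1) * 2 by norm_num, mul_pow]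
    field_simp
  · intro k hk
    have hk' : n < k := by simpa using hk
    have h1 : (ascPochhammer ℂ k).eval (-(n : ℂ)) = 0 :=
      (ascPochhammer_eval_eq_zero_iff k _).2 ⟨n, hk', by simp⟩
    simp [h1]

theorem hypTerm_succ (b : ℂ) (k : ℕ) :
    ((k : ℂ) + 1) * hypTerm b (k + 1) = -2 * (b + k) * hypTerm b k := by
  have h3 : (k.factorial : ℂ) ≠ 0 := by exact_mod_cast k.factorial_ne_zero
  have h4 : (k : ℂ) + 1 ≠ 0 := by exact_mod_cast k.succ_ne_zero
  simp only [hypTerm, ascPochhammer_succ_eval, Nat.factorial_succ, pow_succ]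
  push_cast
  field_simp

theorem hypSum_eq_range (b : ℂ) (n m : ℕ) (h : n + 1 ≤ m) :
    hypSum b n = ∑ k ∈ Finset.range m, (n.choose k : ℂ) * hypTerm b k := by
  refine Finset.sum_subset (by simpa using h) fun k _ hk => ?_
  rw [Nat.choose_eq_zero_of_lt (by simpa using hk)]
  simp

theorem hypSum_diff (b : ℂ) (n : ℕ) :
    ((n : ℂ) + 1) * (hypSum b (n + 1) - hypSum b n) =
      -2 * ∑ k ∈ Finset.range (n + 1), ((n + 1).choose (k + 1) : ℂ) * ((b + k) * hypTerm b k) := by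
  have h1 : hypSum b n = ∑ k ∈ Finset.range (n + 2), (n.choose k : ℂ) * hypTerm b k :=
    hypSum_eq_range b n _ (by omega)
  rw [h1, hypSum, ← Finset.sum_sub_distrib, Finset.sum_range_succ', Finset.mul_sum]
  simp only [Nat.choose_zero_right, sub_self, add_zero, Finset.mul_sum]
  refine Finset.sum_congr rfl fun k _ => ?_
  have h2 : ((n + 1).choose (k + 1) : ℂ) = (n.choose k : ℂ) + (n.choose (k + 1) : ℂ) := by
    exact_mod_cast Nat.choose_succ_succ n k
  have h3 : ((n : ℂ) + 1) * (n.choose k : ℂ) = ((n + 1).choose (k + 1) : ℂ) * ((k : ℂ) + 1) := by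
    exact_mod_cast Nat.add_one_mul_choose_eq n k
  have h4 := hypTerm_succ b k
  linear_combination (-((n : ℂ) + 1) * hypTerm b (k + 1)) * (-h2) + h3 * hypTerm b (k + 1) +
    ((n + 1).choose (k + 1) : ℂ) * h4

theorem hypSum_rec (b : ℂ) (n : ℕ) :
    ((n : ℂ) + 2) * hypSum b (n + 2) =
      (1 - 2 * b) * hypSum b (n + 1) + ((n : ℂ) + 1) * hypSum b n := by
  have d1 := hypSum_diff b (n + 1)
  have d0 := hypSum_diff b n
  have e0 : ∑ k ∈ Finset.range (n + 1), ((n + 1).choose (k + 1) : ℂ) * ((b + k) * hypTerm b k) =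
      ∑ k ∈ Finset.range (n + 1 + 1),
        ((n + 1).choose (k + 1) : ℂ) * ((b + k) * hypTerm b k) := by
    rw [Finset.sum_range_succ _ (n + 1), Nat.choose_eq_zero_of_lt (Nat.lt_succ_self _)]
    simp
  have h1 : hypSum b n = ∑ k ∈ Finset.range (n + 1 + 1), (n.choose k : ℂ) * hypTerm b k :=
    hypSum_eq_range b n _ (by omega)
  have key : (∑ k ∈ Finset.range (n + 1 + 1),
        ((n + 1 + 1).choose (k + 1) : ℂ) * ((b + k) * hypTerm b k)) -
      ∑ k ∈ Finset.range (n + 1 + 1), ((n + 1).choose (k + 1) : ℂ) * ((b + k) * hypTerm b k) =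
      b * hypSum b (n + 1) + ((n : ℂ) + 1) * (hypSum b (n + 1) - hypSum b n) := by
    rw [h1, hypSum, ← Finset.sum_sub_distrib, ← Finset.sum_sub_distrib, Finset.mul_sum,
      Finset.mul_sum, ← Finset.sum_add_distrib]
    refine Finset.sum_congr rfl fun k _ => ?_
    have h2 : ((n + 1 + 1).choose (k + 1) : ℂ) =
        ((n + 1).choose k : ℂ) + ((n + 1).choose (k + 1) : ℂ) := by
      exact_mod_cast Nat.choose_succ_succ (n + 1) k
    have h3 : ((n : ℂ) + 1) * (((n + 1).choose k : ℂ) - (n.choose k : ℂ)) =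
        (k : ℂ) * ((n + 1).choose k : ℂ) := by
      cases k with
      | zero => simp
      | succ j =>
        have h4 : ((n + 1).choose (j + 1) : ℂ) = (n.choose j : ℂ) + (n.choose (j + 1) : ℂ) := by
          exact_mod_cast Nat.choose_succ_succ n j
        have h5 : ((n : ℂ) + 1) * (n.choose j : ℂ) =
            ((n + 1).choose (j + 1) : ℂ) * ((j : ℂ) + 1) := by
          exact_mod_cast Nat.add_one_mul_choose_eq n j
        push_cast
        linear_combination ((n : ℂ) + 1) * h4 + h5
    linear_combination (b + k) * hypTerm b k * h2 - hypTerm b k * h3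
  rw [e0] at d0
  push_cast at d1 d0
  linear_combination d1 - d0 - 2 * key

/-- Agreement with the hypergeometric form `P_n(z) = i^n ₂F₁(-n, 1/2 + i z; 1; 2)`. -/
theorem P_eq_hypergeometric (n : ℕ) (z : ℂ) :
    P n z = Complex.I ^ n *
      ordinaryHypergeometric (-(n : ℂ)) (1 / 2 + Complex.I * z) 1 (2 : ℂ) := by
  rw [hypSum_eq]
  induction n using Nat.twoStepInduction with
  | zero => simp [P, hypSum, hypTerm]
  | one =>
    simp [P, hypSum, hypTerm, Finset.sum_range_succ]
    linear_combination (2 * z) * Complex.I_sq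
  | more n h0 h1 =>
    have h := hypSum_rec (1 / 2 + Complex.I * z) n
    have h4 : (n : ℂ) + 2 ≠ 0 := by exact_mod_cast (n + 1).succ_ne_zero
    rw [P, h0, h1, div_eq_iff h4]
    have hI : Complex.I ^ 2 = -1 := Complex.I_sq
    have e2 : Complex.I ^ (n + 2) = -Complex.I ^ n := by rw [pow_add, hI]; ring
    have e1 : Complex.I ^ (n + 1) = Complex.I ^ n * Complex.I := pow_succ _ _
    rw [e1, e2]
    linear_combination Complex.I ^ n * h

/-- The functions `ψ_n(y) = π^{-1/2} Γ(1/2 + i y) P_n(y)` on the real line. -/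
def psi (n : ℕ) (y : ℝ) : ℂ :=
  ((1 / Real.sqrt Real.pi : ℝ) : ℂ) * Complex.Gamma (1 / 2 + Complex.I * y) * P n y

/-- `F ∈ L²(ℝ)` is the sum in `L²(ℝ)` of the series `∑ c_n ψ_n`. -/
def HasPsiSum (c : ℕ → ℂ) (F : ℝ → ℂ) : Prop :=
  MemLp F 2 volume ∧
    Tendsto (fun m : ℕ => eLpNorm (fun y => F y - ∑ n ∈ Finset.range m, c n * psi n y) 2 volume)
      atTop (𝓝 0)

/-- The sample `f_N = f(N + 1/2)`. -/
def sample (f : ℂ → ℂ) (N : ℕ) : ℂ := f ((N : ℂ) + 1 / 2)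

/-- The Phragmén--Lindelöf indicator `h_f(θ) = limsup_{r → ∞} log |f(r e^{iθ})| / r`, with values in
`[-∞, ∞]` and `log 0 = -∞`. -/
def indicatorPL (f : ℂ → ℂ) (θ : ℝ) : EReal :=
  limsup (fun r : ℝ => ENNReal.log ‖f (r * Complex.exp (Complex.I * θ))‖ₑ / (r : EReal)) atTop

/-- `f` is of order at most one in the closed half-plane `Re z ≥ 0`:
for every `ρ > 1`, `f(z) = O(exp(|z|^ρ))` as `|z| → ∞`, `Re z ≥ 0`. -/
def OrderAtMostOne (f : ℂ → ℂ) : Prop :=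
  ∀ ρ : ℝ, 1 < ρ →
    f =O[Bornology.cobounded ℂ ⊓ 𝓟 {z : ℂ | 0 ≤ z.re}] fun z => Real.exp (‖z‖ ^ ρ)

/-- Carlson's bound: `f` has order at most one in `Re z ≥ 0` and its indicator satisfies
`h_f(θ) ≤ b |sin θ|` for `-π/2 ≤ θ ≤ π/2`, for some `b < π`. -/
def CarlsonBound (f : ℂ → ℂ) : Prop :=
  OrderAtMostOne f ∧ ∃ b : ℝ, b < Real.pi ∧
    ∀ θ ∈ Set.Icc (-(Real.pi / 2)) (Real.pi / 2),
      indicatorPL f θ ≤ ((b * |Real.sin θ| : ℝ) : EReal)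

/-- `f` has a first order pole at `z₀` with residue `R ≠ 0`. -/
def HasSimplePoleAt (f : ℂ → ℂ) (z₀ R : ℂ) : Prop :=
  R ≠ 0 ∧ ∃ g : ℂ → ℂ, AnalyticAt ℂ g z₀ ∧ ∀ᶠ z in 𝓝[≠] z₀, f z = R / (z - z₀) + g z

/-- The `N`-th term of the series in the formula for the expansion coefficients. -/
def coeffTerm (f : ℂ → ℂ) (n N : ℕ) : ℂ :=
  (-1) ^ N / (N.factorial : ℂ) * sample f N * P n (-Complex.I * ((N : ℂ) + 1 / 2))

/-- The coefficients `c_n^{(p)}` of a function with a first order pole at `z_p` with residue `R_p`. -/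
def coeff (f : ℂ → ℂ) (zp Rp : ℂ) (n : ℕ) : ℂ :=
  2 * ((Real.sqrt Real.pi : ℝ) : ℂ) *
    ((∑' N : ℕ, coeffTerm f n N) - Rp * Complex.Gamma (1 / 2 - zp) * P n (-Complex.I * zp))

end PoleInterpolation

end

/-!
The formula is a residue computation on the right half-plane, carried out in a Hardy space.

Dividing out the pole, `f z = g z * ((z + 1) / (z - zp))` with `g` holomorphic for `Re z > 0` and
continuous up to the imaginary axis. The indicator bound on the positive real axis and on the
imaginary axis gives `g` exponential growth `exp (ε Re z + π |Im z|)` for every `ε > 0`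
(Phragmén--Lindelöf in the two quadrants, `exists_growth_bound`). Together with `g ∈ L²` on the
imaginary axis this puts `g` in the Hardy space `H²`: the `L²` norm of `g` on every vertical line is
at most that on the imaginary axis (`integral_sq_line_le`).

Let `W z = q z / cos (π z)`. Integrating `f * W` along the boundary of `0 ≤ Re z ≤ K` and letting
`K → ∞` expresses `∫ f (i y) q (i y) / cosh (π y) dy` through the samples of `f`, the residue at
`zp` and the residues of `q` (`HardyWithPole.tendsto_sum_nodes`). Only `L²` bounds for `g` are
available, so the horizontal sides are controlled along suitably chosen heights (`exists_height`).
The identity is used twice.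

* With `q z = π P_n(-i z) / Γ(1/2 + z)`, so that `W z = Γ(1/2 - z) P_n(-i z)`, it says that
  `coeff f zp Rp n` is the inner product of `psi n` with `y ↦ f (i y)`.
* With `q z = 1 / (x + 1/2 - z)` it is the interpolation formula with `f (i y)` in place of the sum
  of the series `∑ c_n ψ_n`.

It remains to see that the `psi n` form a Hilbert basis of `L²(ℝ)`, so that the series sums to
`f (i y)`. Since `|Γ(1/2 + i y)|² = π / cosh (π y)`, orthonormality concerns the weight
`1 / cosh (π y)`. Multiplication by `y` is symmetric, so by the recurrence it is enough that
`∫ P_n(y) / cosh (π y) dy = 0` for `n ≥ 1`; this follows from the identity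
`P_{n+1}(z - i) + i P_n(z - i) = P_{n+1}(z) - i P_n(z)` by moving the line of integration by one
period of the weight. Completeness holds because the weight decays exponentially: a function with
exponential decay is determined by its moments (`ae_eq_zero_of_integral_pow_eq_zero`).
-/

noncomputable section

namespace PoleInterpolation

open Complex (I)

/-! ### Rectangular contours and residues -/

/-- The integral of `H` along the boundary of `[0, K] × [-T, T]`, counterclockwise. The corners are
written so as to match Mathlib's Cauchy theorem for rectangles. -/
def rectIntegral (H : ℂ → ℂ) (K T : ℝ) : ℂ :=
  (∫ x : ℝ in (0 : ℝ)..K, H (x + (-T : ℝ) * I)) - (∫ x : ℝ in (0 : ℝ)..K, H (x + (T : ℝ) * I)) +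
    I * (∫ y : ℝ in (-T)..T, H ((K : ℝ) + y * I)) - I * ∫ y : ℝ in (-T)..T, H ((0 : ℝ) + y * I)

theorem rectIntegral_eq_zero {H : ℂ → ℂ} {K T : ℝ} (hK : 0 < K)
    (hc : ContinuousOn H {z | 0 ≤ z.re ∧ z.re ≤ K})
    (hd : DifferentiableOn ℂ H {z | 0 < z.re ∧ z.re < K}) : rectIntegral H K T = 0 := by
  have hopen : IsOpen {z : ℂ | 0 < z.re ∧ z.re < K} :=
    (isOpen_lt continuous_const Complex.continuous_re).inter
      (isOpen_lt Complex.continuous_re continuous_const)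
  have h := Complex.integral_boundary_rect_eq_zero_of_differentiable_on_off_countable H
    (⟨0, -T⟩ : ℂ) (⟨K, T⟩ : ℂ) ∅ Set.countable_empty
    (hc.mono fun z hz => by
      have h1 := (Complex.mem_reProdIm.1 hz).1
      rwa [Set.uIcc_of_le hK.le] at h1)
    (fun z hz => by
      have h1 := (Complex.mem_reProdIm.1 hz.1).1
      simp only [min_eq_left hK.le, max_eq_right hK.le] at h1
      exact hd.differentiableAt (hopen.mem_nhds h1))
  simpa [rectIntegral, smul_eq_mul] using h

theorem hasDerivAt_line_log {a b : ℂ} {t : ℝ} (h : a + t * b ∈ Complex.slitPlane) :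
    HasDerivAt (fun t : ℝ => Complex.log (a + t * b)) (b * (a + t * b)⁻¹) t := by
  have h1 : HasDerivAt (fun t : ℝ => a + (t : ℂ) * b) b t := by
    simpa using ((Complex.ofRealCLM.hasDerivAt (x := t)).mul_const b).const_add a
  simpa [div_eq_mul_inv] using h1.clog_real h

theorem integral_line_inv {a b : ℂ} {u v : ℝ}
    (h : ∀ t ∈ Set.uIcc u v, a + t * b ∈ Complex.slitPlane) :
    b * ∫ t : ℝ in u..v, (a + t * b)⁻¹ = Complex.log (a + v * b) - Complex.log (a + u * b) := by
  rw [← intervalIntegral.integral_const_mul]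
  refine intervalIntegral.integral_eq_sub_of_hasDerivAt (fun t ht => hasDerivAt_line_log (h t ht)) ?_
  refine ContinuousOn.intervalIntegrable fun t ht => ContinuousAt.continuousWithinAt ?_
  have := Complex.slitPlane_ne_zero (h t ht)
  fun_prop (disch := assumption)

theorem log_sub_log_neg_of_im_pos {z : ℂ} (h : 0 < z.im) :
    Complex.log z - Complex.log (-z) = Real.pi * I := by
  rw [Complex.log, Complex.log, norm_neg, Complex.arg_neg_eq_arg_sub_pi_of_im_pos h]
  push_cast
  ring

/-- The winding number computation. The principal logarithm is a primitive of `(z - s)⁻¹` along the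
bottom, right and top sides; on the left side `log (s - z)` is used instead, and the two choices
differ by `±iπ` at the two left corners. -/
theorem rectIntegral_inv {K T : ℝ} {s : ℂ} (h0 : 0 < s.re) (hK : s.re < K) (hT : |s.im| < T) :
    rectIntegral (fun z => (z - s)⁻¹) K T = 2 * Real.pi * I := by
  obtain ⟨h1, h2⟩ := abs_lt.1 hT
  have b := integral_line_inv (a := (-T : ℝ) * I - s) (b := 1) (u := 0) (v := K) fun t _ =>
    Or.inr (by simp; linarith)
  have t := integral_line_inv (a := (T : ℝ) * I - s) (b := 1) (u := 0) (v := K) fun t _ =>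
    Or.inr (by simp; linarith)
  have r := integral_line_inv (a := K - s) (b := I) (u := -T) (v := T) fun t _ =>
    Or.inl (by simp; linarith)
  have l := integral_line_inv (a := s) (b := -I) (u := -T) (v := T) fun t _ =>
    Or.inl (by simp; linarith)
  have e1 := log_sub_log_neg_of_im_pos (z := T * I - s) (by simp; linarith)
  have e2 := log_sub_log_neg_of_im_pos (z := -((-T : ℝ) * I - s)) (by simp; linarith)
  have l' : I * ∫ y : ℝ in (-T)..T, ((0 : ℝ) + y * I - s)⁻¹ =
      -I * ∫ y : ℝ in (-T)..T, (s + y * -I)⁻¹ := by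
    rw [neg_mul, ← mul_neg, ← intervalIntegral.integral_neg]
    congr 2
    ext y
    rw [← inv_neg]
    push_cast
    ring_nf
  have b' : ∫ x : ℝ in (0 : ℝ)..K, ((x : ℂ) + (-T : ℝ) * I - s)⁻¹ =
      1 * ∫ t : ℝ in (0 : ℝ)..K, ((-T : ℝ) * I - s + t * 1)⁻¹ := by
    rw [one_mul]; congr 1; ext y; ring_nf
  have t' : ∫ x : ℝ in (0 : ℝ)..K, ((x : ℂ) + (T : ℝ) * I - s)⁻¹ =
      1 * ∫ t : ℝ in (0 : ℝ)..K, ((T : ℝ) * I - s + t * 1)⁻¹ := by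
    rw [one_mul]; congr 1; ext y; ring_nf
  have r' : ∫ y : ℝ in (-T)..T, ((K : ℝ) + y * I - s)⁻¹ =
      ∫ t : ℝ in (-T)..T, ((K : ℂ) - s + t * I)⁻¹ := by
    congr 1; ext y; ring_nf
  rw [rectIntegral, l', b', t', r', b, t, r, l]
  have c1 : (K : ℂ) - s + (-T : ℝ) * I = (-T : ℝ) * I - s + K * 1 := by ring
  have c2 : (K : ℂ) - s + T * I = T * I - s + K * 1 := by ring
  have c3 : s + T * -I = -(T * I - s) := by ring
  have c4 : s + (-T : ℝ) * -I = -((-T : ℝ) * I - s) := by ring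
  rw [c1, c2, c3, c4]
  rw [neg_neg] at e2
  simp only [Complex.ofReal_zero, zero_mul, add_zero]
  linear_combination e1 + e2

theorem rectIntegral_add_const_mul {H₁ H₂ H : ℂ → ℂ} {c : ℂ} {K T : ℝ} (hK : 0 ≤ K) (hT : 0 ≤ T)
    (h₁ : ContinuousOn H₁ {z | (z.re = 0 ∨ z.re = K ∨ z.im = T ∨ z.im = -T) ∧ 0 ≤ z.re ∧ z.re ≤ K})
    (h₂ : ContinuousOn H₂ {z | (z.re = 0 ∨ z.re = K ∨ z.im = T ∨ z.im = -T) ∧ 0 ≤ z.re ∧ z.re ≤ K})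
    (h : ∀ z, (z.re = 0 ∨ z.re = K ∨ z.im = T ∨ z.im = -T) → H z = H₁ z + c * H₂ z) :
    rectIntegral H K T = rectIntegral H₁ K T + c * rectIntegral H₂ K T := by
  have side : ∀ (a b : ℂ) (u v : ℝ), u ≤ v →
      (∀ t ∈ Set.Icc u v, (((a + t * b).re = 0 ∨ (a + t * b).re = K ∨ (a + t * b).im = T ∨
        (a + t * b).im = -T) ∧ 0 ≤ (a + t * b).re ∧ (a + t * b).re ≤ K)) →
      ∫ t : ℝ in u..v, H (a + t * b) =
        (∫ t : ℝ in u..v, H₁ (a + t * b)) + c * ∫ t : ℝ in u..v, H₂ (a + t * b) := by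
    intro a b u v huv hs
    rw [← intervalIntegral.integral_const_mul, ← intervalIntegral.integral_add]
    · refine intervalIntegral.integral_congr fun t ht => ?_
      rw [Set.uIcc_of_le huv] at ht
      exact h _ (hs t ht).1
    · refine ContinuousOn.intervalIntegrable ?_
      rw [Set.uIcc_of_le huv]
      exact h₁.comp (by fun_prop) hs
    · refine ContinuousOn.intervalIntegrable ?_
      rw [Set.uIcc_of_le huv]
      exact continuousOn_const.mul (h₂.comp (by fun_prop) hs)
  have b := side ((-T : ℝ) * I) 1 0 K hK fun t ht => by simpa using ht
  have t := side ((T : ℝ) * I) 1 0 K hK fun t ht => by simpa using ht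
  have r := side K I (-T) T (by linarith) fun t ht => by simpa using hK
  have l := side (0 : ℝ) I (-T) T (by linarith) fun t ht => by simpa using hK
  have comm : ∀ (G : ℂ → ℂ) (d : ℂ),
      ∫ x : ℝ in (0 : ℝ)..K, G (d + x * 1) = ∫ x : ℝ in (0 : ℝ)..K, G (x + d) := fun G d => by
    simp only [mul_one, add_comm]
  rw [comm, comm, comm] at b t
  rw [rectIntegral, rectIntegral, rectIntegral, b, t, r, l]
  ring

/-- The residue theorem for a rectangle and finitely many simple poles, by induction on the set of
poles: subtracting one principal part leaves a removable singularity. -/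
theorem rectIntegral_eq_sum_residues {K T : ℝ} (hK : 0 < K) (hT : 0 < T) (r : ℂ → ℂ) (S : Finset ℂ)
    (hS : ∀ s ∈ S, 0 < s.re ∧ s.re < K ∧ |s.im| < T) (H : ℂ → ℂ)
    (hc : ContinuousOn H ({z | 0 ≤ z.re ∧ z.re ≤ K} \ S))
    (hd : DifferentiableOn ℂ H ({z | 0 < z.re ∧ z.re < K} \ S))
    (hr : ∀ s ∈ S, Tendsto (fun z => (z - s) * H z) (𝓝[≠] s) (𝓝 (r s))) :
    rectIntegral H K T = 2 * Real.pi * I * ∑ s ∈ S, r s := by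
  have hopen : IsOpen {z : ℂ | 0 < z.re ∧ z.re < K} :=
    (isOpen_lt continuous_const Complex.continuous_re).inter
      (isOpen_lt Complex.continuous_re continuous_const)
  induction S using Finset.induction_on generalizing H with
  | empty => simp at hc hd; simpa using rectIntegral_eq_zero hK hc hd
  | insert c S hcS ih =>
    obtain ⟨hc0, hcK, hcT⟩ := hS c (Finset.mem_insert_self _ _)
    have hUo : IsOpen ({z : ℂ | 0 < z.re ∧ z.re < K} \ S) := hopen.sdiff S.finite_toSet.isClosed
    have hcU : c ∈ ({z : ℂ | 0 < z.re ∧ z.re < K} \ S) := ⟨⟨hc0, hcK⟩, by simpa using hcS⟩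
    set G : ℂ → ℂ := fun z => H z - r c * (z - c)⁻¹ with hG
    set G' := Function.update G c (limUnder (𝓝[≠] c) G) with hG'
    have hset : ({z : ℂ | 0 < z.re ∧ z.re < K} \ S) \ {c} =
        {z : ℂ | 0 < z.re ∧ z.re < K} \ ↑(insert c S) := by
      ext z; simp only [Set.mem_sdiff, Finset.coe_insert, Set.mem_insert_iff,
        Set.mem_singleton_iff]; tauto
    have hinv : ContinuousOn (fun z : ℂ => (z - c)⁻¹) {c}ᶜ := fun z hz =>
      ContinuousAt.continuousWithinAt
        (by have : z - c ≠ 0 := sub_ne_zero.2 hz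
            fun_prop (disch := assumption))
    have hGd : DifferentiableOn ℂ G (({z : ℂ | 0 < z.re ∧ z.re < K} \ S) \ {c}) := by
      rw [hset]
      refine hd.sub (DifferentiableOn.const_mul (fun z hz => ?_) _)
      have : z - c ≠ 0 := sub_ne_zero.2 (by rintro rfl; simp at hz)
      exact DifferentiableAt.differentiableWithinAt (by fun_prop (disch := assumption))
    have hG'd : DifferentiableOn ℂ G' ({z : ℂ | 0 < z.re ∧ z.re < K} \ S) := by
      refine Complex.differentiableOn_update_limUnder_of_isLittleO (hUo.mem_nhds hcU) hGd ?_
      rw [Asymptotics.isLittleO_iff_tendsto']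
      · have h1 := hr c (Finset.mem_insert_self _ _)
        have h2 : Tendsto (fun z => (z - c) * G c) (𝓝[≠] c) (𝓝 0) := by
          have : Tendsto (fun z => (z - c) * G c) (𝓝 c) (𝓝 ((c - c) * G c)) := by
            apply Continuous.tendsto; fun_prop
          simpa using this.mono_left nhdsWithin_le_nhds
        have h3 := (h1.sub_const (r c)).sub h2
        simp only [sub_self] at h3
        refine h3.congr' ?_
        filter_upwards [self_mem_nhdsWithin] with z hz
        have : z - c ≠ 0 := sub_ne_zero.2 hz
        simp only [hG]
        field_simp
      · filter_upwards [self_mem_nhdsWithin] with z hz h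
        exact absurd (inv_eq_zero.1 h) (sub_ne_zero.2 hz)
    have hne : ∀ z ≠ c, G' z = G z := fun z hz => Function.update_of_ne hz _ _
    have hev : ∀ z ≠ c, G' =ᶠ[𝓝 z] G := fun z hz => by
      filter_upwards [isOpen_ne.mem_nhds hz] with w hw using hne w hw
    have hG'c : ContinuousOn G' ({z | 0 ≤ z.re ∧ z.re ≤ K} \ S) := by
      intro z hz
      by_cases hzc : z = c
      · rw [hzc]
        exact (hG'd.differentiableAt (hUo.mem_nhds hcU)).continuousAt.continuousWithinAt
      · have h1 : ContinuousWithinAt G ({z | 0 ≤ z.re ∧ z.re ≤ K} \ S) z := by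
          refine ContinuousWithinAt.sub ?_ (ContinuousAt.continuousWithinAt ?_)
          · have := hc z ⟨hz.1, by simpa [hzc] using hz.2⟩
            refine this.mono_of_mem_nhdsWithin ?_
            filter_upwards [self_mem_nhdsWithin,
              mem_nhdsWithin_of_mem_nhds (isOpen_ne.mem_nhds hzc)] with w hw hwc
            exact ⟨hw.1, by simpa [show w ≠ c from hwc] using hw.2⟩
          · have : z - c ≠ 0 := sub_ne_zero.2 hzc
            fun_prop (disch := assumption)
        exact h1.congr_of_eventuallyEq (mem_nhdsWithin_of_mem_nhds (hev z hzc)) (hne z hzc)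
    have key := ih (fun s hs => hS s (Finset.mem_insert_of_mem hs)) G' hG'c hG'd fun s hs => by
      have hsc : s ≠ c := by rintro rfl; exact hcS hs
      have h1 := hr s (Finset.mem_insert_of_mem hs)
      have hsc' : s - c ≠ 0 := sub_ne_zero.2 hsc
      have h2 : Tendsto (fun z => (z - s) * (r c * (z - c)⁻¹)) (𝓝[≠] s) (𝓝 0) := by
        have h3 : ContinuousAt (fun z => (z - s) * (r c * (z - c)⁻¹)) s := by
          fun_prop (disch := assumption)
        have h4 := h3.tendsto
        simp only [sub_self, zero_mul] at h4
        exact h4.mono_left nhdsWithin_le_nhds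
      have h3 := h1.sub h2
      rw [sub_zero] at h3
      refine h3.congr' ?_
      filter_upwards [mem_nhdsWithin_of_mem_nhds (hev s hsc)] with z hz
      rw [hz]
      simp only [hG]
      ring
    have hbd : ∀ z : ℂ, (z.re = 0 ∨ z.re = K ∨ z.im = T ∨ z.im = -T) → z ≠ c ∧ z ∉ S := by
      intro z hz
      have : z ∉ insert c S := by
        intro hmem
        obtain ⟨q1, q2, q3⟩ := hS z hmem
        obtain ⟨q4, q5⟩ := abs_lt.1 q3
        rcases hz with h | h | h | h <;> linarith
      simpa [not_or] using this
    have hlin := rectIntegral_add_const_mul (H := H) (H₁ := G') (H₂ := fun z => (z - c)⁻¹) (c := r c)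
      hK.le hT.le (hG'c.mono fun z hz => ⟨hz.2, by simpa using (hbd z hz.1).2⟩)
      (hinv.mono fun z hz => (hbd z hz.1).1) fun z hz => by
        rw [hne z (hbd z hz).1]; simp [hG]
    rw [hlin, key, rectIntegral_inv hc0 hcK hcT, Finset.sum_insert hcS]
    ring

/-! ### Growth and the Hardy space bound -/

/-- Phragmén--Lindelöf in the two quadrants of the right half-plane, after multiplication by
`exp (-ε z ± iπ z)`. -/
theorem exists_growth_bound {g : ℂ → ℂ} (hc : Continuous g)
    (hd : DifferentiableOn ℂ g {z | 0 < z.re})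
    (hord : g =O[Bornology.cobounded ℂ ⊓ 𝓟 {z : ℂ | 0 ≤ z.re}]
      fun z => Real.exp (‖z‖ ^ (3 / 2 : ℝ)))
    (hre : ∀ ε > 0, ∃ C, ∀ x : ℝ, 0 ≤ x → ‖g x‖ ≤ C * Real.exp (ε * x))
    (him : ∃ C, ∀ y : ℝ, ‖g (y * I)‖ ≤ C * Real.exp (Real.pi * |y|)) {ε : ℝ} (hε : 0 < ε) :
    ∃ C, ∀ z : ℂ, 0 ≤ z.re → ‖g z‖ ≤ C * Real.exp (ε * z.re + Real.pi * |z.im|) := by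
  obtain ⟨C₁, h₁⟩ := hre ε hε
  obtain ⟨C₂, h₂⟩ := him
  have hord' : ∀ s : Set ℂ, s ⊆ {z : ℂ | 0 ≤ z.re} → ∀ E : ℂ → ℂ, (∀ z ∈ s, ‖E z‖ ≤ 1) →
      ∃ c < (2 : ℝ), ∃ B, (fun z => g z * E z) =O[Bornology.cobounded ℂ ⊓ 𝓟 s]
        fun z => Real.exp (B * ‖z‖ ^ c) := by
    intro s hs E hE
    refine ⟨3 / 2, by norm_num, 1, ?_⟩
    have h3 : (fun z => g z * E z) =O[Bornology.cobounded ℂ ⊓ 𝓟 s] g := by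
      refine Asymptotics.IsBigO.of_bound 1 ?_
      filter_upwards [mem_inf_of_right (mem_principal_self s)] with z hz
      rw [norm_mul, mul_comm]
      gcongr
      exact hE z hz
    simpa using h3.trans (hord.mono (inf_le_inf_left _ (principal_mono.2 hs)))
  refine ⟨max C₁ C₂, fun z hz => ?_⟩
  rcases le_total 0 z.im with him0 | him0
  · have hE : ∀ w : ℂ, ‖Complex.exp (-ε * w + Real.pi * I * w)‖ =
        Real.exp (-(ε * w.re + Real.pi * w.im)) := fun w => by
      rw [Complex.norm_exp]; congr 1; simp; ring
    have key := PhragmenLindelof.quadrant_I (C := max C₁ C₂)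
      (f := fun w => g w * Complex.exp (-ε * w + Real.pi * I * w))
      (z := z) ⟨(hd.mono fun w hw => hw.1).mul (by fun_prop), by fun_prop⟩
      (hord' _ (fun w hw => le_of_lt (show 0 < w.re from hw.1)) _ fun w hw => by
        rw [hE, Real.exp_le_one_iff]
        have h1 : 0 < w.re := hw.1
        have h2 : 0 < w.im := hw.2
        have := Real.pi_pos
        have : 0 ≤ ε * w.re + Real.pi * w.im := by positivity
        linarith)
      (fun x hx => by
        rw [norm_mul, hE]
        calc _ ≤ C₁ * Real.exp (ε * x) * Real.exp (-(ε * (x : ℂ).re + Real.pi * (x : ℂ).im)) := by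
              gcongr; exact h₁ x hx
          _ = C₁ := by rw [mul_assoc, ← Real.exp_add]; simp
          _ ≤ _ := le_max_left _ _)
      (fun x hx => by
        rw [norm_mul, hE]
        calc _ ≤ C₂ * Real.exp (Real.pi * |x|) *
                Real.exp (-(ε * (x * I : ℂ).re + Real.pi * (x * I : ℂ).im)) := by
              gcongr; exact h₂ x
          _ = C₂ := by rw [mul_assoc, ← Real.exp_add]; simp [abs_of_nonneg hx]
          _ ≤ _ := le_max_right _ _)
      hz him0
    rw [norm_mul, hE, Real.exp_neg, ← div_eq_mul_inv, div_le_iff₀ (Real.exp_pos _)] at key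
    rwa [abs_of_nonneg him0]
  · have hE : ∀ w : ℂ, ‖Complex.exp (-ε * w - Real.pi * I * w)‖ =
        Real.exp (-(ε * w.re - Real.pi * w.im)) := fun w => by
      rw [Complex.norm_exp]; congr 1; simp; ring
    have key := PhragmenLindelof.quadrant_IV (C := max C₁ C₂)
      (f := fun w => g w * Complex.exp (-ε * w - Real.pi * I * w))
      (z := z) ⟨(hd.mono fun w hw => hw.1).mul (by fun_prop), by fun_prop⟩
      (hord' _ (fun w hw => le_of_lt (show 0 < w.re from hw.1)) _ fun w hw => by
        rw [hE, Real.exp_le_one_iff]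
        have h1 : 0 < w.re := hw.1
        have h2 : w.im < 0 := hw.2
        have := Real.pi_pos
        nlinarith [mul_pos hε h1])
      (fun x hx => by
        rw [norm_mul, hE]
        calc _ ≤ C₁ * Real.exp (ε * x) * Real.exp (-(ε * (x : ℂ).re - Real.pi * (x : ℂ).im)) := by
              gcongr; exact h₁ x hx
          _ = C₁ := by rw [mul_assoc, ← Real.exp_add]; simp
          _ ≤ _ := le_max_left _ _)
      (fun x hx => by
        rw [norm_mul, hE]
        calc _ ≤ C₂ * Real.exp (Real.pi * |x|) *
                Real.exp (-(ε * (x * I : ℂ).re - Real.pi * (x * I : ℂ).im)) := by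
              gcongr; exact h₂ x
          _ = C₂ := by rw [mul_assoc, ← Real.exp_add]; simp [abs_of_nonpos hx]
          _ ≤ _ := le_max_right _ _)
      hz him0
    rw [norm_mul, hE, Real.exp_neg, ← div_eq_mul_inv, div_le_iff₀ (Real.exp_pos _)] at key
    rwa [abs_of_nonpos him0, mul_neg, ← sub_eq_add_neg]

theorem differentiableOn_vertical_average {g : ℂ → ℂ} {φ : ℝ → ℂ} (hc : Continuous g)
    (hd : DifferentiableOn ℂ g {z | 0 < z.re}) (hφ : Continuous φ) (T : ℝ) :
    DifferentiableOn ℂ (fun z => ∫ t : ℝ in (-T)..T, g (z + t * I) * φ t) {z | 0 < z.re} := by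
  intro z₀ hz₀
  have hz₀' : 0 < z₀.re := hz₀
  have hopen : IsOpen {z : ℂ | 0 < z.re} := isOpen_lt continuous_const Complex.continuous_re
  have hball : ∀ z ∈ Metric.closedBall z₀ (z₀.re / 2), ∀ t : ℝ, 0 < (z + t * I).re := by
    intro z hz t
    have h1 : |(z - z₀).re| ≤ z₀.re / 2 :=
      (Complex.abs_re_le_norm _).trans (by simpa [dist_eq_norm] using hz)
    have h2 := (abs_le.1 h1).1
    simp at h2 ⊢
    linarith
  have hdc : ContinuousOn (fun p : ℂ × ℝ => deriv g (p.1 + p.2 * I))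
      (Metric.closedBall z₀ (z₀.re / 2) ×ˢ Set.uIcc (-T) T) :=
    (hd.deriv hopen).continuousOn.comp (by fun_prop) fun p hp => hball p.1 hp.1 p.2
  obtain ⟨C, hC⟩ :=
    ((isCompact_closedBall z₀ (z₀.re / 2)).prod isCompact_uIcc).exists_bound_of_continuousOn hdc
  have key := intervalIntegral.hasDerivAt_integral_of_dominated_loc_of_deriv_le
    (μ := volume) (a := -T) (b := T)
    (F := fun z (t : ℝ) => g (z + t * I) * φ t) (F' := fun z (t : ℝ) => deriv g (z + t * I) * φ t)
    (x₀ := z₀) (s := Metric.closedBall z₀ (z₀.re / 2)) (bound := fun t => C * ‖φ t‖)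
    (Metric.closedBall_mem_nhds _ (by positivity))
    (Eventually.of_forall fun z => by
      apply Continuous.aestronglyMeasurable; fun_prop)
    (by apply Continuous.intervalIntegrable; fun_prop)
    (by
      refine ContinuousOn.aestronglyMeasurable ?_ measurableSet_uIoc
      refine ContinuousOn.mul ?_ hφ.continuousOn
      exact (hd.deriv hopen).continuousOn.comp (by fun_prop) fun t _ =>
        hball z₀ (Metric.mem_closedBall_self (by positivity)) t)
    (Eventually.of_forall fun t ht z hz => by
      rw [norm_mul]
      gcongr
      exact hC (z, t) ⟨hz, Set.uIoc_subset_uIcc ht⟩)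
    (by apply Continuous.intervalIntegrable; fun_prop)
    (Eventually.of_forall fun t _ z hz => by
      have h1 : HasDerivAt g (deriv g (z + t * I)) (z + t * I) :=
        (hd.differentiableAt (hopen.mem_nhds (hball z hz t))).hasDerivAt
      exact (h1.comp_add_const z (t * I)).mul_const _)
  exact key.2.differentiableAt.differentiableWithinAt

/-- The Hardy space bound. For `φ` the conjugate of `g (x + i ·)`, the average
`G z = ∫ g (z + i t) φ t` is bounded on the imaginary axis, hence in the half-plane, by
`(M + J) / 2`, where `M` and `J` are the two sides of the claim; and `G x = J`. -/
theorem integral_sq_line_le {g : ℂ → ℂ} (hc : Continuous g)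
    (hd : DifferentiableOn ℂ g {z | 0 < z.re})
    (hgrow : ∀ ε > 0, ∃ C, ∀ z : ℂ, 0 ≤ z.re →
      ‖g z‖ ≤ C * Real.exp (ε * z.re + Real.pi * |z.im|))
    (hL2 : Integrable fun y : ℝ => ‖g (y * I)‖ ^ 2) {x T : ℝ} (hx : 0 ≤ x) (hT : 0 ≤ T) :
    ∫ t : ℝ in (-T)..T, ‖g (x + t * I)‖ ^ 2 ≤ ∫ y : ℝ, ‖g (y * I)‖ ^ 2 := by
  set M := ∫ y : ℝ, ‖g (y * I)‖ ^ 2 with hM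
  set J := ∫ t : ℝ in (-T)..T, ‖g (x + t * I)‖ ^ 2 with hJ
  have hTT : -T ≤ T := by linarith
  set φ : ℝ → ℂ := fun t => (starRingEnd ℂ) (g (x + t * I)) with hφd
  have hφ : Continuous φ := Complex.continuous_conj.comp (by fun_prop)
  have hφn : ∀ t, ‖φ t‖ = ‖g (x + t * I)‖ := fun t => Complex.norm_conj _
  set G : ℂ → ℂ := fun z => ∫ t : ℝ in (-T)..T, g (z + t * I) * φ t with hG
  have hGc : Continuous G := by
    apply intervalIntegral.continuous_parametric_intervalIntegral_of_continuous'
    fun_prop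
  have hGd : DifferentiableOn ℂ G {z | 0 < z.re} :=
    differentiableOn_vertical_average (φ := φ) (g := g) hc hd hφ T
  -- the average is bounded on the imaginary axis
  have hGi : ∀ y : ℝ, ‖G (y * I)‖ ≤ (M + J) / 2 := by
    intro y
    have h1 : ‖G (y * I)‖ ≤ ∫ t : ℝ in (-T)..T, ‖g (y * I + t * I) * φ t‖ :=
      intervalIntegral.norm_integral_le_integral_norm hTT
    have h2 : ∫ t : ℝ in (-T)..T, ‖g (y * I + t * I) * φ t‖ ≤
        ∫ t : ℝ in (-T)..T, (‖g (y * I + t * I)‖ ^ 2 / 2 + ‖g (x + t * I)‖ ^ 2 / 2) := by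
      refine intervalIntegral.integral_mono_on hTT ?_ ?_ fun t _ => ?_
      · apply Continuous.intervalIntegrable; fun_prop
      · apply Continuous.intervalIntegrable; fun_prop
      · rw [norm_mul, hφn]
        nlinarith [sq_nonneg (‖g (y * I + t * I)‖ - ‖g (x + t * I)‖)]
    have h3 : ∫ t : ℝ in (-T)..T, ‖g (y * I + t * I)‖ ^ 2 ≤ M := by
      have h4 : ∫ t : ℝ in (-T)..T, ‖g (y * I + t * I)‖ ^ 2 =
          ∫ t : ℝ in (-T)..T, (fun u : ℝ => ‖g (u * I)‖ ^ 2) (y + t) := by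
        congr 1; ext t; push_cast; rw [add_mul]
      rw [h4, intervalIntegral.integral_comp_add_left (fun u : ℝ => ‖g (u * I)‖ ^ 2) y,
        intervalIntegral.integral_of_le (by linarith)]
      exact setIntegral_le_integral hL2 (Eventually.of_forall fun _ => by positivity)
    rw [intervalIntegral.integral_add (by apply Continuous.intervalIntegrable; fun_prop)
      (by apply Continuous.intervalIntegrable; fun_prop), intervalIntegral.integral_div,
      intervalIntegral.integral_div] at h2
    linarith
  have hGx : ‖G x‖ = J := by
    have h1 : G x = (J : ℂ) := by
      rw [hG, hJ, ← intervalIntegral.integral_ofReal]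
      refine intervalIntegral.integral_congr fun t _ => ?_
      simp only [hφd]
      rw [Complex.mul_conj, Complex.normSq_eq_norm_sq]
    rw [h1, Complex.norm_real, Real.norm_of_nonneg]
    exact intervalIntegral.integral_nonneg hTT fun _ _ => by positivity
  have hGgrow : ∀ ε > 0, ∃ C, ∀ z : ℂ, 0 ≤ z.re →
      ‖G z‖ ≤ C * Real.exp (ε * z.re + Real.pi * |z.im|) := by
    intro ε hε
    obtain ⟨C, hC⟩ := hgrow ε hε
    obtain ⟨B, hB⟩ := (isCompact_Icc (a := -T) (b := T)).exists_bound_of_continuousOn hφ.continuousOn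
    have hC0 : 0 ≤ C := by
      have := (norm_nonneg _).trans (hC 0 (by simp))
      simpa using this
    have hB0 : 0 ≤ B := (norm_nonneg _).trans (hB T ⟨hTT, le_rfl⟩)
    refine ⟨C * Real.exp (Real.pi * T) * B * (2 * T), fun z hz => ?_⟩
    have h1 := intervalIntegral.norm_integral_le_of_norm_le_const (a := -T) (b := T)
      (f := fun t : ℝ => g (z + t * I) * φ t)
      (C := C * Real.exp (ε * z.re + Real.pi * |z.im|) * Real.exp (Real.pi * T) * B) fun t ht => by
        rw [Set.uIoc_of_le hTT] at ht
        have ht' : |t| ≤ T := abs_le.2 ⟨ht.1.le, ht.2⟩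
        rw [norm_mul]
        have h2 := hC (z + t * I) (by simpa using hz)
        have h3 : Real.exp (ε * (z + t * I).re + Real.pi * |(z + t * I).im|) ≤
            Real.exp (ε * z.re + Real.pi * |z.im|) * Real.exp (Real.pi * T) := by
          rw [← Real.exp_add, Real.exp_le_exp]
          have h4 : |z.im + t| ≤ |z.im| + T := (abs_add_le _ _).trans (by linarith)
          have := mul_le_mul_of_nonneg_left h4 Real.pi_pos.le
          simp
          linarith
        refine mul_le_mul (h2.trans ?_) (hB t (Set.Ioc_subset_Icc_self ht)) (norm_nonneg _)
          (by positivity)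
        rw [mul_assoc]
        gcongr
    have h5 : |T - -T| = 2 * T := by rw [abs_of_nonneg] <;> linarith
    rw [h5] at h1
    refine h1.trans (le_of_eq (by ring))
  have hε : ∀ ε : ℝ, 0 < ε → J * Real.exp (-ε * x) ≤ (M + J) / 2 := by
    intro ε hε
    obtain ⟨C, hC⟩ := hGgrow ε hε
    have hE : ∀ w : ℂ, ‖Complex.exp (-ε * w)‖ = Real.exp (-ε * w.re) := fun w => by
      rw [Complex.norm_exp]; congr 1; simp
    have hbd : ∀ w : ℂ, 0 ≤ w.re →
        ‖G w * Complex.exp (-ε * w)‖ ≤ C * Real.exp (Real.pi * |w.im|) := by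
      intro w hw
      rw [norm_mul, hE]
      calc _ ≤ C * Real.exp (ε * w.re + Real.pi * |w.im|) * Real.exp (-ε * w.re) := by
            gcongr; exact hC w hw
        _ = _ := by rw [mul_assoc, ← Real.exp_add]; congr 2; ring
    have hC0 : 0 ≤ C := by
      have := (norm_nonneg _).trans (hC 0 (by simp))
      simpa using this
    have key := PhragmenLindelof.right_half_plane_of_bounded_on_real (C := (M + J) / 2)
      (f := fun w => G w * Complex.exp (-ε * w)) (z := x)
      ⟨hGd.mul (by fun_prop), by fun_prop⟩
      ⟨1, by norm_num, Real.pi, Asymptotics.IsBigO.of_bound C (by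
        filter_upwards [mem_inf_of_right (mem_principal_self _)] with w hw
        refine (hbd w (le_of_lt hw)).trans ?_
        rw [Real.norm_of_nonneg (Real.exp_pos _).le, Real.rpow_one]
        have := Real.pi_pos
        gcongr
        exact Complex.abs_im_le_norm w)⟩
      ⟨C, by
        rw [eventually_map]
        filter_upwards [eventually_ge_atTop 0] with y hy
        simpa using hbd y (by simpa using hy)⟩
      (fun y => by
        rw [norm_mul, hE]
        simpa using hGi y)
      (by simpa using hx)
    rw [norm_mul, hE, hGx] at key
    simpa using key
  -- the bound `J ≤ (M + J) / 2` appears as `ε → 0`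
  have hlim : Tendsto (fun ε : ℝ => J * Real.exp (-ε * x)) (𝓝[>] 0) (𝓝 J) := by
    have h1 : ContinuousAt (fun ε : ℝ => J * Real.exp (-ε * x)) 0 := by fun_prop
    have h2 := h1.tendsto
    simp only [neg_zero, zero_mul, Real.exp_zero, mul_one] at h2
    exact h2.mono_left nhdsWithin_le_nhds
  have := le_of_tendsto hlim (by
    filter_upwards [self_mem_nhdsWithin] with ε h using hε ε h)
  linarith

/-! ### Contour integration over a half-strip and the zeros of `cos (π z)` -/

theorem integrable_sq_line {g : ℂ → ℂ} (hc : Continuous g) {M x : ℝ}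
    (hM : ∀ T : ℝ, 0 ≤ T → ∫ t : ℝ in (-T)..T, ‖g (x + t * I)‖ ^ 2 ≤ M) :
    Integrable (fun t : ℝ => ‖g (x + t * I)‖ ^ 2) ∧ ∫ t : ℝ, ‖g (x + t * I)‖ ^ 2 ≤ M := by
  have hcont : Continuous fun t : ℝ => ‖g (x + t * I)‖ ^ 2 := by fun_prop
  have hint : Integrable (fun t : ℝ => ‖g (x + t * I)‖ ^ 2) := by
    refine integrable_of_intervalIntegral_norm_bounded M (l := atTop) (a := fun n : ℕ => -(n : ℝ))
      (b := fun n : ℕ => (n : ℝ)) (fun n => (hcont.intervalIntegrable _ _).1)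
      (tendsto_neg_atTop_atBot.comp tendsto_natCast_atTop_atTop) tendsto_natCast_atTop_atTop
      (Eventually.of_forall fun n => ?_)
    simpa using hM n n.cast_nonneg
  refine ⟨hint, ?_⟩
  exact le_of_tendsto (intervalIntegral_tendsto_integral hint
    (tendsto_neg_atTop_atBot.comp tendsto_natCast_atTop_atTop) tendsto_natCast_atTop_atTop)
    (Eventually.of_forall fun n : ℕ => hM n n.cast_nonneg)

/-- The product of an `L²` function on a vertical line and the weight `(1 + y²)⁻¹` is integrable. -/
theorem integrable_of_norm_le_line {g : ℂ → ℂ} (hc : Continuous g) {M x c : ℝ} (hc0 : 0 ≤ c)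
    (hM : ∀ T : ℝ, 0 ≤ T → ∫ t : ℝ in (-T)..T, ‖g (x + t * I)‖ ^ 2 ≤ M) {u : ℝ → ℂ}
    (hu : Continuous u) (hbd : ∀ y : ℝ, ‖u y‖ ≤ c * (‖g (x + y * I)‖ * (1 + y ^ 2)⁻¹)) :
    Integrable u ∧ ‖∫ y, u y‖ ≤ c * ((M + Real.pi) / 2) := by
  obtain ⟨h1, h2⟩ := integrable_sq_line hc hM
  have h3 : Integrable fun y : ℝ => c * ((‖g (x + y * I)‖ ^ 2 + (1 + y ^ 2)⁻¹) / 2) :=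
    ((h1.add integrable_inv_one_add_sq).div_const 2).const_mul c
  have h4 : ∀ y : ℝ, ‖u y‖ ≤ c * ((‖g (x + y * I)‖ ^ 2 + (1 + y ^ 2)⁻¹) / 2) := fun y => by
    refine (hbd y).trans (mul_le_mul_of_nonneg_left ?_ hc0)
    have h5 : (1 + y ^ 2)⁻¹ ≤ 1 := inv_le_one_of_one_le₀ (by nlinarith [sq_nonneg y])
    have h6 : 0 ≤ (1 + y ^ 2)⁻¹ := by positivity
    nlinarith [sq_nonneg (‖g (x + y * I)‖ - (1 + y ^ 2)⁻¹)]
  refine ⟨h3.mono' hu.aestronglyMeasurable (Eventually.of_forall h4), ?_⟩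
  refine (norm_integral_le_of_norm_le h3 (Eventually.of_forall h4)).trans ?_
  rw [integral_const_mul, integral_div, integral_add h1 integrable_inv_one_add_sq,
    integral_univ_inv_one_add_sq]
  gcongr

/-- An `L²` bound on vertical lines gives, by averaging over `[n, n + 1]`, an `L²` bound on suitable
horizontal segments. -/
theorem exists_height {g : ℂ → ℂ} (hc : Continuous g) {M K : ℝ} (hK : 0 ≤ K)
    (hM : ∀ x T : ℝ, 0 ≤ x → 0 ≤ T → ∫ t : ℝ in (-T)..T, ‖g (x + t * I)‖ ^ 2 ≤ M) (n : ℕ) :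
    ∃ T ∈ Set.Icc (n : ℝ) (n + 1),
      ∫ x : ℝ in (0 : ℝ)..K, (‖g (x + T * I)‖ ^ 2 + ‖g (x + (-T : ℝ) * I)‖ ^ 2) ≤ K * M := by
  by_contra! hcon
  set F : ℝ → ℝ → ℝ := fun T x => ‖g (x + T * I)‖ ^ 2 + ‖g (x + (-T : ℝ) * I)‖ ^ 2 with hF
  have hFc : Continuous (Function.uncurry F) := by
    simp only [hF, Function.uncurry_def]; fun_prop
  have hΦ : Continuous fun T => ∫ x : ℝ in (0 : ℝ)..K, F T x :=
    intervalIntegral.continuous_parametric_intervalIntegral_of_continuous' hFc _ _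
  have hpos : 0 < ∫ T : ℝ in (n : ℝ)..(n + 1), ((∫ x : ℝ in (0 : ℝ)..K, F T x) - K * M) := by
    refine intervalIntegral.intervalIntegral_pos_of_pos_on ?_ (fun T hT => ?_) (by linarith)
    · apply Continuous.intervalIntegrable; fun_prop
    · have := hcon T (Set.Ioo_subset_Icc_self hT)
      simp only [hF]
      linarith
  rw [intervalIntegral.integral_sub (hΦ.intervalIntegrable _ _) (by simp),
    intervalIntegral.integral_const,
    intervalIntegral_intervalIntegral_swap (by
      rw [Set.uIoc_of_le (by linarith), Set.uIoc_of_le hK]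
      refine (hFc.continuousOn.integrableOn_compact
        (isCompact_Icc.prod isCompact_Icc)).mono_set
        (Set.prod_mono Set.Ioc_subset_Icc_self Set.Ioc_subset_Icc_self))] at hpos
  have hin : ∀ x ∈ Set.Icc (0 : ℝ) K, ∫ T : ℝ in (n : ℝ)..(n + 1), F T x ≤ M := by
    intro x hx
    have hg : Continuous fun t : ℝ => ‖g (x + t * I)‖ ^ 2 := by fun_prop
    have h1 := hM x (n + 1) hx.1 (by positivity)
    rw [intervalIntegral.integral_add (by apply Continuous.intervalIntegrable; fun_prop)
      (by apply Continuous.intervalIntegrable; fun_prop),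
      intervalIntegral.integral_comp_neg (fun t : ℝ => ‖g (x + t * I)‖ ^ 2)]
    rw [← intervalIntegral.integral_add_adjacent_intervals (b := (n : ℝ))
      (hg.intervalIntegrable _ _) (hg.intervalIntegrable _ _),
      ← intervalIntegral.integral_add_adjacent_intervals (b := -(n : ℝ))
      (hg.intervalIntegrable _ _) (hg.intervalIntegrable _ _)] at h1
    have h2 : 0 ≤ ∫ t : ℝ in (-(n : ℝ))..n, ‖g (x + t * I)‖ ^ 2 :=
      intervalIntegral.integral_nonneg (by have := n.cast_nonneg (α := ℝ); linarith)
        fun _ _ => by positivity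
    linarith
  have h3 : ∫ x : ℝ in (0 : ℝ)..K, ∫ T : ℝ in (n : ℝ)..(n + 1), F T x ≤
      ∫ x : ℝ in (0 : ℝ)..K, M := by
    refine intervalIntegral.integral_mono_on hK ?_ (by simp) hin
    apply Continuous.intervalIntegrable
    apply intervalIntegral.continuous_parametric_intervalIntegral_of_continuous'
    simp only [hF, Function.uncurry_def]; fun_prop
  simp at h3 hpos
  linarith

/-- The residue theorem for a vertical strip, when the horizontal sides vanish along a sequence of
heights. -/
theorem integral_line_sub_integral_line {K : ℝ} (hK : 0 < K) (r : ℂ → ℂ) (S : Finset ℂ)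
    (hS : ∀ s ∈ S, 0 < s.re ∧ s.re < K) (H : ℂ → ℂ)
    (hc : ContinuousOn H ({z | 0 ≤ z.re ∧ z.re ≤ K} \ S))
    (hd : DifferentiableOn ℂ H ({z | 0 < z.re ∧ z.re < K} \ S))
    (hr : ∀ s ∈ S, Tendsto (fun z => (z - s) * H z) (𝓝[≠] s) (𝓝 (r s)))
    (h0 : Integrable fun y : ℝ => H ((0 : ℝ) + y * I))
    (h1 : Integrable fun y : ℝ => H ((K : ℝ) + y * I)) {T : ℕ → ℝ} (hT : Tendsto T atTop atTop)
    (htop : Tendsto (fun n => ∫ x : ℝ in (0 : ℝ)..K, H (x + T n * I)) atTop (𝓝 0))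
    (hbot : Tendsto (fun n => ∫ x : ℝ in (0 : ℝ)..K, H (x + (-T n : ℝ) * I)) atTop (𝓝 0)) :
    (∫ y : ℝ, H ((K : ℝ) + y * I)) - ∫ y : ℝ, H ((0 : ℝ) + y * I) =
      2 * Real.pi * ∑ s ∈ S, r s := by
  have hTn := tendsto_neg_atTop_atBot.comp hT
  have hlim := ((hbot.sub htop).add
    ((intervalIntegral_tendsto_integral h1 hTn hT).const_mul I)).sub
    ((intervalIntegral_tendsto_integral h0 hTn hT).const_mul I)
  have hconst : Tendsto (fun n => rectIntegral H K (T n)) atTop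
      (𝓝 (2 * Real.pi * I * ∑ s ∈ S, r s)) := by
    refine tendsto_const_nhds.congr' ?_
    have hev : ∀ᶠ n in atTop, ∀ s ∈ S, |s.im| < T n :=
      (Finset.eventually_all S).2 fun s _ => hT.eventually_gt_atTop _
    filter_upwards [hev, hT.eventually_gt_atTop 0] with n hn hn0
    exact (rectIntegral_eq_sum_residues hK hn0 r S
      (fun s hs => ⟨(hS s hs).1, (hS s hs).2, hn s hs⟩) H hc hd hr).symm
  have := tendsto_nhds_unique hlim hconst
  refine mul_left_cancel₀ Complex.I_ne_zero ?_
  linear_combination this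

theorem cos_pi_mul_ne_zero {z : ℂ} (hz : -(1 / 2) < z.re) (h : ∀ N : ℕ, z ≠ (N : ℂ) + 1 / 2) :
    Complex.cos (Real.pi * z) ≠ 0 := by
  rw [Ne, Complex.cos_eq_zero_iff]
  rintro ⟨k, hk⟩
  have hpi : (Real.pi : ℂ) ≠ 0 := by exact_mod_cast Real.pi_ne_zero
  have hzk : z = (k : ℂ) + 1 / 2 := by
    refine mul_left_cancel₀ hpi ?_
    rw [hk]; ring
  have hre : z.re = (k : ℝ) + 1 / 2 := by rw [hzk]; simp
  have hk0 : 0 ≤ k := by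
    have : (-1 : ℝ) < k := by linarith
    have : (-1 : ℤ) < k := by exact_mod_cast this
    omega
  lift k to ℕ using hk0
  exact h k (by simpa using hzk)

theorem sin_pi_mul_node (N : ℕ) : Complex.sin (Real.pi * ((N : ℂ) + 1 / 2)) = (-1) ^ N := by
  have : (Real.pi : ℂ) * ((N : ℂ) + 1 / 2) = N * Real.pi + Real.pi / 2 := by ring
  rw [this, Complex.sin_add_pi_div_two]
  exact_mod_cast congrArg ((↑) : ℝ → ℂ) (Real.cos_nat_mul_pi N)

theorem cos_pi_mul_node (N : ℕ) : Complex.cos (Real.pi * ((N : ℂ) + 1 / 2)) = 0 := by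
  rw [Complex.cos_eq_zero_iff]
  exact ⟨N, by push_cast; ring⟩

/-- The residue of `1 / cos (π z)` at the node `N + 1/2`. -/
theorem tendsto_sub_div_cos (N : ℕ) :
    Tendsto (fun z : ℂ => (z - ((N : ℂ) + 1 / 2)) * (Complex.cos (Real.pi * z))⁻¹)
      (𝓝[≠] ((N : ℂ) + 1 / 2)) (𝓝 (-(-1) ^ N / Real.pi)) := by
  set s : ℂ := (N : ℂ) + 1 / 2 with hs
  have hpi : (Real.pi : ℂ) ≠ 0 := by exact_mod_cast Real.pi_ne_zero
  have h1 : HasDerivAt (fun z : ℂ => Complex.cos (Real.pi * z)) (-(-1) ^ N * Real.pi) s := by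
    have h := ((hasDerivAt_id s).const_mul (Real.pi : ℂ)).ccos
    simp only [id, mul_one] at h
    rwa [hs, sin_pi_mul_node, ← hs] at h
  have h2 := hasDerivAt_iff_tendsto_slope.1 h1
  have hp : (-(-1 : ℂ) ^ N * Real.pi) ≠ 0 :=
    mul_ne_zero (neg_ne_zero.2 (pow_ne_zero _ (by norm_num))) hpi
  have h3 := h2.inv₀ hp
  have e : (-(-1 : ℂ) ^ N * Real.pi)⁻¹ = -(-1) ^ N / Real.pi := by
    rcases neg_one_pow_eq_or ℂ N with h | h <;> rw [h] <;> simp [div_eq_mul_inv, mul_comm]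
  rw [e] at h3
  refine h3.congr fun z => ?_
  rw [slope_def_field, hs, cos_pi_mul_node, ← hs, sub_zero, inv_div, div_eq_mul_inv]

/-! ### Summation over the nodes for functions with one pole -/

/-- `f` is holomorphic in `Re z > 0` up to a simple pole at `zp` with residue `R`, away from the nodes
`N + 1/2`, and continuous up to the boundary. Off the pole it is `(z + 1) / (z - zp)` times a function
`g` whose squared `L²` norms on the vertical lines `Re z = x ≥ 0` are at most `M`. The function `g` is
continuous on all of `ℂ`; its values for `Re z < 0` carry no information. -/
structure HardyWithPole (f g : ℂ → ℂ) (zp R : ℂ) (M : ℝ) : Prop where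
  re_pos : 0 < zp.re
  ne_node : ∀ N : ℕ, zp ≠ (N : ℂ) + 1 / 2
  residue : Tendsto (fun z => (z - zp) * f z) (𝓝[≠] zp) (𝓝 R)
  continuousOn : ContinuousOn f ({z | 0 ≤ z.re} \ {zp})
  differentiableOn : DifferentiableOn ℂ f ({z | 0 < z.re} \ {zp})
  continuous : Continuous g
  factor : ∀ z : ℂ, 0 ≤ z.re → z ≠ zp → f z = g z * ((z + 1) / (z - zp))
  hardy : ∀ x T : ℝ, 0 ≤ x → 0 ≤ T → ∫ t : ℝ in (-T)..T, ‖g (x + t * I)‖ ^ 2 ≤ M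

/-- Away from the pole `f` is dominated by `g`. -/
theorem HardyWithPole.exists_norm_le {f g : ℂ → ℂ} {zp R : ℂ} {M : ℝ}
    (h : HardyWithPole f g zp R M) :
    ∃ C, 0 ≤ C ∧ ∀ z : ℂ, 0 ≤ z.re → min 1 zp.re ≤ ‖z - zp‖ → ‖f z‖ ≤ C * ‖g z‖ := by
  have hδ : 0 < min 1 zp.re := lt_min one_pos h.re_pos
  refine ⟨1 + ‖zp + 1‖ / min 1 zp.re, by positivity, fun z hz hzp => ?_⟩
  have hne : z - zp ≠ 0 := norm_pos_iff.1 (hδ.trans_le hzp)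
  rw [h.factor z hz (sub_ne_zero.1 hne), norm_mul, mul_comm]
  gcongr
  have : (z + 1) / (z - zp) = 1 + (zp + 1) / (z - zp) := by field_simp; ring
  rw [this]
  refine (norm_add_le _ _).trans ?_
  rw [norm_one, norm_div]
  gcongr

/-- The residue theorem on the half-plane for `f * (q / cos (π ·))`, where `q` may have simple poles in
the finite set `A` with residues `σ`. The kernel has to decay like `(1 + y²)⁻¹` on the boundary and on
the lines `Re z = K`, with a constant `κ K → 0`, and to tend to zero at both ends of every strip. -/
theorem HardyWithPole.tendsto_sum_nodes {f g q : ℂ → ℂ} {zp R : ℂ} {M : ℝ}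
    (h : HardyWithPole f g zp R M) {A : Finset ℂ} {σ : ℂ → ℂ} {C : ℝ} {κ : ℕ → ℝ}
    (hA : ∀ a ∈ A, 0 < a.re ∧ a ≠ zp ∧ ∀ N : ℕ, a ≠ (N : ℂ) + 1 / 2)
    (hq : DifferentiableOn ℂ q ({z | -(1 / 2) < z.re} \ A))
    (hσ : ∀ a ∈ A, Tendsto (fun z => (z - a) * q z) (𝓝[≠] a) (𝓝 (σ a)))
    (hW : ∀ y : ℝ, ‖q (y * I) / Complex.cos (Real.pi * (y * I))‖ ≤ C * (1 + y ^ 2)⁻¹)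
    (hκ : Tendsto κ atTop (𝓝 0))
    (hWκ : ∀ᶠ K : ℕ in atTop, ∀ y : ℝ,
      ‖q (K + y * I) / Complex.cos (Real.pi * (K + y * I))‖ ≤ κ K * (1 + y ^ 2)⁻¹)
    (hstrip : ∀ K : ℕ, ∀ ε > 0, ∀ᶠ T : ℝ in atTop, ∀ x ∈ Set.Icc (0 : ℝ) K,
      ‖q (x + T * I) / Complex.cos (Real.pi * (x + T * I))‖ ≤ ε ∧
      ‖q (x + (-T : ℝ) * I) / Complex.cos (Real.pi * (x + (-T : ℝ) * I))‖ ≤ ε) :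
    Integrable (fun y : ℝ => f (y * I) * (q (y * I) / Complex.cos (Real.pi * (y * I)))) ∧
    Tendsto (fun K : ℕ => ∑ N ∈ Finset.range K,
        2 * ((-1) ^ N * f ((N : ℂ) + 1 / 2) * q ((N : ℂ) + 1 / 2))) atTop
      (𝓝 ((∫ y : ℝ, f (y * I) * (q (y * I) / Complex.cos (Real.pi * (y * I)))) +
        2 * Real.pi * (R * (q zp / Complex.cos (Real.pi * zp)) +
          ∑ a ∈ A, σ a * (f a / Complex.cos (Real.pi * a))))) := by
  obtain ⟨C₁, hC₁, hfg⟩ := h.exists_norm_le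
  have hgc := h.continuous
  have hM0 : 0 ≤ M := by simpa using h.hardy 0 0 le_rfl le_rfl
  have hopenq : IsOpen ({z : ℂ | -(1 / 2) < z.re} \ (A : Set ℂ)) :=
    (isOpen_lt continuous_const Complex.continuous_re).sdiff A.finite_toSet.isClosed
  have hopenf : IsOpen ({z : ℂ | 0 < z.re} \ {zp}) :=
    (isOpen_lt continuous_const Complex.continuous_re).sdiff isClosed_singleton
  set W : ℂ → ℂ := fun z => q z / Complex.cos (Real.pi * z) with hWdef
  set H : ℂ → ℂ := fun z => f z * W z with hH
  replace hW : ∀ y : ℝ, ‖W (y * I)‖ ≤ C * (1 + y ^ 2)⁻¹ := hW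
  replace hWκ : ∀ᶠ K : ℕ in atTop, ∀ y : ℝ, ‖W (K + y * I)‖ ≤ κ K * (1 + y ^ 2)⁻¹ := hWκ
  replace hstrip : ∀ K : ℕ, ∀ ε > 0, ∀ᶠ T : ℝ in atTop, ∀ x ∈ Set.Icc (0 : ℝ) K,
      ‖W (x + T * I)‖ ≤ ε ∧ ‖W (x + (-T : ℝ) * I)‖ ≤ ε := hstrip
  have hcosd : ∀ z : ℂ, DifferentiableAt ℂ (fun z : ℂ => Complex.cos (Real.pi * z)) z := by
    intro z; fun_prop
  have hWd : ∀ z : ℂ, -(1 / 2) < z.re → z ∉ A → (∀ N : ℕ, z ≠ (N : ℂ) + 1 / 2) →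
      DifferentiableAt ℂ W z := fun z hz hzA hzN =>
    (hq.differentiableAt (hopenq.mem_nhds ⟨hz, hzA⟩)).div (hcosd z) (cos_pi_mul_ne_zero hz hzN)
  -- the boundary lines avoid all poles
  have hline : ∀ x : ℝ, 0 ≤ x → x ≠ zp.re → (∀ a ∈ A, a.re ≠ x) → (∀ N : ℕ, x ≠ (N : ℝ) + 1 / 2) →
      Continuous fun y : ℝ => H (x + y * I) := by
    intro x hx hxp hxA hxN
    have hre : ∀ y : ℝ, ((x : ℂ) + y * I).re = x := fun y => by simp
    refine Continuous.mul ?_ ?_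
    · refine h.continuousOn.comp_continuous (by fun_prop) fun y => ⟨?_, ?_⟩
      · simpa using hx
      · intro hmem
        rw [Set.mem_singleton_iff] at hmem
        exact hxp (by rw [← hmem, hre])
    · rw [continuous_iff_continuousAt]
      intro y
      have h1 : ContinuousAt W (x + y * I) := (hWd _ (by rw [hre]; linarith)
        (fun hmem => hxA _ hmem (hre y))
        (fun N hN => hxN N (by rw [← hre y, hN]; simp))).continuousAt
      exact ContinuousAt.comp (f := fun y : ℝ => (x : ℂ) + y * I) h1 (by fun_prop)
  have hint0 := integrable_of_norm_le_line (u := fun y : ℝ => H ((0 : ℝ) + y * I)) (x := 0)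
    (c := C₁ * max C 0) hgc (by positivity) (fun T hT => h.hardy 0 T le_rfl hT)
    (hline 0 le_rfl h.re_pos.ne (fun a ha => (hA a ha).1.ne') fun N => by positivity)
    fun y => by
      rw [norm_mul]
      have h1 := hfg ((0 : ℝ) + y * I) (by simp) (by
        refine (min_le_right _ _).trans ?_
        refine le_trans ?_ (Complex.abs_re_le_norm _)
        simp [abs_of_pos h.re_pos])
      have h2 := (hW y).trans (mul_le_mul_of_nonneg_right (le_max_left C 0) (by positivity))
      calc _ ≤ C₁ * ‖g ((0 : ℝ) + y * I)‖ * (max C 0 * (1 + y ^ 2)⁻¹) := by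
            gcongr
            simpa using h2
        _ = _ := by ring
  set V : ℂ := ∫ y : ℝ, H ((0 : ℝ) + y * I) with hV
  -- naming the residues by limits treats the nodes, `zp` and the points of `A` alike
  set ρ : ℂ → ℂ := fun s => limUnder (𝓝[≠] s) (fun z => (z - s) * H z) with hρ
  have hres_node : ∀ N : ℕ, Tendsto (fun z => (z - ((N : ℂ) + 1 / 2)) * H z)
      (𝓝[≠] ((N : ℂ) + 1 / 2))
      (𝓝 (-(-1) ^ N / Real.pi * (f ((N : ℂ) + 1 / 2) * q ((N : ℂ) + 1 / 2)))) := by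
    intro N
    have hN0 : (0 : ℝ) < ((N : ℂ) + 1 / 2).re := by simp; positivity
    have hfc : ContinuousAt f ((N : ℂ) + 1 / 2) :=
      (h.differentiableOn.differentiableAt
        (hopenf.mem_nhds ⟨hN0, fun hh => h.ne_node N hh.symm⟩)).continuousAt
    have hqc : ContinuousAt q ((N : ℂ) + 1 / 2) :=
      (hq.differentiableAt (hopenq.mem_nhds ⟨by
        show -(1 / 2) < ((N : ℂ) + 1 / 2).re
        linarith, fun hh => (hA _ hh).2.2 N rfl⟩)).continuousAt
    have h1 := (tendsto_sub_div_cos N).mul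
      ((hfc.tendsto.mul hqc.tendsto).mono_left nhdsWithin_le_nhds)
    refine h1.congr fun z => ?_
    simp only [hH, hWdef]
    ring
  have hres_p : Tendsto (fun z => (z - zp) * H z) (𝓝[≠] zp) (𝓝 (R * W zp)) := by
    have hWc : ContinuousAt W zp := (hWd zp (by linarith [h.re_pos])
      (fun hh => (hA _ hh).2.1 rfl) h.ne_node).continuousAt
    refine (h.residue.mul (hWc.tendsto.mono_left nhdsWithin_le_nhds)).congr fun z => ?_
    simp only [hH]
    ring
  have hres_A : ∀ a ∈ A, Tendsto (fun z => (z - a) * H z) (𝓝[≠] a)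
      (𝓝 (σ a * (f a / Complex.cos (Real.pi * a)))) := by
    intro a ha
    obtain ⟨ha0, hap, haN⟩ := hA a ha
    have hfc : ContinuousAt f a :=
      (h.differentiableOn.differentiableAt (hopenf.mem_nhds ⟨ha0, hap⟩)).continuousAt
    have h2 : ContinuousAt (fun z => f z / Complex.cos (Real.pi * z)) a :=
      hfc.div (hcosd a).continuousAt (cos_pi_mul_ne_zero (by linarith) haN)
    refine ((hσ a ha).mul (h2.tendsto.mono_left nhdsWithin_le_nhds)).congr fun z => ?_
    simp only [hH, hWdef]
    ring
  have hinj : Function.Injective fun N : ℕ => (N : ℂ) + 1 / 2 := fun a b hab => by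
    simpa using hab
  -- the residue theorem on the strip `0 ≤ Re z ≤ K`, and the estimate on its right side
  have hstep : ∀ᶠ K : ℕ in atTop,
      ‖(∑ N ∈ Finset.range K, 2 * ((-1) ^ N * f ((N : ℂ) + 1 / 2) * q ((N : ℂ) + 1 / 2))) -
        (V + 2 * Real.pi * (R * W zp + ∑ a ∈ A, σ a * (f a / Complex.cos (Real.pi * a))))‖ ≤
        C₁ * max (κ K) 0 * ((M + Real.pi) / 2) := by
    have hAre : ∀ᶠ K : ℕ in atTop, ∀ a ∈ A, a.re < K := (Finset.eventually_all A).2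
      fun a _ => tendsto_natCast_atTop_atTop.eventually_gt_atTop _
    filter_upwards [hWκ, hAre, tendsto_natCast_atTop_atTop.eventually_gt_atTop (zp.re + 1),
      eventually_gt_atTop 0] with K hK hKA hKp hK0
    have hK0' : (0 : ℝ) < K := by exact_mod_cast hK0
    have hint1 := integrable_of_norm_le_line (u := fun y : ℝ => H ((K : ℝ) + y * I)) (x := K)
      (c := C₁ * max (κ K) 0) hgc (by positivity) (fun T hT => h.hardy K T hK0'.le hT)
      (hline K hK0'.le (by linarith) (fun a ha => (hKA a ha).ne) fun N hN => by
        have h1 : (2 * K : ℝ) = 2 * N + 1 := by linarith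
        have h2 : 2 * K = 2 * N + 1 := by exact_mod_cast h1
        omega)
      fun y => by
        rw [norm_mul]
        have h1 := hfg ((K : ℝ) + y * I) (by simp) (by
          refine (min_le_left _ _).trans ?_
          refine le_trans ?_ (Complex.abs_re_le_norm _)
          simp only [Complex.sub_re, Complex.add_re, Complex.ofReal_re, Complex.re_ofReal_mul,
            Complex.I_re, mul_zero, add_zero]
          refine le_trans ?_ (le_abs_self _)
          linarith)
        have h2 := (hK y).trans
          (mul_le_mul_of_nonneg_right (le_max_left (κ K) 0) (by positivity))
        calc _ ≤ C₁ * ‖g ((K : ℝ) + y * I)‖ * (max (κ K) 0 * (1 + y ^ 2)⁻¹) := by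
              gcongr
              simpa using h2
          _ = _ := by ring
    choose T hTmem hTint using exists_height hgc hK0'.le h.hardy
    have hTt : Tendsto T atTop atTop :=
      tendsto_atTop_mono (fun n => (hTmem n).1) tendsto_natCast_atTop_atTop
    -- both horizontal sides are controlled at the chosen heights
    have hhor : ∀ e : ℝ, (e = 1 ∨ e = -1) →
        Tendsto (fun n => ∫ x : ℝ in (0 : ℝ)..K, H (x + (e * T n : ℝ) * I)) atTop (𝓝 0) := by
      intro e he
      rw [Metric.tendsto_atTop']
      intro η hη
      have hBpos : 0 < C₁ * (K + K * M) + 1 := by positivity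
      set ε := η / (C₁ * (K + K * M) + 1) with hε
      have hε0 : 0 < ε := by positivity
      have hev := hTt.eventually ((hstrip K ε hε0).and (eventually_gt_atTop (|zp.im| + 1)))
      rw [eventually_atTop] at hev
      obtain ⟨n₀, hn₀⟩ := hev
      refine ⟨n₀, fun n hn => ?_⟩
      obtain ⟨hs, hT1⟩ := hn₀ n hn.le
      have hpt : ∀ x ∈ Set.Icc (0 : ℝ) K, ‖H (x + (e * T n : ℝ) * I)‖ ≤
          C₁ * ε * ((1 + (‖g (x + T n * I)‖ ^ 2 + ‖g (x + (-T n : ℝ) * I)‖ ^ 2)) / 2) := by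
        intro x hx
        have hW' : ‖W (x + (e * T n : ℝ) * I)‖ ≤ ε := by
          rcases he with rfl | rfl
          · simpa using (hs x hx).1
          · simpa using (hs x hx).2
        have hf' := hfg (x + (e * T n : ℝ) * I) (by simpa using hx.1) (by
          refine (min_le_left _ _).trans ?_
          refine le_trans ?_ (Complex.abs_im_le_norm _)
          have h1 : (x + (e * T n : ℝ) * I - zp).im = e * T n - zp.im := by simp
          rw [h1]
          obtain ⟨h2, h3⟩ := abs_le.1 (le_refl |zp.im|)
          rcases he with rfl | rfl
          · refine le_trans ?_ (le_abs_self _)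
            linarith
          · refine le_trans ?_ (neg_le_abs _)
            linarith)
        have hg' : ‖g (x + (e * T n : ℝ) * I)‖ ^ 2 ≤
            ‖g (x + T n * I)‖ ^ 2 + ‖g (x + (-T n : ℝ) * I)‖ ^ 2 := by
          rcases he with rfl | rfl
          · simp
          · simp
        rw [norm_mul]
        calc _ ≤ C₁ * ‖g (x + (e * T n : ℝ) * I)‖ * ε := by gcongr
          _ = C₁ * ε * ‖g (x + (e * T n : ℝ) * I)‖ := by ring
          _ ≤ _ := by
            gcongr
            nlinarith [sq_nonneg (‖g (x + (e * T n : ℝ) * I)‖ - 1)]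
      have hb : ‖∫ x : ℝ in (0 : ℝ)..K, H (x + (e * T n : ℝ) * I)‖ ≤
          ∫ x : ℝ in (0 : ℝ)..K,
          C₁ * ε * ((1 + (‖g (x + T n * I)‖ ^ 2 + ‖g (x + (-T n : ℝ) * I)‖ ^ 2)) / 2) := by
        refine intervalIntegral.norm_integral_le_of_norm_le hK0'.le
          (Eventually.of_forall fun x hx => hpt x (Set.Ioc_subset_Icc_self hx)) ?_
        apply Continuous.intervalIntegrable
        fun_prop
      rw [intervalIntegral.integral_const_mul, intervalIntegral.integral_div,
        intervalIntegral.integral_add (by simp)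
          (by apply Continuous.intervalIntegrable; fun_prop)] at hb
      have hTn := hTint n
      simp only [intervalIntegral.integral_const, sub_zero, smul_eq_mul, mul_one] at hb
      rw [dist_zero_right]
      calc _ ≤ C₁ * ε * ((K + K * M) / 2) := hb.trans (by gcongr)
        _ < ε * (C₁ * (K + K * M) + 1) := by
            have : 0 ≤ C₁ * ε * (K + K * M) := by positivity
            nlinarith
        _ = η := by rw [hε]; field_simp
    set S : Finset ℂ := (Finset.range K).image (fun N : ℕ => (N : ℂ) + 1 / 2) ∪ insert zp A with hS
    have hSmem : ∀ s, s ∈ S ↔ (∃ N < K, (N : ℂ) + 1 / 2 = s) ∨ s = zp ∨ s ∈ A := by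
      intro s
      rw [hS, Finset.mem_union, Finset.mem_insert, Finset.mem_image]
      simp only [Finset.mem_range]
    have hnotS : ∀ z : ℂ, z.re ≤ K → z ∉ S → z ≠ zp ∧ z ∉ A ∧ ∀ N : ℕ, z ≠ (N : ℂ) + 1 / 2 := by
      intro z hz hzS
      rw [hSmem] at hzS
      push Not at hzS
      refine ⟨hzS.2.1, hzS.2.2, fun N hN => hzS.1 N ?_ hN.symm⟩
      have h1 : (N : ℝ) + 1 / 2 ≤ K := by simpa [hN] using hz
      have h2 : (N : ℝ) < K := by linarith
      exact_mod_cast h2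
    have hmain := integral_line_sub_integral_line hK0' ρ S
      (by
        intro s hs
        rcases (hSmem s).1 hs with ⟨N, hN, rfl⟩ | rfl | hsA
        · have : (N : ℝ) + 1 ≤ K := by exact_mod_cast hN
          refine ⟨by simp; positivity, by simp; linarith⟩
        · exact ⟨h.re_pos, by linarith⟩
        · exact ⟨(hA s hsA).1, hKA s hsA⟩) H
      (by
        intro z hz
        obtain ⟨h1, h2, h3⟩ := hnotS z hz.1.2 hz.2
        refine ContinuousWithinAt.mul ?_
          (hWd z (by linarith [hz.1.1]) h2 h3).continuousAt.continuousWithinAt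
        refine (h.continuousOn z ⟨hz.1.1, h1⟩).mono fun w hw => ⟨hw.1.1, ?_⟩
        exact (hnotS w hw.1.2 hw.2).1)
      (by
        intro z hz
        obtain ⟨h1, h2, h3⟩ := hnotS z hz.1.2.le hz.2
        exact ((h.differentiableOn.differentiableAt (hopenf.mem_nhds ⟨hz.1.1, h1⟩)).mul
          (hWd z (by linarith [hz.1.1]) h2 h3)).differentiableWithinAt)
      (by
        intro s hs
        refine tendsto_nhds_limUnder ?_
        rcases (hSmem s).1 hs with ⟨N, hN, rfl⟩ | rfl | hsA
        · exact ⟨_, hres_node N⟩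
        · exact ⟨_, hres_p⟩
        · exact ⟨_, hres_A s hsA⟩)
      hint0.1 hint1.1 hTt (by simpa using hhor 1 (Or.inl rfl)) (by simpa using hhor (-1) (Or.inr rfl))
    have hsum : ∑ s ∈ S, ρ s = (∑ N ∈ Finset.range K,
        -(-1) ^ N / Real.pi * (f ((N : ℂ) + 1 / 2) * q ((N : ℂ) + 1 / 2))) +
        (R * W zp + ∑ a ∈ A, σ a * (f a / Complex.cos (Real.pi * a))) := by
      rw [hS, Finset.sum_union, Finset.sum_image hinj.injOn, Finset.sum_insert]
      · congr 1
        · exact Finset.sum_congr rfl fun N _ => (hres_node N).limUnder_eq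
        · congr 1
          · exact hres_p.limUnder_eq
          · exact Finset.sum_congr rfl fun a ha => (hres_A a ha).limUnder_eq
      · exact fun hh => (hA _ hh).2.1 rfl
      · rw [Finset.disjoint_left]
        intro s hs hs'
        obtain ⟨N, _, rfl⟩ := Finset.mem_image.1 hs
        rcases Finset.mem_insert.1 hs' with h1 | h1
        · exact h.ne_node N h1.symm
        · exact (hA _ h1).2.2 N rfl
    rw [hsum] at hmain
    refine le_trans (le_of_eq ?_) hint1.2
    rw [← norm_neg]
    congr 1
    have hpi : (Real.pi : ℂ) ≠ 0 := by exact_mod_cast Real.pi_ne_zero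
    have h4 : (2 * Real.pi : ℂ) * ∑ N ∈ Finset.range K,
        -(-1) ^ N / Real.pi * (f ((N : ℂ) + 1 / 2) * q ((N : ℂ) + 1 / 2)) =
        -∑ N ∈ Finset.range K, 2 * ((-1) ^ N * f ((N : ℂ) + 1 / 2) * q ((N : ℂ) + 1 / 2)) := by
      rw [Finset.mul_sum, ← Finset.sum_neg_distrib]
      refine Finset.sum_congr rfl fun N _ => ?_
      field_simp
    rw [mul_add, h4] at hmain
    linear_combination -hmain
  have hV' : V = ∫ y : ℝ, f (y * I) * W (y * I) := by simp [hV, hH]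
  refine ⟨by simpa [hH] using hint0.1, ?_⟩
  rw [← hV']
  rw [tendsto_iff_norm_sub_tendsto_zero]
  refine squeeze_zero' (Eventually.of_forall fun _ => norm_nonneg _) hstep ?_
  have h1 : Tendsto (fun K => max (κ K) 0) atTop (𝓝 (max 0 0)) := hκ.max tendsto_const_nhds
  simpa using (h1.const_mul C₁).mul_const ((M + Real.pi) / 2)

/-! ### Bounds for the Meixner--Pollaczek polynomials and the Gamma function -/

theorem P_succ_succ (n : ℕ) (z : ℂ) :
    ((n : ℂ) + 2) * P (n + 2) z = 2 * z * P (n + 1) z - (n + 1) * P n z := by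
  have h : (n : ℂ) + 2 ≠ 0 := by exact_mod_cast (n + 1).succ_ne_zero
  rw [P, mul_div_cancel₀ _ h]

theorem differentiable_P (n : ℕ) : Differentiable ℂ (P n) := by
  induction n using Nat.twoStepInduction with
  | zero =>
    have : P 0 = fun _ => 1 := by ext z; rw [P]
    rw [this]; fun_prop
  | one =>
    have : P 1 = fun z => 2 * z := by ext z; rw [P]
    rw [this]; fun_prop
  | more n h0 h1 =>
    have : P (n + 2) = fun z => (2 * z * P (n + 1) z - (n + 1) * P n z) / (n + 2) := by
      ext z; rw [P]
    rw [this]; fun_prop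

theorem conj_P (n : ℕ) (y : ℝ) : (starRingEnd ℂ) (P n y) = P n y := by
  have h2 : (starRingEnd ℂ) 2 = 2 := map_ofNat _ 2
  induction n using Nat.twoStepInduction with
  | zero => simp [P]
  | one => simp [P, h2]
  | more n h0 h1 => simp [P, h0, h1, h2]

theorem exists_norm_P_le (n : ℕ) : ∃ C, 0 ≤ C ∧ ∀ z : ℂ, ‖P n z‖ ≤ C * (1 + ‖z‖) ^ n := by
  induction n using Nat.twoStepInduction with
  | zero => exact ⟨1, zero_le_one, fun z => by simp [P]⟩
  | one =>
    refine ⟨2, zero_le_two, fun z => ?_⟩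
    simp only [P, norm_mul, Complex.norm_ofNat, pow_one]
    linarith
  | more n h0 h1 =>
    obtain ⟨A, hA, h0⟩ := h0
    obtain ⟨B, hB, h1⟩ := h1
    refine ⟨2 * B + A, by positivity, fun z => ?_⟩
    have hn : ‖(n : ℂ) + 2‖ = n + 2 := by
      have := Complex.norm_natCast (n + 2)
      push_cast at this
      exact this
    have hn1 : ‖(n : ℂ) + 1‖ = n + 1 := by
      have := Complex.norm_natCast (n + 1)
      push_cast at this
      exact this
    have hz := norm_nonneg z
    rw [P, norm_div, hn, div_le_iff₀ (by positivity)]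
    refine (norm_sub_le _ _).trans ?_
    rw [norm_mul, norm_mul, norm_mul, hn1, Complex.norm_ofNat]
    have e1 : 2 * ‖z‖ * ‖P (n + 1) z‖ ≤ 2 * B * (1 + ‖z‖) ^ (n + 2) := by
      calc _ ≤ 2 * (1 + ‖z‖) * (B * (1 + ‖z‖) ^ (n + 1)) := by
            gcongr
            · linarith
            · exact h1 z
        _ = _ := by ring
    have e2 : ‖P n z‖ ≤ A * (1 + ‖z‖) ^ (n + 2) := by
      refine (h0 z).trans ?_
      gcongr
      · linarith
      · omega
    have e3 : 0 ≤ 2 * B * (1 + ‖z‖) ^ (n + 2) := by positivity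
    have e4 := norm_nonneg (P n z)
    have hn0 : (0 : ℝ) ≤ n := n.cast_nonneg
    nlinarith [mul_le_mul_of_nonneg_left e2 (by positivity : (0 : ℝ) ≤ n + 1),
      mul_nonneg hn0 e3, mul_nonneg hA (by positivity : 0 ≤ (1 + ‖z‖) ^ (n + 2))]

theorem norm_Gamma_le {s : ℂ} (hs : 0 < s.re) : ‖Complex.Gamma s‖ ≤ Real.Gamma s.re := by
  rw [Complex.Gamma_eq_integral hs, Real.Gamma_eq_integral hs, Complex.GammaIntegral]
  refine (norm_integral_le_integral_norm _).trans (le_of_eq ?_)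
  refine setIntegral_congr_fun measurableSet_Ioi fun x hx => ?_
  rw [norm_mul, Complex.norm_cpow_eq_rpow_re_of_pos hx, Complex.norm_real,
    Real.norm_of_nonneg (Real.exp_pos _).le]
  simp

/-- Polynomial decay of the Gamma function in vertical strips, from the functional equation. -/
theorem norm_Gamma_mul_pow_le {s : ℂ} (hs : s.im ≠ 0) (m : ℕ) :
    ‖Complex.Gamma s‖ * |s.im| ^ m ≤ ‖Complex.Gamma (s + m)‖ := by
  induction m with
  | zero => simp
  | succ m ih =>
    have h1 : s + m ≠ 0 := fun h => hs (by simpa using congrArg Complex.im h)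
    have h2 : |s.im| ≤ ‖s + m‖ := by simpa using Complex.abs_im_le_norm (s + m)
    push_cast
    rw [← add_assoc, Complex.Gamma_add_one _ h1, norm_mul, pow_succ, ← mul_assoc, mul_comm]
    gcongr

theorem exists_norm_Gamma_strip_le (K m : ℕ) :
    ∃ C, 0 ≤ C ∧ ∀ x ∈ Set.Icc (0 : ℝ) K, ∀ y : ℝ, 1 ≤ |y| →
      ‖Complex.Gamma (1 / 2 - (x + y * I))‖ * |y| ^ m ≤ C := by
  obtain ⟨C, hC⟩ := (isCompact_Icc (a := (1 / 2 : ℝ)) (b := 1 / 2 + ((m + K : ℕ) : ℝ))).exists_bound_of_continuousOn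
    (f := Real.Gamma) fun t ht => by
      refine (Real.differentiableAt_Gamma fun k hk => ?_).continuousAt.continuousWithinAt
      have := ht.1
      have : (0 : ℝ) ≤ k := k.cast_nonneg
      linarith
  refine ⟨max C 0, le_max_right _ _, fun x hx y hy => le_trans ?_ (le_max_left _ _)⟩
  have him : (1 / 2 - (x + y * I) : ℂ).im = -y := by simp
  have hre : (1 / 2 - (x + y * I) + ((m + K : ℕ) : ℂ)).re = 1 / 2 - x + ((m + K : ℕ) : ℝ) := by simp
  have h1 := norm_Gamma_mul_pow_le (s := 1 / 2 - (x + y * I)) (by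
    rw [him]; rintro h; rw [neg_eq_zero] at h; norm_num [h] at hy) (m + K)
  rw [him, abs_neg] at h1
  have hx' := hx.2
  have hm : (0 : ℝ) ≤ m := m.cast_nonneg
  have h2 := norm_Gamma_le (s := 1 / 2 - (x + y * I) + ((m + K : ℕ) : ℂ)) (by
    rw [hre]; push_cast; linarith)
  rw [hre] at h2
  have h3 := hC (1 / 2 - x + ((m + K : ℕ) : ℝ)) ⟨by push_cast; linarith, by linarith [hx.1]⟩
  calc _ ≤ ‖Complex.Gamma (1 / 2 - (x + y * I))‖ * |y| ^ (m + K) := by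
        gcongr
        omega
    _ ≤ C := h1.trans (h2.trans ((le_abs_self _).trans h3))

theorem exists_norm_Gamma_half_le (m : ℕ) :
    ∃ C, 0 ≤ C ∧ ∀ y : ℝ, ‖Complex.Gamma (1 / 2 - y * I)‖ * (1 + |y|) ^ m ≤ C := by
  obtain ⟨C, hC, h⟩ := exists_norm_Gamma_strip_le 0 m
  have hΓ : 0 ≤ Real.Gamma (1 / 2) := (Real.Gamma_pos_of_pos (by norm_num)).le
  refine ⟨2 ^ m * (C + Real.Gamma (1 / 2)), by positivity, fun y => ?_⟩
  rcases le_total 1 |y| with hy | hy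
  · have h1 := h 0 (by simp) y hy
    simp only [Complex.ofReal_zero, zero_add] at h1
    calc _ ≤ ‖Complex.Gamma (1 / 2 - y * I)‖ * (2 * |y|) ^ m := by gcongr; linarith
      _ = 2 ^ m * (‖Complex.Gamma (1 / 2 - y * I)‖ * |y| ^ m) := by ring
      _ ≤ _ := by gcongr; linarith
  · have h1 := norm_Gamma_le (s := 1 / 2 - y * I) (by simp)
    have h2 : (1 / 2 - y * I : ℂ).re = 1 / 2 := by simp
    rw [h2] at h1
    calc _ ≤ Real.Gamma (1 / 2) * 2 ^ m := by gcongr; linarith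
      _ ≤ _ := by nlinarith [pow_pos (zero_lt_two (α := ℝ)) m]

/-- On the line `Re s = 1/2 - (K + 1)` the Gamma function is factorially small, uniformly in `y`. -/
theorem norm_Gamma_shift_le (K : ℕ) (y : ℝ) :
    ‖Complex.Gamma (1 / 2 - (((K : ℕ) + 1 : ℂ) + y * I))‖ * K.factorial ≤
      2 * ‖Complex.Gamma (1 / 2 - y * I)‖ := by
  have step : ∀ k : ℕ, ((k : ℝ) + 1 / 2) * ‖Complex.Gamma (1 / 2 - ((k + 1 : ℂ) + y * I))‖ ≤
      ‖Complex.Gamma (1 / 2 - (k + y * I))‖ := by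
    intro k
    set s : ℂ := 1 / 2 - ((k + 1 : ℂ) + y * I) with hs
    have hre : s.re = -((k : ℝ) + 1 / 2) := by simp [hs]; ring
    have hk : (0 : ℝ) < (k : ℝ) + 1 / 2 := by positivity
    have h1 : (k : ℝ) + 1 / 2 ≤ ‖s‖ := by
      refine le_trans ?_ (Complex.abs_re_le_norm s)
      rw [hre, abs_neg, abs_of_pos hk]
    have hs0 : s ≠ 0 := norm_pos_iff.1 (hk.trans_le h1)
    have h2 : (1 / 2 - (k + y * I) : ℂ) = s + 1 := by rw [hs]; ring
    rw [h2, Complex.Gamma_add_one _ hs0, norm_mul]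
    gcongr
  induction K with
  | zero =>
    have := step 0
    simp at this ⊢
    linarith
  | succ K ih =>
    have h1 := step (K + 1)
    rw [Nat.factorial_succ]
    push_cast at h1 ⊢
    set u := ‖Complex.Gamma (1 / 2 - ((K + 1 + 1 : ℂ) + y * I))‖ with hu
    have hu0 : 0 ≤ u := norm_nonneg _
    have h2 : ((K : ℝ) + 1) * u ≤ ‖Complex.Gamma (1 / 2 - ((K + 1 : ℂ) + y * I))‖ := by
      linarith
    calc _ = (((K : ℝ) + 1) * u) * K.factorial := by ring
      _ ≤ ‖Complex.Gamma (1 / 2 - ((K + 1 : ℂ) + y * I))‖ * K.factorial := by gcongr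
      _ ≤ _ := ih

theorem summable_pow_div_factorial_shift (m : ℕ) :
    Summable fun N : ℕ => ((N : ℝ) + 2) ^ m / N.factorial := by
  refine Summable.of_nonneg_of_le (fun N => by positivity) (fun N => ?_)
    ((Real.summable_pow_div_factorial (Real.exp 1)).mul_left (m.factorial * Real.exp 2))
  have h1 := Real.pow_div_factorial_le_exp ((N : ℝ) + 2) (by positivity) m
  rw [div_le_iff₀ (by positivity)] at h1
  rw [← mul_div_assoc]
  gcongr
  calc _ ≤ Real.exp ((N : ℝ) + 2) * m.factorial := h1
    _ = _ := by rw [Real.exp_add, ← Real.exp_nat_mul, mul_one]; ring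

/-- The reflection formula: `Γ(1/2 - z)` as an entire function divided by `cos (π z)`. -/
theorem Gamma_half_sub {z : ℂ} (hz : -(1 / 2) < z.re) :
    Real.pi * (Complex.Gamma (1 / 2 + z))⁻¹ / Complex.cos (Real.pi * z) =
      Complex.Gamma (1 / 2 - z) := by
  have h1 := Complex.Gamma_mul_Gamma_one_sub (1 / 2 + z)
  have h2 : Complex.Gamma (1 / 2 + z) ≠ 0 :=
    Complex.Gamma_ne_zero_of_re_pos (by simp; linarith)
  have h3 : (1 : ℂ) - (1 / 2 + z) = 1 / 2 - z := by ring
  have h4 : (Real.pi : ℂ) * (1 / 2 + z) = Real.pi * z + Real.pi / 2 := by ring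
  rw [h3, h4, Complex.sin_add_pi_div_two] at h1
  rw [mul_comm, mul_div_assoc, ← h1, inv_mul_cancel_left₀ h2]

theorem sinh_le_norm_cos (u v : ℝ) : Real.sinh |v| ≤ ‖Complex.cos (u + v * I)‖ := by
  have h1 : Real.sinh |v| ^ 2 = Real.sinh v ^ 2 := by
    rcases abs_choice v with h | h <;> rw [h]
    rw [Real.sinh_neg, neg_sq]
  refine abs_le_of_sq_le_sq' ?_ (norm_nonneg _) |>.2
  have h2 : Complex.cos (u + v * I) =
      ((Real.cos u * Real.cosh v : ℝ) : ℂ) + ((-(Real.sin u * Real.sinh v) : ℝ) : ℂ) * I := by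
    rw [Complex.cos_add_mul_I]; push_cast; ring
  rw [h1, h2, ← Complex.normSq_eq_norm_sq, Complex.normSq_add_mul_I]
  nlinarith [Real.cosh_sq v, Real.sin_sq_add_cos_sq u, sq_nonneg (Real.cos u)]

theorem norm_cos_pi_mul_nat_add (K : ℕ) (y : ℝ) :
    ‖Complex.cos (Real.pi * (K + y * I))‖ = Real.cosh (Real.pi * y) := by
  have h1 : (Real.pi : ℂ) * (K + y * I) = (K * Real.pi : ℝ) + (Real.pi * y : ℝ) * I := by
    push_cast; ring
  rw [h1, Complex.cos_add_mul_I, ← Complex.ofReal_cos, ← Complex.ofReal_sin, Real.cos_nat_mul_pi,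
    Real.sin_nat_mul_pi]
  simp only [Complex.ofReal_zero, zero_mul, sub_zero]
  rw [norm_mul, ← Complex.ofReal_cosh, Complex.norm_real, Complex.norm_real,
    Real.norm_of_nonneg (Real.cosh_pos _).le]
  simp

theorem one_add_sq_le_cosh (y : ℝ) : 1 + y ^ 2 ≤ Real.cosh (Real.pi * y) := by
  have h1 : 1 + (Real.pi * y) ^ 2 / 2 ≤ Real.cosh (Real.pi * y) := by
    have h2 := Real.cosh_sq (Real.pi * y / 2)
    have h3 := Real.cosh_two_mul (Real.pi * y / 2)
    have h4 : 2 * (Real.pi * y / 2) = Real.pi * y := by ring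
    rw [h4] at h3
    have h5 : |Real.pi * y / 2| ≤ Real.sinh |Real.pi * y / 2| :=
      Real.self_le_sinh_iff.2 (abs_nonneg _)
    have h6 : Real.sinh |Real.pi * y / 2| ^ 2 = Real.sinh (Real.pi * y / 2) ^ 2 := by
      rcases abs_choice (Real.pi * y / 2) with h | h <;> rw [h]
      rw [Real.sinh_neg, neg_sq]
    have h7 := pow_le_pow_left₀ (abs_nonneg _) h5 2
    rw [h6, sq_abs] at h7
    nlinarith
  nlinarith [Real.pi_gt_three, sq_nonneg y, mul_nonneg (sq_nonneg y) (by nlinarith [Real.pi_gt_three] : (0 : ℝ) ≤ Real.pi ^ 2 - 2)]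

/-! ### The two kernels: expansion coefficients and interpolation -/

theorem exists_norm_sample_le {f : ℂ → ℂ}
    (hsum : Summable fun N : ℕ => ‖sample f (N + 1)‖ / ((N : ℝ) + 1)) :
    ∃ C, 0 ≤ C ∧ ∀ N : ℕ, ‖sample f N‖ ≤ C * ((N : ℝ) + 1) := by
  obtain ⟨B, hB⟩ := hsum.tendsto_atTop_zero.bddAbove_range
  have hB' : ∀ N : ℕ, ‖sample f (N + 1)‖ / ((N : ℝ) + 1) ≤ B := fun N => hB ⟨N, rfl⟩
  have hB0 : 0 ≤ B := le_trans (by positivity) (hB' 0)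
  refine ⟨‖sample f 0‖ + B, by positivity, fun N => ?_⟩
  cases N with
  | zero => simpa using hB0
  | succ N =>
    have h1 := hB' N
    rw [div_le_iff₀ (by positivity)] at h1
    have h2 := norm_nonneg (sample f 0)
    have hN : (0 : ℝ) ≤ N := N.cast_nonneg
    push_cast
    nlinarith [mul_nonneg h2 hN]

theorem summable_coeffTerm {f : ℂ → ℂ}
    (hsum : Summable fun N : ℕ => ‖sample f (N + 1)‖ / ((N : ℝ) + 1)) (n : ℕ) :
    Summable (coeffTerm f n) := by
  obtain ⟨C, hC, h1⟩ := exists_norm_sample_le hsum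
  obtain ⟨B, hB, h2⟩ := exists_norm_P_le n
  refine Summable.of_norm_bounded ((summable_pow_div_factorial_shift (n + 1)).mul_left (C * B))
    fun N => ?_
  have h3 : ‖(N : ℂ) + 1 / 2‖ ≤ N + 1 := by
    refine (norm_add_le _ _).trans ?_
    rw [Complex.norm_natCast]
    norm_num
  have h4 := h2 (-I * ((N : ℂ) + 1 / 2))
  rw [norm_mul, norm_neg, Complex.norm_I, one_mul] at h4
  rw [coeffTerm, norm_mul, norm_mul, norm_div, norm_pow, norm_neg, norm_one, one_pow,
    Complex.norm_natCast]
  calc _ ≤ 1 / (N.factorial : ℝ) * (C * ((N : ℝ) + 1)) * (B * (1 + ((N : ℝ) + 1)) ^ n) := by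
        gcongr
        · exact h1 N
        · refine h4.trans ?_
          gcongr
    _ ≤ 1 / (N.factorial : ℝ) * (C * ((N : ℝ) + 2)) * (B * ((N : ℝ) + 2) ^ n) := by
        have e1 : (N : ℝ) + 1 ≤ N + 2 := by linarith
        have e2 : 1 + ((N : ℝ) + 1) = N + 2 := by ring
        rw [e2]
        gcongr
    _ = _ := by ring

/-- The half-plane residue theorem for the kernel `Γ(1/2 - z) P_n(-i z)`. -/
theorem HardyWithPole.tsum_coeffTerm {f g : ℂ → ℂ} {zp R : ℂ} {M : ℝ}
    (h : HardyWithPole f g zp R M)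
    (hsum : Summable fun N : ℕ => ‖sample f (N + 1)‖ / ((N : ℝ) + 1)) (n : ℕ) :
    2 * ∑' N : ℕ, coeffTerm f n N =
      ((∫ y : ℝ, f (y * I) * (Complex.Gamma (1 / 2 - y * I) * P n y)) +
        2 * Real.pi * (R * (Complex.Gamma (1 / 2 - zp) * P n (-I * zp)))) / Real.pi := by
  have hpi : (Real.pi : ℂ) ≠ 0 := by exact_mod_cast Real.pi_ne_zero
  set q : ℂ → ℂ := fun z => Real.pi * (Complex.Gamma (1 / 2 + z))⁻¹ * P n (-I * z) with hq
  have hqW : ∀ z : ℂ, -(1 / 2) < z.re → q z / Complex.cos (Real.pi * z) =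
      Complex.Gamma (1 / 2 - z) * P n (-I * z) := fun z hz => by
    rw [← Gamma_half_sub hz, hq]; ring
  have hI : ∀ z : ℂ, ‖-I * z‖ = ‖z‖ := fun z => by simp
  obtain ⟨B, hB, hP⟩ := exists_norm_P_le n
  have hP' : ∀ x y : ℝ, 0 ≤ x → ‖P n (-I * (x + y * I))‖ ≤ B * ((1 + x) ^ n * (1 + |y|) ^ n) := by
    intro x y hx
    refine (hP _).trans ?_
    rw [hI, ← mul_pow]
    have h1 : ‖(x : ℂ) + y * I‖ ≤ x + |y| := by
      refine (norm_add_le _ _).trans ?_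
      simp [abs_of_nonneg hx]
    have h2 := abs_nonneg y
    gcongr
    nlinarith [mul_nonneg hx h2]
  have hsq : ∀ y : ℝ, 1 + y ^ 2 ≤ (1 + |y|) ^ 2 := fun y => by
    nlinarith [sq_abs y, abs_nonneg y]
  obtain ⟨G, hG, hΓ⟩ := exists_norm_Gamma_half_le (n + 2)
  have hΓ' : ∀ y : ℝ, ‖Complex.Gamma (1 / 2 - y * I)‖ * (1 + |y|) ^ n ≤ G * (1 + y ^ 2)⁻¹ := by
    intro y
    rw [← div_eq_mul_inv, le_div_iff₀ (by positivity)]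
    calc _ ≤ ‖Complex.Gamma (1 / 2 - y * I)‖ * (1 + |y|) ^ n * (1 + |y|) ^ 2 := by
          gcongr; exact hsq y
      _ = ‖Complex.Gamma (1 / 2 - y * I)‖ * (1 + |y|) ^ (n + 2) := by ring
      _ ≤ G := hΓ y
  have key := h.tendsto_sum_nodes (q := q) (A := ∅) (σ := 0) (C := G * B)
    (κ := fun K => 2 * G * B * (((K - 1 : ℕ) + 2 : ℝ) ^ n / (K - 1).factorial))
    (by simp)
    (by
      refine Differentiable.differentiableOn ?_
      refine Differentiable.mul (Differentiable.const_mul ?_ _) ?_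
      · exact Complex.differentiable_one_div_Gamma.comp (by fun_prop)
      · exact (differentiable_P n).comp (by fun_prop))
    (by simp)
    (by
      intro y
      rw [hqW _ (by simp), norm_mul]
      have h1 := hP' 0 y le_rfl
      simp only [Complex.ofReal_zero, zero_add, add_zero, one_pow, one_mul] at h1
      calc _ ≤ ‖Complex.Gamma (1 / 2 - y * I)‖ * (B * (1 + |y|) ^ n) := by gcongr
        _ = ‖Complex.Gamma (1 / 2 - y * I)‖ * (1 + |y|) ^ n * B := by ring
        _ ≤ G * (1 + y ^ 2)⁻¹ * B := mul_le_mul_of_nonneg_right (hΓ' y) hB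
        _ = _ := by ring)
    (by
      have h1 := ((summable_pow_div_factorial_shift n).tendsto_atTop_zero.comp
        (tendsto_sub_atTop_nat 1)).const_mul (2 * G * B)
      simpa using h1)
    (by
      filter_upwards [eventually_gt_atTop 0] with K hK y
      obtain ⟨k, rfl⟩ := Nat.exists_eq_succ_of_ne_zero hK.ne'
      have hk : (0 : ℝ) ≤ k := k.cast_nonneg
      rw [hqW _ (by simp; linarith), norm_mul]
      have h1 := norm_Gamma_shift_le k y
      have h2 := hP' (k + 1) y (by positivity)
      rw [← le_div_iff₀ (by positivity)] at h1
      simp only [Nat.succ_eq_add_one, Nat.add_sub_cancel]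
      push_cast at h2 ⊢
      calc _ ≤ 2 * ‖Complex.Gamma (1 / 2 - y * I)‖ / k.factorial *
            (B * ((1 + (k + 1 : ℝ)) ^ n * (1 + |y|) ^ n)) := by gcongr
        _ = (‖Complex.Gamma (1 / 2 - y * I)‖ * (1 + |y|) ^ n) *
            (2 * B * ((k + 2 : ℝ) ^ n / k.factorial)) := by ring
        _ ≤ (G * (1 + y ^ 2)⁻¹) * (2 * B * ((k + 2 : ℝ) ^ n / k.factorial)) :=
            mul_le_mul_of_nonneg_right (hΓ' y) (by positivity)
        _ = _ := by ring)
    (by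
      intro K ε hε
      obtain ⟨D, hD, hΓK⟩ := exists_norm_Gamma_strip_le K (n + 1)
      have hb : ∀ x ∈ Set.Icc (0 : ℝ) K, ∀ y : ℝ, 1 ≤ |y| →
          ‖q (x + y * I) / Complex.cos (Real.pi * (x + y * I))‖ ≤
            D * B * (1 + K) ^ n * 2 ^ n / |y| := by
        intro x hx y hy
        have hx0 := hx.1
        have hxK := hx.2
        have hy0 : 0 < |y| := by linarith
        rw [hqW _ (by simp; linarith), norm_mul, le_div_iff₀ hy0]
        calc _ ≤ ‖Complex.Gamma (1 / 2 - (x + y * I))‖ * (B * ((1 + K) ^ n * (2 * |y|) ^ n)) *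
              |y| := by
              gcongr
              refine (hP' x y hx.1).trans ?_
              gcongr
              linarith
          _ = ‖Complex.Gamma (1 / 2 - (x + y * I))‖ * |y| ^ (n + 1) *
              (B * (1 + K) ^ n * 2 ^ n) := by ring
          _ ≤ D * (B * (1 + K) ^ n * 2 ^ n) := by gcongr; exact hΓK x hx y hy
          _ = _ := by ring
      have hlim : Tendsto (fun T : ℝ => D * B * (1 + K) ^ n * 2 ^ n / |T|) atTop (𝓝 0) :=
        tendsto_const_nhds.div_atTop tendsto_abs_atTop_atTop
      filter_upwards [hlim.eventually_le_const hε, eventually_ge_atTop 1] with T hT hT1 x hx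
      have hT1' : 1 ≤ |T| := hT1.trans (le_abs_self _)
      exact ⟨(hb x hx T hT1').trans hT, (hb x hx (-T) (by rwa [abs_neg])).trans (by rwa [abs_neg])⟩)
  have hterm : ∀ N : ℕ, 2 * ((-1) ^ N * f ((N : ℂ) + 1 / 2) * q ((N : ℂ) + 1 / 2)) =
      Real.pi * (2 * coeffTerm f n N) := by
    intro N
    have h1 : (1 / 2 + ((N : ℂ) + 1 / 2)) = N + 1 := by ring
    simp only [hq, coeffTerm, sample]
    rw [h1, Complex.Gamma_nat_eq_factorial]
    ring
  have h1 := ((summable_coeffTerm hsum n).hasSum.tendsto_sum_nat.const_mul (2 : ℂ)).const_mul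
    (Real.pi : ℂ)
  have h2 := key.2
  simp only [hterm, ← Finset.mul_sum] at h2
  have h3 := tendsto_nhds_unique h1 h2
  rw [eq_div_iff hpi, mul_comm, h3]
  have h4 : ∀ y : ℝ, -I * (y * I) = y := fun y => by
    linear_combination (-(y : ℂ)) * Complex.I_sq
  congr 2
  · ext y
    rw [hqW _ (by simp), h4]
  · rw [hqW _ (by linarith [h.re_pos])]
    simp

/-- The half-plane residue theorem for the kernel `1 / ((x + 1/2 - z) cos (π z))`, when `x + 1/2` is
not a node. -/
theorem HardyWithPole.tendsto_interpolation {f g : ℂ → ℂ} {zp R : ℂ} {M : ℝ}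
    (h : HardyWithPole f g zp R M) {x : ℝ} (hx : -(1 / 2) < x) (hxp : (x : ℂ) + 1 / 2 ≠ zp)
    (hxN : ∀ N : ℕ, x ≠ N) :
    Tendsto (fun K : ℕ => ∑ N ∈ Finset.range K,
        2 * ((-1) ^ N * sample f N * ((x : ℂ) - N)⁻¹)) atTop
      (𝓝 ((∫ y : ℝ, f (y * I) / (((x : ℂ) + 1 / 2 - I * y) * ((Real.cosh (Real.pi * y) : ℝ) : ℂ))) +
        2 * Real.pi * (R / (((x : ℂ) + 1 / 2 - zp) * Complex.cos (Real.pi * zp)) +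
          f ((x : ℂ) + 1 / 2) / Complex.sin (Real.pi * x)))) := by
  set a : ℂ := (x : ℂ) + 1 / 2 with ha
  have hare : a.re = x + 1 / 2 := by simp [ha]
  have haim : a.im = 0 := by simp [ha]
  have ha0 : 0 < x + 1 / 2 := by linarith
  set q : ℂ → ℂ := fun z => (a - z)⁻¹ with hq
  have hqn : ∀ z : ℂ, ‖q z‖ = ‖a - z‖⁻¹ := fun z => norm_inv _
  have hcos1 : ∀ K : ℕ, ∀ y : ℝ,
      ‖Complex.cos (Real.pi * (K + y * I))‖⁻¹ ≤ (1 + y ^ 2)⁻¹ := fun K y => by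
    rw [norm_cos_pi_mul_nat_add]
    exact inv_anti₀ (by positivity) (one_add_sq_le_cosh y)
  have key := h.tendsto_sum_nodes (q := q) (A := {a}) (σ := fun _ => -1) (C := (x + 1 / 2)⁻¹)
    (κ := fun K => ((K : ℝ) - (x + 1 / 2))⁻¹)
    (by
      intro b hb
      rw [Finset.mem_singleton] at hb
      subst hb
      refine ⟨by rw [hare]; exact ha0, hxp, fun N hN => hxN N ?_⟩
      have : (x : ℂ) = N := by rw [ha] at hN; exact add_right_cancel hN
      exact_mod_cast this)
    (by
      intro z hz
      have : a - z ≠ 0 := sub_ne_zero.2 fun hh => hz.2 (by simp [hh])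
      exact DifferentiableAt.differentiableWithinAt (by fun_prop (disch := assumption)))
    (by
      intro b hb
      rw [Finset.mem_singleton] at hb
      subst hb
      refine tendsto_const_nhds.congr' ?_
      filter_upwards [self_mem_nhdsWithin] with z hz
      have : a - z ≠ 0 := sub_ne_zero.2 fun hh => hz hh.symm
      simp only [hq]
      field_simp
      ring)
    (by
      intro y
      rw [norm_div, div_eq_mul_inv, hqn]
      have h1 := hcos1 0 y
      simp only [Nat.cast_zero, zero_add] at h1
      gcongr
      refine le_trans ?_ (Complex.abs_re_le_norm _)
      have : (a - y * I).re = x + 1 / 2 := by simp [hare]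
      rw [this]
      exact le_abs_self _)
    (tendsto_inv_atTop_zero.comp
      (tendsto_atTop_add_const_right _ _ tendsto_natCast_atTop_atTop))
    (by
      filter_upwards [tendsto_natCast_atTop_atTop.eventually_gt_atTop (x + 1 / 2)] with K hK y
      rw [norm_div, div_eq_mul_inv, hqn]
      have h1 := hcos1 K y
      have h2 : 0 < (K : ℝ) - (x + 1 / 2) := by linarith
      gcongr
      refine le_trans ?_ (Complex.abs_re_le_norm _)
      have : (a - (K + y * I)).re = -(K - (x + 1 / 2)) := by simp [hare]
      rw [this]
      exact neg_le_abs (-((K : ℝ) - (x + 1 / 2))) |>.trans' (by simp))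
    (by
      intro K ε hε
      have hb : ∀ x' y : ℝ, 1 ≤ |y| →
          ‖q (x' + y * I) / Complex.cos (Real.pi * (x' + y * I))‖ ≤ 1 / |y| := by
        intro x' y hy
        have hy0 : 0 < |y| := by linarith
        rw [norm_div, div_eq_mul_inv, hqn, one_div]
        have h1 : 1 ≤ ‖Complex.cos (Real.pi * (x' + y * I))‖ := by
          have h2 := sinh_le_norm_cos (Real.pi * x') (Real.pi * y)
          have h3 : |Real.pi * y| ≤ Real.sinh |Real.pi * y| :=
            Real.self_le_sinh_iff.2 (abs_nonneg _)
          rw [abs_mul, abs_of_pos Real.pi_pos] at h3 h2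
          have h4 : ((Real.pi * x' : ℝ) : ℂ) + (Real.pi * y : ℝ) * I =
              Real.pi * (x' + y * I) := by push_cast; ring
          rw [h4] at h2
          nlinarith [Real.pi_gt_three]
        have h5 : |y| ≤ ‖a - (x' + y * I)‖ := by
          refine le_trans (le_of_eq ?_) (Complex.abs_im_le_norm _)
          have : (a - (x' + y * I)).im = -y := by simp [haim]
          rw [this, abs_neg]
        calc _ ≤ |y|⁻¹ * 1⁻¹ := by gcongr
          _ = _ := by simp
      have hlim : Tendsto (fun T : ℝ => 1 / |T|) atTop (𝓝 0) :=
        tendsto_const_nhds.div_atTop tendsto_abs_atTop_atTop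
      filter_upwards [hlim.eventually_le_const hε, eventually_ge_atTop 1] with T hT hT1 x' _
      have hT1' : 1 ≤ |T| := hT1.trans (le_abs_self _)
      exact ⟨(hb x' T hT1').trans hT, (hb x' (-T) (by rwa [abs_neg])).trans (by rwa [abs_neg])⟩)
  have h2 := key.2
  have hnode : ∀ N : ℕ, q ((N : ℂ) + 1 / 2) = ((x : ℂ) - N)⁻¹ := fun N => by
    simp only [hq, ha]; congr 1; ring
  simp only [hnode, Finset.sum_singleton] at h2
  have hcosa : Complex.cos (Real.pi * a) = -Complex.sin (Real.pi * x) := by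
    rw [ha, mul_add, show (Real.pi : ℂ) * (1 / 2) = Real.pi / 2 by ring,
      Complex.cos_add_pi_div_two]
  rw [hcosa] at h2
  have e1 : ∀ y : ℝ, f (y * I) / ((a - I * y) * ((Real.cosh (Real.pi * y) : ℝ) : ℂ)) =
      f (y * I) * (q (y * I) / Complex.cos (Real.pi * (y * I))) := fun y => by
    have h3 : (Real.pi : ℂ) * (y * I) = (Real.pi * y : ℝ) * I := by push_cast; ring
    rw [h3, Complex.cos_mul_I, ← Complex.ofReal_cosh, mul_comm I]
    simp only [hq, div_eq_mul_inv, mul_inv]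
  have e2 : R / ((a - zp) * Complex.cos (Real.pi * zp)) + f a / Complex.sin (Real.pi * x) =
      R * (q zp / Complex.cos (Real.pi * zp)) + -1 * (f a / -Complex.sin (Real.pi * x)) := by
    simp only [hq, div_eq_mul_inv, mul_inv, inv_neg]
    ring
  simp only [e1]
  rw [e2]
  exact h2

/-! ### Orthogonality of the Meixner--Pollaczek polynomials -/

theorem one_add_abs_pow_le_cosh (m : ℕ) (y : ℝ) :
    (1 + |y|) ^ m ≤ 2 * Real.exp 1 * m.factorial * Real.cosh (Real.pi * y) := by
  have h1 := Real.pow_div_factorial_le_exp (1 + |y|) (by positivity) m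
  rw [div_le_iff₀ (by positivity)] at h1
  have h2 : Real.exp |y| ≤ 2 * Real.cosh (Real.pi * y) := by
    rw [← Real.cosh_abs, Real.cosh_eq, abs_mul, abs_of_pos Real.pi_pos]
    have h3 : Real.exp |y| ≤ Real.exp (Real.pi * |y|) := by
      rw [Real.exp_le_exp]
      nlinarith [Real.pi_gt_three, abs_nonneg y]
    have := Real.exp_pos (-(Real.pi * |y|))
    linarith
  calc _ ≤ Real.exp (1 + |y|) * m.factorial := h1
    _ = Real.exp 1 * m.factorial * Real.exp |y| := by rw [Real.exp_add]; ring
    _ ≤ Real.exp 1 * m.factorial * (2 * Real.cosh (Real.pi * y)) := by gcongr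
    _ = _ := by ring

theorem integrable_div_cosh {u : ℝ → ℂ} (hu : Continuous u) {C : ℝ} {n : ℕ} (hC : 0 ≤ C)
    (hb : ∀ y : ℝ, ‖u y‖ ≤ C * (1 + |y|) ^ n) :
    Integrable fun y : ℝ => u y / ((Real.cosh (Real.pi * y) : ℝ) : ℂ) := by
  set B : ℝ := 2 * Real.exp 1 * (n + 2).factorial with hB
  refine (integrable_inv_one_add_sq.const_mul (C * B)).mono' ?_ (Eventually.of_forall fun y => ?_)
  · refine Continuous.aestronglyMeasurable (hu.div (by fun_prop) fun y => ?_)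
    exact_mod_cast (Real.cosh_pos _).ne'
  · have hc := Real.cosh_pos (Real.pi * y)
    rw [norm_div, Complex.norm_real, Real.norm_of_nonneg hc.le, ← div_eq_mul_inv,
      div_le_div_iff₀ hc (by positivity)]
    have h1 := one_add_abs_pow_le_cosh (n + 2) y
    have h2 : 1 + y ^ 2 ≤ (1 + |y|) ^ 2 := by nlinarith [sq_abs y, abs_nonneg y]
    calc _ ≤ C * (1 + |y|) ^ n * (1 + |y|) ^ 2 := by gcongr; exact hb y
      _ = C * (1 + |y|) ^ (n + 2) := by ring
      _ ≤ C * (B * Real.cosh (Real.pi * y)) := by gcongr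
      _ = _ := by ring

/-- Moving the line of integration by one period of `1 / cosh (π y)`, across a single pole. -/
theorem integral_shift_div_cosh {p : ℂ → ℂ} (hp : Differentiable ℂ p) {C : ℝ} {n : ℕ} (hC : 0 ≤ C)
    (hb : ∀ z : ℂ, ‖p z‖ ≤ C * (1 + ‖z‖) ^ n) :
    ∫ y : ℝ, (p y + p (y - I)) / ((Real.cosh (Real.pi * y) : ℝ) : ℂ) = 2 * p (-I / 2) := by
  have hpc := hp.continuous
  set H : ℂ → ℂ := fun z => p (-I * z) * (Complex.cos (Real.pi * z))⁻¹ with hH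
  have hb' : ∀ x ∈ Set.Icc (0 : ℝ) 1, ∀ y : ℝ,
      ‖p (-I * (x + y * I))‖ ≤ C * 2 ^ n * (1 + |y|) ^ n := by
    intro x hx y
    refine (hb _).trans ?_
    rw [mul_assoc, ← mul_pow]
    have h1 : ‖-I * ((x : ℂ) + y * I)‖ ≤ 1 + |y| := by
      rw [norm_mul, norm_neg, Complex.norm_I, one_mul]
      refine (norm_add_le _ _).trans ?_
      rw [Complex.norm_real, Real.norm_of_nonneg hx.1]
      simpa using hx.2
    gcongr
    linarith [abs_nonneg y]
  have e0 : ∀ y : ℝ, H ((0 : ℝ) + y * I) = p y / ((Real.cosh (Real.pi * y) : ℝ) : ℂ) := by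
    intro y
    have h1 : (Real.pi : ℂ) * ((0 : ℝ) + y * I) = (Real.pi * y : ℝ) * I := by push_cast; ring
    have h2 : -I * ((0 : ℝ) + y * I) = y := by
      push_cast
      linear_combination (-(y : ℂ)) * Complex.I_sq
    simp only [hH]
    rw [h1, h2, Complex.cos_mul_I, ← Complex.ofReal_cosh, div_eq_mul_inv]
  have e1 : ∀ y : ℝ, H ((1 : ℝ) + y * I) =
      -(p (y - I) / ((Real.cosh (Real.pi * y) : ℝ) : ℂ)) := by
    intro y
    have h1 : (Real.pi : ℂ) * ((1 : ℝ) + y * I) = (Real.pi * y : ℝ) * I + Real.pi := by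
      push_cast; ring
    have h2 : -I * ((1 : ℝ) + y * I) = y - I := by
      push_cast
      linear_combination (-(y : ℂ)) * Complex.I_sq
    simp only [hH]
    rw [h1, h2, Complex.cos_add_pi, Complex.cos_mul_I, ← Complex.ofReal_cosh, inv_neg,
      div_eq_mul_inv, mul_neg]
  have i0 : Integrable fun y : ℝ => p y / ((Real.cosh (Real.pi * y) : ℝ) : ℂ) :=
    integrable_div_cosh (by fun_prop) hC fun y => by simpa using hb y
  have i1 : Integrable fun y : ℝ => p (y - I) / ((Real.cosh (Real.pi * y) : ℝ) : ℂ) :=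
    integrable_div_cosh (C := C * 2 ^ n) (n := n) (by fun_prop) (by positivity) fun y => by
      have := hb' 1 (by simp) y
      have h2 : -I * ((1 : ℝ) + y * I) = y - I := by
        push_cast
        linear_combination (-(y : ℂ)) * Complex.I_sq
      rwa [h2] at this
  have hcosd : ∀ z : ℂ, 0 ≤ z.re ∧ z.re ≤ 1 → z ∉ ({1 / 2} : Finset ℂ) →
      DifferentiableAt ℂ H z := by
    intro z hz hz2
    have hne : Complex.cos (Real.pi * z) ≠ 0 := cos_pi_mul_ne_zero (by linarith [hz.1]) fun N hN => by
      rcases Nat.eq_zero_or_pos N with rfl | hN0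
      · exact hz2 (by simp [hN])
      · have h1 : z.re = N + 1 / 2 := by rw [hN]; simp
        have h2 : (1 : ℝ) ≤ N := by exact_mod_cast hN0
        linarith [hz.2]
    have h1 : DifferentiableAt ℂ (fun z : ℂ => (Complex.cos (Real.pi * z))⁻¹) z :=
      DifferentiableAt.inv (by fun_prop) hne
    exact DifferentiableAt.mul (by fun_prop) h1
  have hhor : ∀ e : ℝ, (e = 1 ∨ e = -1) →
      Tendsto (fun N : ℕ => ∫ x : ℝ in (0 : ℝ)..1, H (x + (e * N : ℝ) * I)) atTop (𝓝 0) := by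
    intro e he
    set B : ℝ := 2 * Real.exp 1 * (n + 1).factorial with hB
    have hlim : Tendsto (fun N : ℕ => C * 2 ^ n * (2 * B) / (N : ℝ)) atTop (𝓝 0) :=
      tendsto_const_nhds.div_atTop tendsto_natCast_atTop_atTop
    refine squeeze_zero_norm' ?_ hlim
    filter_upwards [eventually_ge_atTop 1] with N hN
    have hN1 : (1 : ℝ) ≤ N := by exact_mod_cast hN
    have habs : |e * N| = N := by
      rcases he with rfl | rfl <;> simp
    have := intervalIntegral.norm_integral_le_of_norm_le_const (a := 0) (b := 1)
      (f := fun x : ℝ => H (x + (e * N : ℝ) * I)) (C := C * 2 ^ n * (2 * B) / (N : ℝ)) fun x hx => by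
        rw [Set.uIoc_of_le zero_le_one] at hx
        have h1 := hb' x (Set.Ioc_subset_Icc_self hx) (e * N)
        have h2 := sinh_le_norm_cos (Real.pi * x) (Real.pi * (e * N))
        have h4 : ((Real.pi * x : ℝ) : ℂ) + (Real.pi * (e * N) : ℝ) * I =
            Real.pi * (x + (e * N : ℝ) * I) := by push_cast; ring
        rw [h4, abs_mul, habs, abs_of_pos Real.pi_pos] at h2
        have h5 := one_add_abs_pow_le_cosh (n + 1) (N : ℝ)
        have h6 : Real.cosh (Real.pi * N) ≤ 2 * Real.sinh (Real.pi * N) := by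
          have h7 := Real.cosh_sub_sinh (Real.pi * N)
          have h8 : Real.exp (-(Real.pi * N)) ≤ 1 := by
            rw [Real.exp_le_one_iff]; have := Real.pi_pos; nlinarith
          have h9 : Real.pi * N ≤ Real.sinh (Real.pi * N) :=
            Real.self_le_sinh_iff.2 (by positivity)
          nlinarith [Real.pi_gt_three]
        rw [habs] at h1
        rw [Nat.abs_cast] at h5
        have hs0 : 0 < Real.sinh (Real.pi * N) := Real.sinh_pos_iff.2 (by positivity)
        have hB0 : 0 ≤ B := by positivity
        have h10 : (1 + (N : ℝ)) ^ n * N ≤ 2 * B * Real.sinh (Real.pi * N) := by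
          calc (1 + (N : ℝ)) ^ n * N ≤ (1 + (N : ℝ)) ^ n * (1 + N) := by gcongr; linarith
            _ = (1 + (N : ℝ)) ^ (n + 1) := by ring
            _ ≤ B * Real.cosh (Real.pi * N) := h5
            _ ≤ B * (2 * Real.sinh (Real.pi * N)) := by gcongr
            _ = _ := by ring
        rw [hH]
        simp only
        rw [norm_mul, norm_inv, ← div_eq_mul_inv, div_le_div_iff₀ (hs0.trans_le h2) (by linarith)]
        calc _ ≤ C * 2 ^ n * (1 + (N : ℝ)) ^ n * N := by gcongr
          _ = C * 2 ^ n * ((1 + (N : ℝ)) ^ n * N) := by ring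
          _ ≤ C * 2 ^ n * (2 * B * Real.sinh (Real.pi * N)) := by gcongr
          _ = C * 2 ^ n * (2 * B) * Real.sinh (Real.pi * N) := by ring
          _ ≤ _ := by gcongr
    simpa using this
  have key := integral_line_sub_integral_line (K := 1) one_pos
    (fun _ => -1 / Real.pi * p (-I / 2)) {1 / 2} (by
      intro s hs
      rw [Finset.mem_singleton] at hs
      subst hs
      norm_num) H
    (fun z hz => (hcosd z hz.1 (by simpa using hz.2)).continuousAt.continuousWithinAt)
    (fun z hz => (hcosd z ⟨hz.1.1.le, hz.1.2.le⟩ (by simpa using hz.2)).differentiableWithinAt)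
    (by
      intro s hs
      rw [Finset.mem_singleton] at hs
      subst hs
      have h1 := tendsto_sub_div_cos 0
      have h2 : ContinuousAt (fun z => p (-I * z)) (1 / 2) := by fun_prop
      have h3 := h2.tendsto.mono_left (nhdsWithin_le_nhds (s := {(1 / 2 : ℂ)}ᶜ))
      simp only [Nat.cast_zero, zero_add, pow_zero] at h1
      have h4 := h1.mul h3
      rw [show -I * (1 / 2) = -I / 2 by ring] at h4
      refine h4.congr fun z => ?_
      simp only [hH]
      ring)
    (by simpa only [e0] using i0) (by simp only [e1]; exact i1.neg)
    tendsto_natCast_atTop_atTop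
    (by simpa using hhor 1 (Or.inl rfl)) (by simpa using hhor (-1) (Or.inr rfl))
  simp only [e0, e1, Finset.sum_singleton] at key
  rw [integral_neg] at key
  simp only [add_div]
  rw [integral_add i0 i1]
  have hpi : (Real.pi : ℂ) ≠ 0 := by exact_mod_cast Real.pi_ne_zero
  have h5 : (2 : ℂ) * Real.pi * (-1 / Real.pi * p (-I / 2)) = -(2 * p (-I / 2)) := by field_simp
  rw [h5] at key
  linear_combination -key

/-- The polynomial `E_n(u) = P_n(u - i/2) + i P_{n-1}(u - i/2)` has generating function
`exp (2 u arctan t)`, whose symmetry `(u, t) ↦ (-u, -t)` and the parity of `P_n` give this identity. -/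
theorem P_sub_I (n : ℕ) (z : ℂ) :
    P (n + 1) (z - I) + I * P n (z - I) = P (n + 1) z - I * P n z := by
  have hI := Complex.I_sq
  induction n using Nat.twoStepInduction with
  | zero => simp [P]; ring
  | one =>
    simp [P]
    linear_combination (0 : ℂ) * hI
  | more n h0 h1 =>
    have a3 := P_succ_succ (n + 1) (z - I)
    have a2 := P_succ_succ n (z - I)
    have b3 := P_succ_succ (n + 1) z
    have b2 := P_succ_succ n z
    have hn : (n : ℂ) + 3 ≠ 0 := by exact_mod_cast (n + 2).succ_ne_zero
    refine mul_left_cancel₀ hn ?_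
    push_cast at a3 b3
    linear_combination a3 - b3 + (2 * z - I) * h1 + I * a2 + I * b2 - ((n : ℂ) + 1) * h0 -
      (P (n + 1) (z - I) - P (n + 1) z) * hI

theorem P_neg_I_half (n : ℕ) : P n (-I / 2) = (-I) ^ n := by
  have hI := Complex.I_sq
  induction n using Nat.twoStepInduction with
  | zero => simp [P]
  | one => simp [P]; ring
  | more n h0 h1 =>
    rw [P, h0, h1]
    have hn : (n : ℂ) + 2 ≠ 0 := by exact_mod_cast (n + 1).succ_ne_zero
    rw [div_eq_iff hn, pow_succ, pow_succ]
    linear_combination (-I) ^ n * (n + 1) * (-hI)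

theorem two_mul_P (n : ℕ) (z : ℂ) :
    2 * z * P n z = ((n : ℂ) + 1) * P (n + 1) z + n * P (n - 1) z := by
  cases n with
  | zero => simp [P]
  | succ n =>
    have := P_succ_succ n z
    push_cast
    linear_combination -this

theorem integrable_P_mul_P (n m : ℕ) :
    Integrable fun y : ℝ => P n y * P m y / ((Real.cosh (Real.pi * y) : ℝ) : ℂ) := by
  obtain ⟨A, hA, hPA⟩ := exists_norm_P_le n
  obtain ⟨B, hB, hPB⟩ := exists_norm_P_le m
  have := (differentiable_P n).continuous
  have := (differentiable_P m).continuous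
  refine integrable_div_cosh (C := A * B) (n := n + m) (by fun_prop) (by positivity) fun y => ?_
  rw [norm_mul, pow_add]
  have h1 := hPA y
  have h2 := hPB y
  rw [Complex.norm_real, Real.norm_eq_abs] at h1 h2
  calc _ ≤ A * (1 + |y|) ^ n * (B * (1 + |y|) ^ m) := by gcongr
    _ = _ := by ring

theorem integral_P_div_cosh (n : ℕ) :
    ∫ y : ℝ, P n y / ((Real.cosh (Real.pi * y) : ℝ) : ℂ) = if n = 0 then 1 else 0 := by
  cases n with
  | zero =>
    have h := integral_shift_div_cosh (p := fun _ => 1) (by fun_prop) (C := 1) (n := 0) zero_le_one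
      (by simp)
    have h1 : ∀ y : ℝ, ((1 : ℂ) + 1) / ((Real.cosh (Real.pi * y) : ℝ) : ℂ) =
        2 * (P 0 y / ((Real.cosh (Real.pi * y) : ℝ) : ℂ)) := fun y => by simp [P]; ring
    simp only [h1] at h
    rw [integral_const_mul] at h
    simpa using h
  | succ n =>
    obtain ⟨A, hA, hPA⟩ := exists_norm_P_le (n + 1)
    obtain ⟨B, hB, hPB⟩ := exists_norm_P_le n
    have d1 := differentiable_P (n + 1)
    have d2 := differentiable_P n
    have h := integral_shift_div_cosh (p := fun z => P (n + 1) z + I * P n z) (by fun_prop)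
      (C := A + B) (n := n + 1) (by positivity) (fun z => by
        refine (norm_add_le _ _).trans ?_
        rw [norm_mul, Complex.norm_I, one_mul, add_mul]
        refine add_le_add (hPA z) ((hPB z).trans ?_)
        gcongr
        · linarith [norm_nonneg z]
        · omega)
    have h1 : ∀ y : ℝ, (P (n + 1) y + I * P n y + (P (n + 1) (y - I) + I * P n (y - I))) /
        ((Real.cosh (Real.pi * y) : ℝ) : ℂ) =
        2 * (P (n + 1) y / ((Real.cosh (Real.pi * y) : ℝ) : ℂ)) := fun y => by
      rw [P_sub_I]; ring
    simp only [h1] at h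
    rw [integral_const_mul, P_neg_I_half, P_neg_I_half] at h
    have h2 : (-I) ^ (n + 1) + I * (-I) ^ n = 0 := by ring
    rw [h2] at h
    simpa using h

/-- Orthonormality for the weight `1 / cosh (π y)`. -/
theorem integral_P_mul_P (n m : ℕ) :
    ∫ y : ℝ, P n y * P m y / ((Real.cosh (Real.pi * y) : ℝ) : ℂ) = if n = m then 1 else 0 := by
  -- multiplication by `y` is symmetric, so the recurrence moves from one index to the other
  have step : ∀ n k : ℕ, ((k : ℂ) + 1) *
        (∫ y : ℝ, P n y * P (k + 1) y / ((Real.cosh (Real.pi * y) : ℝ) : ℂ)) =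
      ((n : ℂ) + 1) * (∫ y : ℝ, P (n + 1) y * P k y / ((Real.cosh (Real.pi * y) : ℝ) : ℂ)) +
      n * (∫ y : ℝ, P (n - 1) y * P k y / ((Real.cosh (Real.pi * y) : ℝ) : ℂ)) -
      k * (∫ y : ℝ, P n y * P (k - 1) y / ((Real.cosh (Real.pi * y) : ℝ) : ℂ)) := by
    intro n k
    rw [← integral_const_mul, ← integral_const_mul, ← integral_const_mul, ← integral_const_mul,
      ← integral_add ((integrable_P_mul_P _ _).const_mul _) ((integrable_P_mul_P _ _).const_mul _),
      ← integral_sub (by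
        exact ((integrable_P_mul_P _ _).const_mul _).add ((integrable_P_mul_P _ _).const_mul _))
        ((integrable_P_mul_P _ _).const_mul _)]
    congr 1
    ext y
    have h1 := two_mul_P n y
    have h2 := two_mul_P k y
    simp only [div_eq_mul_inv]
    linear_combination (P k y * h1 - P n y * h2) * ((Real.cosh (Real.pi * y) : ℝ) : ℂ)⁻¹
  induction m using Nat.twoStepInduction generalizing n with
  | zero => simpa [P] using integral_P_div_cosh n
  | one =>
    have h := step n 0
    have hP0 : ∀ k : ℕ, ∫ y : ℝ, P k y * P 0 y / ((Real.cosh (Real.pi * y) : ℝ) : ℂ) =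
        if k = 0 then 1 else 0 := fun k => by simpa [P] using integral_P_div_cosh k
    rw [hP0, hP0] at h
    simp only [Nat.cast_zero, zero_add, one_mul, zero_mul, sub_zero] at h
    rw [h]
    rcases n with _ | _ | n <;> simp
  | more m h0 h1 =>
    have h := step n (m + 1)
    rw [h1, h1, Nat.add_sub_cancel, h0] at h
    have hm : (m : ℂ) + 2 ≠ 0 := by exact_mod_cast (m + 1).succ_ne_zero
    refine mul_left_cancel₀ hm ?_
    rw [show (m : ℂ) + 2 = ((m + 1 : ℕ) : ℂ) + 1 by push_cast; ring, h]
    push_cast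
    rcases n with _ | n
    · rcases m with _ | m <;> simp
    · by_cases e1 : n = m + 1
      · subst e1
        have : m + 1 + 1 ≠ m := by omega
        simp [this]
      · by_cases e2 : n + 1 = m
        · subst e2
          have : n ≠ n + 1 + 1 := by omega
          simp [this]
        · simp [e1, e2]

/-! ### Determinacy of exponentially decaying functions by their moments -/

open scoped FourierTransform SchwartzMap ContDiff in
theorem ae_eq_zero_of_fourier_eq_zero {G : ℝ → ℂ} (hG : Integrable G)
    (h : ∀ w : ℝ, 𝓕 G w = 0) : ∀ᵐ y, G y = 0 := by
  refine ae_eq_zero_of_integral_contDiff_smul_eq_zero hG.locallyIntegrable fun φ hφ hφc => ?_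
  have h1 : HasCompactSupport (Complex.ofRealCLM ∘ φ) := hφc.comp_left rfl
  have h2 : ContDiff ℝ ∞ (Complex.ofRealCLM ∘ φ) := by fun_prop
  set s : 𝓢(ℝ, ℂ) := h1.toSchwartzMap h2 with hs
  have h3 : ∀ y : ℝ, φ y • G y = (𝓕 (𝓕⁻ s : 𝓢(ℝ, ℂ)) : 𝓢(ℝ, ℂ)) y • G y := fun y => by
    rw [FourierTransform.fourier_fourierInv_eq]; simp [hs]
  have h4 := VectorFourier.integral_fourierIntegral_smul_eq_flip (L := innerₗ ℝ)
    (μ := volume) (ν := volume) (e := Real.fourierChar) (f := (𝓕⁻ s : 𝓢(ℝ, ℂ))) (g := G)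
    Real.continuous_fourierChar continuous_inner (SchwartzMap.integrable _) hG
  simp only [h3]
  refine Eq.trans ?_ (h4.trans ?_)
  · rfl
  · have : ∀ x : ℝ, VectorFourier.fourierIntegral Real.fourierChar volume (innerₗ ℝ).flip G x = 0 := by
      intro x
      rw [flip_innerₗ]
      exact h x
    simp only [this, smul_zero, integral_zero]

/-- A function with exponential decay and vanishing moments is zero: `z ↦ ∫ exp (z y) G y` is
holomorphic in a vertical strip and has zero Taylor series at the origin, so the Fourier transform of
`G` vanishes. -/
theorem ae_eq_zero_of_integral_pow_eq_zero {G : ℝ → ℂ} {c : ℝ} (hc : 0 < c)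
    (hGm : AEStronglyMeasurable G)
    (hG : Integrable fun y : ℝ => Real.exp (c * |y|) * ‖G y‖)
    (hmom : ∀ n : ℕ, ∫ y : ℝ, (y : ℂ) ^ n * G y = 0) : ∀ᵐ y, G y = 0 := by
  set U : Set ℂ := {z | |z.re| < c} with hU
  have hUo : IsOpen U := isOpen_lt (by fun_prop) continuous_const
  have hnorm : ∀ (z : ℂ) (y : ℝ), ‖Complex.exp (z * y) * G y‖ = Real.exp (z.re * y) * ‖G y‖ :=
    fun z y => by rw [norm_mul, Complex.norm_exp]; simp
  have hmeas : ∀ z : ℂ, AEStronglyMeasurable (fun y : ℝ => Complex.exp (z * y) * G y) := fun z =>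
    (Continuous.aestronglyMeasurable (by fun_prop)).mul hGm
  have hle : ∀ (a y : ℝ), a * y ≤ |a| * |y| := fun a y => by
    rw [← abs_mul]; exact le_abs_self _
  have hint : ∀ z ∈ U, Integrable fun y : ℝ => Complex.exp (z * y) * G y := fun z hz =>
    hG.mono' (hmeas z) (Eventually.of_forall fun y => by
      rw [hnorm]
      refine mul_le_mul_of_nonneg_right (Real.exp_le_exp.2 ((hle _ _).trans ?_)) (norm_nonneg _)
      gcongr
      exact le_of_lt hz)
  set Φ : ℂ → ℂ := fun z => ∫ y : ℝ, Complex.exp (z * y) * G y with hΦ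
  have hdiff : DifferentiableOn ℂ Φ U := by
    intro z₀ hz₀
    have hz₀' : |z₀.re| < c := hz₀
    set δ := (c - |z₀.re|) / 2 with hδ
    have hδ0 : 0 < δ := by rw [hδ]; linarith
    have key := hasDerivAt_integral_of_dominated_loc_of_deriv_le (μ := volume) (x₀ := z₀)
      (F := fun z (y : ℝ) => Complex.exp (z * y) * G y)
      (F' := fun z (y : ℝ) => (Complex.exp (z * y) * y) * G y)
      (s := Metric.ball z₀ δ) (bound := fun y => δ⁻¹ * (Real.exp (c * |y|) * ‖G y‖))
      (Metric.ball_mem_nhds _ hδ0) (Eventually.of_forall hmeas) (hint z₀ hz₀)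
      ((Continuous.aestronglyMeasurable (by fun_prop)).mul hGm)
      (Eventually.of_forall fun y z hz => by
        have h1 : |z.re| ≤ |z₀.re| + δ := by
          have h2 : |(z - z₀).re| ≤ δ :=
            (Complex.abs_re_le_norm _).trans (by simpa [dist_eq_norm] using (Metric.mem_ball.1 hz).le)
          rw [Complex.sub_re] at h2
          have h3 := abs_add_le z₀.re (z.re - z₀.re)
          rw [add_sub_cancel] at h3
          linarith
        have h4 : |y| ≤ δ⁻¹ * Real.exp (δ * |y|) := by
          rw [inv_mul_eq_div, le_div_iff₀ hδ0]
          linarith [Real.add_one_le_exp (δ * |y|)]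
        rw [norm_mul, norm_mul, Complex.norm_exp, Complex.norm_real, Real.norm_eq_abs,
          ← mul_assoc]
        refine mul_le_mul_of_nonneg_right ?_ (norm_nonneg _)
        have h5 : (z * y).re = z.re * y := by simp
        rw [h5]
        calc _ ≤ Real.exp ((|z₀.re| + δ) * |y|) * (δ⁻¹ * Real.exp (δ * |y|)) := by
              refine mul_le_mul (Real.exp_le_exp.2 ((hle _ _).trans ?_)) h4 (abs_nonneg _)
                (Real.exp_pos _).le
              gcongr
          _ = δ⁻¹ * (Real.exp ((|z₀.re| + δ) * |y|) * Real.exp (δ * |y|)) := by ring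
          _ = _ := by rw [← Real.exp_add]; congr 2; rw [hδ]; ring)
      (hG.const_mul _)
      (Eventually.of_forall fun y z _ => by
        have h1 : HasDerivAt (fun z : ℂ => z * y) (y : ℂ) z := by
          simpa using (hasDerivAt_id z).mul_const (y : ℂ)
        exact h1.cexp.mul_const _)
    exact key.2.differentiableAt.differentiableWithinAt
  have hzero : Φ =ᶠ[𝓝 0] 0 := by
    filter_upwards [Metric.ball_mem_nhds (0 : ℂ) hc] with z hz
    have hz' : ‖z‖ < c := by simpa using hz
    have hts : ∀ y : ℝ, HasSum (fun n : ℕ => (‖z‖ * |y|) ^ n / n.factorial * ‖G y‖)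
        (Real.exp (‖z‖ * |y|) * ‖G y‖) := fun y => by
      refine HasSum.mul_right _ ?_
      rw [Real.exp_eq_exp_ℝ]
      exact NormedSpace.expSeries_div_hasSum_exp (‖z‖ * |y|)
    have key := hasSum_integral_of_dominated_convergence (μ := volume)
      (F := fun (n : ℕ) (y : ℝ) => (z * y) ^ n / n.factorial * G y)
      (f := fun y : ℝ => Complex.exp (z * y) * G y)
      (fun n y => (‖z‖ * |y|) ^ n / n.factorial * ‖G y‖)
      (fun n => (Continuous.aestronglyMeasurable (by fun_prop)).mul hGm)
      (fun n => Eventually.of_forall fun y => by simp)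
      (Eventually.of_forall fun y => (hts y).summable)
      (by
        simp only [(hts _).tsum_eq]
        refine hG.mono' ((Continuous.aestronglyMeasurable (by fun_prop)).mul hGm.norm)
          (Eventually.of_forall fun y => ?_)
        rw [Real.norm_of_nonneg (by positivity)]
        gcongr)
      (Eventually.of_forall fun y => by
        refine HasSum.mul_right _ ?_
        rw [Complex.exp_eq_exp_ℂ]
        exact NormedSpace.expSeries_div_hasSum_exp (z * y))
    have h0 : ∀ n : ℕ, ∫ y : ℝ, (z * y) ^ n / n.factorial * G y = 0 := fun n => by
      have : ∀ y : ℝ, (z * y) ^ n / n.factorial * G y =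
          z ^ n / n.factorial * ((y : ℂ) ^ n * G y) := fun y => by rw [mul_pow]; ring
      simp only [this]
      rw [integral_const_mul, hmom, mul_zero]
    simp only [h0] at key
    exact (key.unique hasSum_zero)
  have hUc : IsPreconnected U := by
    refine Convex.isPreconnected ?_
    have : U = Complex.reCLM ⁻¹' (Set.Ioo (-c) c) := by
      ext z; simp [hU, abs_lt]
    rw [this]
    exact (convex_Ioo _ _).linear_preimage (Complex.reCLM : ℂ →ₗ[ℝ] ℝ)
  have hall := (hdiff.analyticOnNhd hUo).eqOn_zero_of_preconnected_of_eventuallyEq_zero hUc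
    (z₀ := 0) (by simpa [hU] using hc) hzero
  refine ae_eq_zero_of_fourier_eq_zero (by simpa using hint 0 (by simpa [hU] using hc)) fun w => ?_
  have h1 := hall (x := ((-2 * Real.pi * w : ℝ) : ℂ) * I) (by simpa [hU] using hc)
  rw [Real.fourier_real_eq_integral_exp_smul]
  refine Eq.trans ?_ h1
  refine integral_congr_ae (Eventually.of_forall fun y => ?_)
  simp only [smul_eq_mul]
  congr 2
  push_cast
  ring

/-! ### The orthonormal basis `psi n` of `L²(ℝ)` -/

theorem Gamma_half_mul_Gamma_half (y : ℝ) :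
    Complex.Gamma (1 / 2 - y * I) * Complex.Gamma (1 / 2 + y * I) =
      Real.pi / ((Real.cosh (Real.pi * y) : ℝ) : ℂ) := by
  have h2 : Complex.Gamma (1 / 2 + y * I) ≠ 0 :=
    Complex.Gamma_ne_zero_of_re_pos (by simp)
  have h3 : (Real.pi : ℂ) * (y * I) = (Real.pi * y : ℝ) * I := by push_cast; ring
  rw [← Gamma_half_sub (by simp : -(1 / 2) < (y * I : ℂ).re), h3, Complex.cos_mul_I,
    ← Complex.ofReal_cosh, div_mul_eq_mul_div, mul_assoc, inv_mul_cancel₀ h2, mul_one]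

theorem conj_Gamma_half (y : ℝ) :
    (starRingEnd ℂ) (Complex.Gamma (1 / 2 + y * I)) = Complex.Gamma (1 / 2 - y * I) := by
  rw [← Complex.Gamma_conj]
  congr 1
  have h2 : (starRingEnd ℂ) 2 = 2 := map_ofNat _ 2
  simp [h2, sub_eq_add_neg]

theorem norm_Gamma_half_sq (y : ℝ) :
    ‖Complex.Gamma (1 / 2 - y * I)‖ ^ 2 = Real.pi / Real.cosh (Real.pi * y) := by
  have h1 := Gamma_half_mul_Gamma_half y
  rw [← conj_Gamma_half, mul_comm, Complex.mul_conj, Complex.normSq_eq_norm_sq] at h1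
  rw [← conj_Gamma_half, Complex.norm_conj]
  exact_mod_cast h1

theorem continuous_Gamma_half : Continuous fun y : ℝ => Complex.Gamma (1 / 2 - y * I) := by
  rw [continuous_iff_continuousAt]
  intro y
  have h1 : ContinuousAt Complex.Gamma (1 / 2 - y * I) := by
    refine (Complex.differentiableAt_Gamma _ fun m hm => ?_).continuousAt
    have := congrArg Complex.re hm
    simp at this
    have h2 : (0 : ℝ) ≤ m := m.cast_nonneg
    linarith
  exact ContinuousAt.comp (f := fun y : ℝ => (1 / 2 - y * I : ℂ)) h1 (by fun_prop)

theorem conj_psi (n : ℕ) (y : ℝ) : (starRingEnd ℂ) (psi n y) =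
    ((1 / Real.sqrt Real.pi : ℝ) : ℂ) * (Complex.Gamma (1 / 2 - y * I) * P n y) := by
  rw [psi, map_mul, map_mul, Complex.conj_ofReal, conj_P, mul_comm I, conj_Gamma_half, mul_assoc]

theorem continuous_psi (n : ℕ) : Continuous (psi n) := by
  have h : Continuous fun y : ℝ => (starRingEnd ℂ) (psi n y) := by
    simp only [conj_psi]
    have := continuous_Gamma_half
    have := (differentiable_P n).continuous
    fun_prop
  simpa [Function.comp_def] using Complex.continuous_conj.comp h

theorem conj_psi_mul_psi (n m : ℕ) (y : ℝ) :
    (starRingEnd ℂ) (psi n y) * psi m y =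
      P n y * P m y / ((Real.cosh (Real.pi * y) : ℝ) : ℂ) := by
  have hpi : (Real.pi : ℂ) ≠ 0 := by exact_mod_cast Real.pi_ne_zero
  have h1 : ((1 / Real.sqrt Real.pi : ℝ) : ℂ) * ((1 / Real.sqrt Real.pi : ℝ) : ℂ) =
      (Real.pi : ℂ)⁻¹ := by
    rw [← Complex.ofReal_mul, div_mul_div_comm, Real.mul_self_sqrt Real.pi_pos.le]
    simp
  rw [conj_psi, psi, mul_comm I]
  calc _ = (((1 / Real.sqrt Real.pi : ℝ) : ℂ) * ((1 / Real.sqrt Real.pi : ℝ) : ℂ)) *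
        (Complex.Gamma (1 / 2 - y * I) * Complex.Gamma (1 / 2 + y * I)) * (P n y * P m y) := by ring
    _ = _ := by
      rw [h1, Gamma_half_mul_Gamma_half, ← mul_div_assoc, inv_mul_cancel₀ hpi]
      ring

theorem memLp_psi (n : ℕ) : MemLp (psi n) 2 := by
  rw [memLp_two_iff_integrable_sq_norm (continuous_psi n).aestronglyMeasurable]
  have h := (integrable_P_mul_P n n).norm
  refine h.congr (Eventually.of_forall fun y => ?_)
  simp only
  rw [← conj_psi_mul_psi, norm_mul, Complex.norm_conj, sq]

theorem integral_conj_psi_mul_psi (n m : ℕ) :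
    ∫ y : ℝ, (starRingEnd ℂ) (psi n y) * psi m y = if n = m then 1 else 0 := by
  simp only [conj_psi_mul_psi, integral_P_mul_P]

/-- Completeness of the `psi n`: orthogonality means that all moments of `Γ(1/2 - i y) F y` vanish. -/
theorem ae_eq_zero_of_integral_conj_psi_eq_zero {F : ℝ → ℂ} (hF : MemLp F 2)
    (h : ∀ n : ℕ, ∫ y : ℝ, (starRingEnd ℂ) (psi n y) * F y = 0) : ∀ᵐ y, F y = 0 := by
  set G : ℝ → ℂ := fun y => Complex.Gamma (1 / 2 - y * I) * F y with hG
  have hGm : AEStronglyMeasurable G :=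
    continuous_Gamma_half.aestronglyMeasurable.mul hF.aestronglyMeasurable
  -- the weight decays like `exp (-π |y|)`, so it absorbs `exp (2 |y|)`
  have hΓ : ∀ y : ℝ, (Real.exp |y| * ‖Complex.Gamma (1 / 2 - y * I)‖) ^ 2 ≤
      4 * Real.pi * (1 + y ^ 2)⁻¹ := by
    intro y
    have hc := Real.cosh_pos (Real.pi * y)
    rw [mul_pow, norm_Gamma_half_sq, ← mul_div_assoc, ← div_eq_mul_inv,
      div_le_div_iff₀ hc (by positivity)]
    have h1 : Real.exp (3 * |y|) ≤ 2 * Real.cosh (Real.pi * y) := by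
      rw [← Real.cosh_abs, Real.cosh_eq, abs_mul, abs_of_pos Real.pi_pos]
      have h3 : Real.exp (3 * |y|) ≤ Real.exp (Real.pi * |y|) := by
        rw [Real.exp_le_exp]
        nlinarith [Real.pi_gt_three, abs_nonneg y]
      have := Real.exp_pos (-(Real.pi * |y|))
      linarith
    have h2 : 1 + y ^ 2 ≤ 2 * Real.exp |y| := by
      have := Real.quadratic_le_exp_of_nonneg (abs_nonneg y)
      rw [sq_abs] at this
      linarith [abs_nonneg y]
    have h4 : Real.exp |y| ^ 2 * Real.exp |y| = Real.exp (3 * |y|) := by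
      rw [← pow_succ, ← Real.exp_nat_mul]; norm_num
    calc Real.exp |y| ^ 2 * Real.pi * (1 + y ^ 2)
        ≤ Real.exp |y| ^ 2 * Real.pi * (2 * Real.exp |y|) := by gcongr
      _ = 2 * Real.pi * (Real.exp |y| ^ 2 * Real.exp |y|) := by ring
      _ ≤ 2 * Real.pi * (2 * Real.cosh (Real.pi * y)) := by rw [h4]; gcongr
      _ = _ := by ring
  have hF2 : Integrable fun y : ℝ => ‖F y‖ ^ 2 :=
    (memLp_two_iff_integrable_sq_norm hF.aestronglyMeasurable).1 hF
  have hGi : Integrable fun y : ℝ => Real.exp (1 * |y|) * ‖G y‖ := by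
    refine ((hF2.add (integrable_inv_one_add_sq.const_mul (4 * Real.pi))).div_const 2).mono'
      ((Continuous.aestronglyMeasurable (by fun_prop)).mul hGm.norm)
      (Eventually.of_forall fun y => ?_)
    rw [Real.norm_of_nonneg (by positivity), one_mul, hG]
    simp only [Pi.add_apply]
    rw [norm_mul]
    have := hΓ y
    nlinarith [sq_nonneg (Real.exp |y| * ‖Complex.Gamma (1 / 2 - y * I)‖ - ‖F y‖)]
  have hpoly : ∀ k n : ℕ, Integrable fun y : ℝ => (y : ℂ) ^ k * P n y * G y := by
    intro k n
    obtain ⟨A, hA, hPA⟩ := exists_norm_P_le n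
    have := (differentiable_P n).continuous
    refine (hGi.const_mul (A * Real.exp 1 * (k + n).factorial)).mono'
      ((Continuous.aestronglyMeasurable (by fun_prop)).mul hGm) (Eventually.of_forall fun y => ?_)
    have h1 := Real.pow_div_factorial_le_exp (1 + |y|) (by positivity) (k + n)
    rw [div_le_iff₀ (by positivity), Real.exp_add] at h1
    have h2 := hPA y
    rw [Complex.norm_real, Real.norm_eq_abs] at h2
    rw [norm_mul, norm_mul, norm_pow, Complex.norm_real, Real.norm_eq_abs, one_mul, ← mul_assoc]
    refine mul_le_mul_of_nonneg_right ?_ (norm_nonneg _)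
    calc _ ≤ (1 + |y|) ^ k * (A * (1 + |y|) ^ n) := by
          gcongr
          linarith [abs_nonneg y]
      _ = A * (1 + |y|) ^ (k + n) := by ring
      _ ≤ A * (Real.exp 1 * Real.exp |y| * (k + n).factorial) := by gcongr
      _ = _ := by ring
  have hmom : ∀ k n : ℕ, ∫ y : ℝ, (y : ℂ) ^ k * P n y * G y = 0 := by
    intro k
    induction k with
    | zero =>
      intro n
      have h1 : ∀ y : ℝ, (starRingEnd ℂ) (psi n y) * F y =
          ((1 / Real.sqrt Real.pi : ℝ) : ℂ) * ((y : ℂ) ^ 0 * P n y * G y) := fun y => by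
        rw [conj_psi, hG]; ring
      have h2 := h n
      simp only [h1] at h2
      rw [integral_const_mul] at h2
      refine (mul_eq_zero.1 h2).resolve_left ?_
      have := Real.sqrt_pos.2 Real.pi_pos
      exact_mod_cast (by positivity : (0 : ℝ) < 1 / Real.sqrt Real.pi).ne'
    | succ k ih =>
      intro n
      have h1 : ∀ y : ℝ, (y : ℂ) ^ (k + 1) * P n y * G y =
          ((n : ℂ) + 1) / 2 * ((y : ℂ) ^ k * P (n + 1) y * G y) +
          (n : ℂ) / 2 * ((y : ℂ) ^ k * P (n - 1) y * G y) := fun y => by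
        linear_combination (y : ℂ) ^ k * G y / 2 * two_mul_P n y
      simp only [h1]
      rw [integral_add ((hpoly _ _).const_mul _) ((hpoly _ _).const_mul _), integral_const_mul,
        integral_const_mul, ih, ih]
      simp
  have hzero := ae_eq_zero_of_integral_pow_eq_zero one_pos hGm hGi fun n => by
    simpa [P] using hmom n 0
  filter_upwards [hzero] with y hy
  refine (mul_eq_zero.1 hy).resolve_left (Complex.Gamma_ne_zero_of_re_pos ?_)
  simp

theorem inner_toLp_psi {u : ℝ → ℂ} (hu : MemLp u 2) (n : ℕ) :
    inner ℂ ((memLp_psi n).toLp (psi n)) (hu.toLp u) =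
      ∫ y : ℝ, (starRingEnd ℂ) (psi n y) * u y := by
  rw [L2.inner_def]
  refine integral_congr_ae ?_
  filter_upwards [(memLp_psi n).coeFn_toLp, hu.coeFn_toLp] with y h1 h2
  rw [h1, h2, RCLike.inner_apply']

theorem orthonormal_psi : Orthonormal ℂ fun n => (memLp_psi n).toLp (psi n) := by
  rw [orthonormal_iff_ite]
  intro n m
  rw [inner_toLp_psi, integral_conj_psi_mul_psi]

/-- The functions `psi n` as a Hilbert basis of `L²(ℝ)`. -/
def psiBasis : HilbertBasis ℕ ℂ (Lp ℂ 2 (volume : Measure ℝ)) :=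
  HilbertBasis.mkOfOrthogonalEqBot orthonormal_psi <| by
    rw [Submodule.eq_bot_iff]
    intro u hu
    rw [Submodule.mem_orthogonal] at hu
    have h1 := ae_eq_zero_of_integral_conj_psi_eq_zero (Lp.memLp u) fun n => by
      rw [← inner_toLp_psi (Lp.memLp u), Lp.toLp_coeFn]
      exact hu _ (Submodule.subset_span ⟨n, rfl⟩)
    exact (Lp.eq_zero_iff_ae_eq_zero).2 h1

theorem memLp_psi_sum (c : ℕ → ℂ) (m : ℕ) :
    MemLp (fun y => ∑ n ∈ Finset.range m, c n * psi n y) 2 :=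
  memLp_finsetSum _ fun n _ => (memLp_psi n).const_mul _

theorem toLp_psi_sum (c : ℕ → ℂ) (m : ℕ) :
    (memLp_psi_sum c m).toLp _ = ∑ n ∈ Finset.range m, c n • (memLp_psi n).toLp (psi n) := by
  induction m with
  | zero =>
    simp only [Finset.range_zero, Finset.sum_empty]
    exact MemLp.toLp_zero _
  | succ m ih =>
    rw [Finset.sum_range_succ, ← ih, ← MemLp.toLp_const_smul, ← MemLp.toLp_add]
    congr 1
    ext y
    simp [Finset.sum_range_succ]

theorem hasPsiSum_iff {c : ℕ → ℂ} {F : ℝ → ℂ} (hF : MemLp F 2) :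
    HasPsiSum c F ↔ Tendsto (fun m : ℕ => ∑ n ∈ Finset.range m, c n • (memLp_psi n).toLp (psi n))
      atTop (𝓝 (hF.toLp F)) := by
  have h := Lp.tendsto_Lp_iff_tendsto_eLpNorm'' (fi := atTop) (p := 2) (μ := volume)
    (fun m y => ∑ n ∈ Finset.range m, c n * psi n y) (memLp_psi_sum c) F hF
  simp only [toLp_psi_sum] at h
  rw [h, HasPsiSum, and_iff_right hF]
  refine Eq.to_iff ?_
  congr 1
  ext m
  exact eLpNorm_sub_comm _ _ _ _

theorem hasPsiSum_integral {u : ℝ → ℂ} (hu : MemLp u 2) :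
    HasPsiSum (fun n => ∫ y : ℝ, (starRingEnd ℂ) (psi n y) * u y) u := by
  rw [hasPsiSum_iff hu]
  have h := (psiBasis.hasSum_repr (hu.toLp u)).tendsto_sum_nat
  have hb : ∀ n, psiBasis n = (memLp_psi n).toLp (psi n) := fun n => by
    rw [psiBasis, HilbertBasis.coe_mkOfOrthogonalEqBot]
  simpa only [HilbertBasis.repr_apply_apply, hb, inner_toLp_psi] using h

theorem HasPsiSum.ae_eq {c : ℕ → ℂ} {F F' : ℝ → ℂ} (h : HasPsiSum c F) (h' : HasPsiSum c F') :
    F =ᵐ[volume] F' :=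
  (MemLp.toLp_eq_toLp_iff h.1 h'.1).1
    (tendsto_nhds_unique ((hasPsiSum_iff h.1).1 h) ((hasPsiSum_iff h'.1).1 h'))

/-! ### Removing the pole, and the interpolation formula -/

theorem eventually_norm_le_of_indicatorPL_le {f : ℂ → ℂ} {θ b b' : ℝ}
    (h : indicatorPL f θ ≤ (b : EReal)) (hb : b < b') :
    ∀ᶠ r : ℝ in atTop, ‖f (r * Complex.exp (I * θ))‖ ≤ Real.exp (b' * r) := by
  have h1 : indicatorPL f θ < (b' : EReal) := h.trans_lt (by exact_mod_cast hb)
  filter_upwards [eventually_lt_of_limsup_lt h1, eventually_gt_atTop 0] with r hr hr0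
  rw [EReal.div_lt_iff (by exact_mod_cast hr0) (EReal.coe_ne_top r), ← EReal.coe_mul] at hr
  have h2 := EReal.exp_monotone hr.le
  rw [ENNReal.exp_log, EReal.exp_coe, ← ofReal_norm,
    ENNReal.ofReal_le_ofReal_iff (Real.exp_pos _).le] at h2
  exact h2

/-- Passage to `g z = f z * (z - zp) / (z + 1)`, extended to the pole by its limit and to the left
half-plane by `g (x + i y) = g (i y)`. -/
theorem exists_hardyWithPole {f : ℂ → ℂ} {zp Rp : ℂ} (hzp : 0 < zp.re)
    (hnode : ∀ N : ℕ, zp ≠ (N : ℂ) + 1 / 2) (hpole : HasSimplePoleAt f zp Rp)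
    (hhol : DifferentiableOn ℂ f ({z : ℂ | 0 < z.re} \ {zp}))
    (hcont : ∀ y : ℝ, ContinuousWithinAt f {z : ℂ | 0 ≤ z.re} (I * y))
    (hcarlson : CarlsonBound f) (hL2 : MemLp (fun y : ℝ => f (I * y)) 2 volume) :
    ∃ g M, HardyWithPole f g zp Rp M := by
  obtain ⟨-, k, hk, hfk⟩ := hpole
  obtain ⟨hord, b, hb, hind⟩ := hcarlson
  have hopen : IsOpen {z : ℂ | 0 < z.re} := isOpen_lt continuous_const Complex.continuous_re
  have hopenf : IsOpen ({z : ℂ | 0 < z.re} \ {zp}) := hopen.sdiff isClosed_singleton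
  have hfc : ContinuousOn f ({z | 0 ≤ z.re} \ {zp}) := by
    intro z hz
    rcases (show 0 ≤ z.re from hz.1).eq_or_lt with h0 | h0
    · have hz' : z = I * (z.im : ℝ) := by
        apply Complex.ext <;> simp [← h0]
      rw [hz']
      exact (hcont z.im).mono Set.sdiff_subset
    · exact (hhol.differentiableAt (hopenf.mem_nhds ⟨h0, hz.2⟩)).continuousAt.continuousWithinAt
  have hres : Tendsto (fun z => (z - zp) * f z) (𝓝[≠] zp) (𝓝 Rp) := by
    have h1 : ContinuousAt (fun z => Rp + (z - zp) * k z) zp := by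
      have := hk.continuousAt
      fun_prop
    have h2 := h1.tendsto
    simp only [sub_self, zero_mul, add_zero] at h2
    refine (h2.mono_left nhdsWithin_le_nhds).congr' ?_
    filter_upwards [hfk, self_mem_nhdsWithin] with z hz hne
    have : z - zp ≠ 0 := sub_ne_zero.2 hne
    rw [hz]
    field_simp
  -- removing the pole with a factor of modulus bounded at infinity
  set g₀ : ℂ → ℂ := Function.update (fun z => f z * (z - zp) / (z + 1)) zp (Rp / (zp + 1)) with hg₀
  have hg₀ne : ∀ z ≠ zp, g₀ z = f z * (z - zp) / (z + 1) := fun z hz => Function.update_of_ne hz _ _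
  have hadd : ∀ z : ℂ, 0 ≤ z.re → z + 1 ≠ 0 := fun z hz h => by
    have := congrArg Complex.re h
    simp at this
    linarith
  have hg₀d : ∀ z : ℂ, 0 < z.re → DifferentiableAt ℂ g₀ z := by
    intro z hz
    have hz1 := hadd z hz.le
    by_cases hzz : z = zp
    · subst hzz
      have h1 : g₀ =ᶠ[𝓝 z] fun w => (Rp + (w - z) * k w) / (w + 1) := by
        rw [eventually_nhdsWithin_iff] at hfk
        filter_upwards [hfk] with w hw
        by_cases hwz : w = z
        · subst hwz; simp [hg₀]
        · have : w - z ≠ 0 := sub_ne_zero.2 hwz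
          rw [hg₀ne w hwz, hw hwz]
          field_simp
      rw [h1.differentiableAt_iff]
      have := hk.differentiableAt
      fun_prop (disch := assumption)
    · have h1 : g₀ =ᶠ[𝓝 z] fun w => f w * (w - zp) / (w + 1) := by
        filter_upwards [isOpen_ne.mem_nhds hzz] with w hw using hg₀ne w hw
      rw [h1.differentiableAt_iff]
      have := hhol.differentiableAt (hopenf.mem_nhds ⟨hz, hzz⟩)
      fun_prop (disch := assumption)
  have hg₀c : ContinuousOn g₀ {z | 0 ≤ z.re} := by
    intro z hz
    rcases (show 0 ≤ z.re from hz).eq_or_lt with h0 | h0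
    · have hzz : z ≠ zp := by rintro rfl; linarith
      have hz' : z = I * (z.im : ℝ) := by
        apply Complex.ext <;> simp [← h0]
      have h1 : ContinuousWithinAt f {z | 0 ≤ z.re} z := by rw [hz']; exact hcont z.im
      have h2 : ContinuousWithinAt (fun w => f w * (w - zp) / (w + 1)) {z | 0 ≤ z.re} z :=
        (h1.mul (by fun_prop)).div (by fun_prop) (hadd z hz)
      refine h2.congr_of_eventuallyEq ?_ (hg₀ne z hzz)
      filter_upwards [mem_nhdsWithin_of_mem_nhds (isOpen_ne.mem_nhds hzz)] with w hw
        using hg₀ne w hw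
    · exact (hg₀d z h0).continuousAt.continuousWithinAt
  set pr : ℂ → ℂ := fun z => ((max z.re 0 : ℝ) : ℂ) + z.im * I with hpr
  have hprre : ∀ z, (pr z).re = max z.re 0 := fun z => by simp [hpr]
  have hpre : ∀ z : ℂ, 0 ≤ z.re → pr z = z := fun z hz => by
    simp only [hpr, max_eq_left hz]; exact Complex.re_add_im z
  set g : ℂ → ℂ := fun z => g₀ (pr z) with hg
  have hgg : ∀ z : ℂ, 0 ≤ z.re → g z = g₀ z := fun z hz => by simp only [hg]; rw [hpre z hz]
  have hgc : Continuous g := hg₀c.comp_continuous (by fun_prop) fun z => by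
    show 0 ≤ (pr z).re
    rw [hprre]; exact le_max_right _ _
  have hgd : DifferentiableOn ℂ g {z | 0 < z.re} := by
    intro z hz
    have h1 : g =ᶠ[𝓝 z] g₀ := by
      filter_upwards [hopen.mem_nhds hz] with w hw using hgg w (le_of_lt hw)
    exact (h1.differentiableAt_iff.2 (hg₀d z hz)).differentiableWithinAt
  set B : ℝ := 1 + ‖zp‖ with hB
  have hB0 : 0 ≤ B := by positivity
  have hgf : ∀ z : ℂ, 0 ≤ z.re → z ≠ zp → ‖g z‖ ≤ B * ‖f z‖ := by
    intro z hz hne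
    rw [hgg z hz, hg₀ne z hne, norm_div, norm_mul, div_le_iff₀ (norm_pos_iff.2 (hadd z hz))]
    have h1 : ‖z‖ ≤ ‖z + 1‖ := by
      rw [← sq_le_sq₀ (norm_nonneg _) (norm_nonneg _), ← Complex.normSq_eq_norm_sq,
        ← Complex.normSq_eq_norm_sq, Complex.normSq_apply, Complex.normSq_apply]
      simp
      nlinarith
    have h2 : 1 ≤ ‖z + 1‖ := by
      refine le_trans ?_ (Complex.abs_re_le_norm _)
      rw [Complex.add_re, Complex.one_re]
      exact le_trans (by linarith) (le_abs_self _)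
    have h3 : ‖z - zp‖ ≤ B * ‖z + 1‖ := by
      refine (norm_sub_le _ _).trans ?_
      nlinarith [norm_nonneg zp]
    calc _ ≤ ‖f z‖ * (B * ‖z + 1‖) := by gcongr
      _ = _ := by ring
  have hgord : g =O[Bornology.cobounded ℂ ⊓ 𝓟 {z : ℂ | 0 ≤ z.re}]
      fun z => Real.exp (‖z‖ ^ (3 / 2 : ℝ)) := by
    refine Asymptotics.IsBigO.trans ?_ (hord (3 / 2) (by norm_num))
    refine Asymptotics.IsBigO.of_bound B ?_
    have h1 : ∀ᶠ z in Bornology.cobounded ℂ, z ≠ zp := by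
      filter_upwards [tendsto_norm_cobounded_atTop.eventually_gt_atTop ‖zp‖] with z hz h
      rw [h] at hz
      exact lt_irrefl _ hz
    filter_upwards [mem_inf_of_left h1, mem_inf_of_right (mem_principal_self _)] with z hz hz0
      using hgf z hz0 hz
  -- bounds along a ray, extended to its bounded part by compactness
  have hray : ∀ (v : ℂ) (β : ℝ), 0 ≤ v.re → v ≠ 0 → 0 ≤ β →
      (∀ᶠ r : ℝ in atTop, ‖f (r * v)‖ ≤ Real.exp (β * r)) →
      ∃ C, 0 ≤ C ∧ ∀ r : ℝ, 0 ≤ r → ‖g (r * v)‖ ≤ C * Real.exp (β * r) := by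
    intro v β hv hv0 hβ hev
    have hnz : ∀ᶠ r : ℝ in atTop, (r : ℂ) * v ≠ zp := by
      filter_upwards [eventually_gt_atTop (‖zp‖ / ‖v‖), eventually_gt_atTop 0] with r hr hr0 h
      rw [div_lt_iff₀ (norm_pos_iff.2 hv0)] at hr
      rw [← h, norm_mul, Complex.norm_real, Real.norm_of_nonneg hr0.le] at hr
      exact lt_irrefl _ hr
    obtain ⟨r₀, hr₀⟩ := eventually_atTop.1 (hev.and hnz)
    obtain ⟨D, hD⟩ := (isCompact_Icc (a := 0) (b := r₀)).exists_bound_of_continuousOn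
      (f := fun r : ℝ => g (r * v)) (by fun_prop)
    refine ⟨max B D, hB0.trans (le_max_left _ _), fun r hr => ?_⟩
    have hexp : 1 ≤ Real.exp (β * r) := Real.one_le_exp (by positivity)
    rcases le_total r r₀ with h | h
    · have h1 := hD r ⟨hr, h⟩
      calc _ ≤ D := h1
        _ ≤ max B D := le_max_right _ _
        _ ≤ max B D * Real.exp (β * r) := le_mul_of_one_le_right
            (hB0.trans (le_max_left _ _)) hexp
    · obtain ⟨h1, h2⟩ := hr₀ r h
      calc _ ≤ B * ‖f (r * v)‖ := hgf _ (by simpa using mul_nonneg hr hv) h2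
        _ ≤ max B D * Real.exp (β * r) := by
          gcongr
          exact le_max_left _ _
  have hpi := Real.pi_pos
  have hre : ∀ ε > 0, ∃ C, ∀ x : ℝ, 0 ≤ x → ‖g x‖ ≤ C * Real.exp (ε * x) := by
    intro ε hε
    have h1 := eventually_norm_le_of_indicatorPL_le (b' := ε)
      (hind 0 ⟨by linarith, by linarith⟩) (by simpa using hε)
    obtain ⟨C, -, hC⟩ := hray 1 ε (by simp) one_ne_zero hε.le (by simpa using h1)
    exact ⟨C, fun x hx => by simpa using hC x hx⟩
  have him : ∃ C, ∀ y : ℝ, ‖g (y * I)‖ ≤ C * Real.exp (Real.pi * |y|) := by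
    have h1 := eventually_norm_le_of_indicatorPL_le (b' := Real.pi)
      (hind (Real.pi / 2) ⟨by linarith, le_rfl⟩) (by simpa using hb)
    have h2 := eventually_norm_le_of_indicatorPL_le (b' := Real.pi)
      (hind (-(Real.pi / 2)) ⟨le_rfl, by linarith⟩) (by simpa using hb)
    have e1 : Complex.exp (I * ((Real.pi / 2 : ℝ) : ℂ)) = I := by
      rw [mul_comm]; push_cast; exact Complex.exp_pi_div_two_mul_I
    have e2 : Complex.exp (I * ((-(Real.pi / 2) : ℝ) : ℂ)) = -I := by
      rw [mul_comm, ← Complex.exp_neg_pi_div_two_mul_I]; push_cast; rw [neg_div]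
    rw [e1] at h1
    rw [e2] at h2
    obtain ⟨C₁, hC₁0, hC₁⟩ := hray I Real.pi (by simp) Complex.I_ne_zero hpi.le h1
    obtain ⟨C₂, hC₂0, hC₂⟩ := hray (-I) Real.pi (by simp) (by simp) hpi.le h2
    refine ⟨C₁ + C₂, fun y => ?_⟩
    have := Real.exp_pos (Real.pi * |y|)
    rcases le_total 0 y with hy | hy
    · have h3 := hC₁ y hy
      rw [abs_of_nonneg hy] at this ⊢
      nlinarith
    · have h3 := hC₂ (-y) (by linarith)
      rw [abs_of_nonpos hy] at this ⊢
      have h4 : ((-y : ℝ) : ℂ) * -I = y * I := by push_cast; ring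
      rw [h4] at h3
      nlinarith
  have hgL2 : Integrable fun y : ℝ => ‖g (y * I)‖ ^ 2 := by
    have h1 := (memLp_two_iff_integrable_sq_norm hL2.aestronglyMeasurable).1 hL2
    refine (h1.const_mul (B ^ 2)).mono' (Continuous.aestronglyMeasurable (by fun_prop))
      (Eventually.of_forall fun y => ?_)
    have h2 := hgf (y * I) (by simp) (by rintro h; rw [← h] at hzp; simp at hzp)
    rw [Real.norm_of_nonneg (by positivity), ← mul_pow, mul_comm I]
    gcongr
  refine ⟨g, ∫ y : ℝ, ‖g (y * I)‖ ^ 2, hzp, hnode, hres, hfc, hhol, hgc, fun z hz hne => ?_,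
    fun x T hx hT => integral_sq_line_le hgc hgd
      (fun ε hε => exists_growth_bound hgc hgd hgord hre him hε) hgL2 hx hT⟩
  have h1 : z - zp ≠ 0 := sub_ne_zero.2 hne
  have h2 := hadd z hz
  rw [hgg z hz, hg₀ne z hne]
  field_simp

/-- The coefficients are the Fourier coefficients of `y ↦ f (i y)` in the basis `psi n`. -/
theorem HardyWithPole.coeff_eq {f g : ℂ → ℂ} {zp R : ℂ} {M : ℝ} (h : HardyWithPole f g zp R M)
    (hsum : Summable fun N : ℕ => ‖sample f (N + 1)‖ / ((N : ℝ) + 1)) (n : ℕ) :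
    coeff f zp R n = ∫ y : ℝ, (starRingEnd ℂ) (psi n y) * f (I * y) := by
  have hpi : (Real.pi : ℂ) ≠ 0 := by exact_mod_cast Real.pi_ne_zero
  have hs : ((Real.sqrt Real.pi : ℝ) : ℂ) * ((Real.sqrt Real.pi : ℝ) : ℂ) = Real.pi := by
    exact_mod_cast Real.mul_self_sqrt Real.pi_pos.le
  have hs0 : ((Real.sqrt Real.pi : ℝ) : ℂ) ≠ 0 := by
    exact_mod_cast (Real.sqrt_pos.2 Real.pi_pos).ne'
  have h1 := h.tsum_coeffTerm hsum n
  have h2 : ∀ y : ℝ, (starRingEnd ℂ) (psi n y) * f (I * y) = ((1 / Real.sqrt Real.pi : ℝ) : ℂ) *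
      (f (y * I) * (Complex.Gamma (1 / 2 - y * I) * P n y)) := fun y => by
    rw [conj_psi, mul_comm I]; ring
  simp only [h2]
  rw [integral_const_mul, coeff]
  set J := ∫ y : ℝ, f (y * I) * (Complex.Gamma (1 / 2 - y * I) * P n y)
  rw [eq_div_iff hpi] at h1
  rw [Complex.ofReal_div, Complex.ofReal_one, one_div_mul_eq_div, eq_div_iff hs0]
  linear_combination h1 + (2 * (∑' N : ℕ, coeffTerm f n N) -
    2 * (R * (Complex.Gamma (1 / 2 - zp) * P n (-I * zp)))) * hs

theorem sinc_pi_mul_sub_natCast (x : ℝ) (N : ℕ) :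
    Real.pi * (x - N) * Real.sinc (Real.pi * (x - N)) = (-1) ^ N * Real.sin (Real.pi * x) := by
  have h : ∀ t : ℝ, t * Real.sinc t = Real.sin t := fun t => by
    rcases eq_or_ne t 0 with rfl | ht
    · simp
    · rw [Real.sinc_of_ne_zero ht, mul_div_cancel₀ _ ht]
  rw [h, mul_sub, mul_comm Real.pi (N : ℝ), Real.sin_sub_nat_mul_pi]

theorem summable_sample_mul_sinc {f : ℂ → ℂ}
    (hsum : Summable fun N : ℕ => ‖sample f (N + 1)‖ / ((N : ℝ) + 1)) (x : ℝ) :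
    Summable fun N : ℕ => sample f N * ((Real.sinc (Real.pi * (x - N)) : ℝ) : ℂ) := by
  rw [← summable_nat_add_iff 1]
  refine Summable.of_norm_bounded (hsum.mul_left (1 + |x|)) fun N => ?_
  have h1 : |(x - (N + 1 : ℕ)) * Real.sinc (Real.pi * (x - (N + 1 : ℕ)))| ≤ 1 := by
    have h2 := congrArg abs (sinc_pi_mul_sub_natCast x (N + 1))
    rw [mul_assoc, abs_mul, abs_mul ((-1) ^ (N + 1)), abs_pow, abs_neg, abs_one, one_pow, one_mul,
      abs_of_pos Real.pi_pos] at h2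
    have h3 := Real.abs_sin_le_one (Real.pi * x)
    nlinarith [Real.pi_gt_three,
      abs_nonneg ((x - (N + 1 : ℕ)) * Real.sinc (Real.pi * (x - (N + 1 : ℕ))))]
  have h2 := Real.abs_sinc_le_one (Real.pi * (x - (N + 1 : ℕ)))
  set s := Real.sinc (Real.pi * (x - (N + 1 : ℕ))) with hs
  have h3 : ((N : ℝ) + 1) * |s| ≤ 1 + |x| := by
    have h4 : ((N : ℝ) + 1) * s = x * s - (x - (N + 1 : ℕ)) * s := by push_cast; ring
    have h5 : |((N : ℝ) + 1) * s| ≤ |x * s| + |(x - (N + 1 : ℕ)) * s| := by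
      rw [h4]; exact abs_sub _ _
    rw [abs_mul, abs_mul x, abs_of_nonneg (by positivity : (0 : ℝ) ≤ (N : ℝ) + 1)] at h5
    nlinarith [abs_nonneg x]
  rw [norm_mul, Complex.norm_real, Real.norm_eq_abs, ← mul_div_assoc, le_div_iff₀ (by positivity)]
  calc _ = ‖sample f (N + 1)‖ * (((N : ℝ) + 1) * |s|) := by ring
    _ ≤ ‖sample f (N + 1)‖ * (1 + |x|) := by gcongr
    _ = _ := by ring

theorem integrable_div_mul_cosh {F : ℝ → ℂ} (hF : MemLp F 2) {x : ℝ} (hx : -(1 / 2) < x) :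
    Integrable fun y : ℝ =>
      F y / (((x : ℂ) + 1 / 2 - I * y) * ((Real.cosh (Real.pi * y) : ℝ) : ℂ)) := by
  have ha : 0 < x + 1 / 2 := by linarith
  have hre : ∀ y : ℝ, ((x : ℂ) + 1 / 2 - I * y).re = x + 1 / 2 := fun y => by simp
  have hF2 : Integrable fun y : ℝ => ‖F y‖ ^ 2 :=
    (memLp_two_iff_integrable_sq_norm hF.aestronglyMeasurable).1 hF
  have hne : ∀ y : ℝ, ((x : ℂ) + 1 / 2 - I * y) * ((Real.cosh (Real.pi * y) : ℝ) : ℂ) ≠ 0 := by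
    intro y
    refine mul_ne_zero (fun h => ?_) (by exact_mod_cast (Real.cosh_pos _).ne')
    have := hre y
    rw [h, Complex.zero_re] at this
    linarith
  refine (((hF2.add integrable_inv_one_add_sq).div_const 2).const_mul (x + 1 / 2)⁻¹).mono' ?_
    (Eventually.of_forall fun y => ?_)
  · simp only [div_eq_mul_inv]
    exact hF.aestronglyMeasurable.mul
      (Continuous.inv₀ (by fun_prop) hne).aestronglyMeasurable
  · have hc := one_add_sq_le_cosh y
    have h1 : x + 1 / 2 ≤ ‖(x : ℂ) + 1 / 2 - I * y‖ := by
      rw [← hre y]; exact Complex.re_le_norm _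
    have hinv : (1 + y ^ 2)⁻¹ ≤ 1 := inv_le_one_of_one_le₀ (by nlinarith [sq_nonneg y])
    have hinv0 : 0 < (1 + y ^ 2)⁻¹ := by positivity
    rw [norm_div, norm_mul, Complex.norm_real, Real.norm_of_nonneg (Real.cosh_pos _).le,
      div_eq_mul_inv, mul_inv]
    simp only [Pi.add_apply]
    calc _ ≤ ‖F y‖ * ((x + 1 / 2)⁻¹ * (1 + y ^ 2)⁻¹) := by gcongr
      _ = (x + 1 / 2)⁻¹ * (‖F y‖ * (1 + y ^ 2)⁻¹) := by ring
      _ ≤ _ := by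
        gcongr
        nlinarith [sq_nonneg (‖F y‖ - (1 + y ^ 2)⁻¹)]

/-- The interpolation formula with the boundary values of `f` under the integral. For `x` a natural
number it reduces to `sinc (π (x - N)) = δ`, since the other two terms vanish with `sin (π x)`. -/
theorem HardyWithPole.interpolation {f g : ℂ → ℂ} {zp R : ℂ} {M : ℝ} (h : HardyWithPole f g zp R M)
    (hsum : Summable fun N : ℕ => ‖sample f (N + 1)‖ / ((N : ℝ) + 1)) {x : ℝ}
    (hx : -(1 / 2) < x) (hxp : (x : ℂ) + 1 / 2 ≠ zp) :
    f ((x : ℂ) + 1 / 2) =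
      (∑' N : ℕ, sample f N * ((Real.sinc (Real.pi * (x - N)) : ℝ) : ℂ))
      - R / Complex.cos (Real.pi * zp) *
          (((Real.sin (Real.pi * x) : ℝ) : ℂ) / ((x : ℂ) + 1 / 2 - zp))
      - ((Real.sin (Real.pi * x) / (2 * Real.pi) : ℝ) : ℂ) *
          ∫ y : ℝ, f (y * I) /
            (((x : ℂ) + 1 / 2 - I * y) * ((Real.cosh (Real.pi * y) : ℝ) : ℂ)) := by
  have hpi : (Real.pi : ℂ) ≠ 0 := by exact_mod_cast Real.pi_ne_zero
  by_cases hxN : ∃ N : ℕ, x = N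
  · obtain ⟨n, rfl⟩ := hxN
    have hsin : Real.sin (Real.pi * n) = 0 := by rw [mul_comm]; exact Real.sin_nat_mul_pi n
    rw [tsum_eq_single n, hsin]
    · simp [sample]
    · intro N hN
      have h1 := sinc_pi_mul_sub_natCast n N
      rw [hsin, mul_zero] at h1
      have h2 : (n : ℝ) - N ≠ 0 := sub_ne_zero.2 (by exact_mod_cast hN.symm)
      rw [(mul_eq_zero.1 h1).resolve_left (mul_ne_zero Real.pi_ne_zero h2)]
      simp
  · push Not at hxN
    have hsin : Complex.sin (Real.pi * x) ≠ 0 := by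
      rw [← Complex.ofReal_mul, ← Complex.ofReal_sin]
      norm_cast
      rw [Real.sin_eq_zero_iff]
      rintro ⟨m, hm⟩
      have hxm : x = m := by
        rw [mul_comm] at hm
        exact (mul_left_cancel₀ Real.pi_ne_zero hm).symm
      have h1 : (-1 : ℝ) < m := by rw [← hxm]; linarith
      have h2 : (-1 : ℤ) < m := by exact_mod_cast h1
      have h3 : 0 ≤ m := by omega
      lift m to ℕ using h3
      exact hxN m (by simpa using hxm)
    have hterm : ∀ N : ℕ, sample f N * ((Real.sinc (Real.pi * (x - N)) : ℝ) : ℂ) =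
        Complex.sin (Real.pi * x) / (2 * Real.pi) *
          (2 * ((-1) ^ N * sample f N * ((x : ℂ) - N)⁻¹)) := by
      intro N
      have h1 := congrArg ((↑) : ℝ → ℂ) (sinc_pi_mul_sub_natCast x N)
      have h2 : (x : ℂ) - N ≠ 0 := sub_ne_zero.2 (by exact_mod_cast hxN N)
      push_cast at h1
      have h3 : ((Real.sinc (Real.pi * (x - N)) : ℝ) : ℂ) =
          (-1) ^ N * Complex.sin (Real.pi * x) / (Real.pi * (x - N)) := by
        rw [eq_div_iff (mul_ne_zero hpi h2), mul_comm]
        exact h1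
      rw [h3]
      field_simp
    have h1 := (h.tendsto_interpolation hx hxp hxN).const_mul
      (Complex.sin (Real.pi * x) / (2 * Real.pi))
    simp only [Finset.mul_sum, ← hterm] at h1
    rw [tendsto_nhds_unique (summable_sample_mul_sinc hsum x).hasSum.tendsto_sum_nat h1]
    have hp : (x : ℂ) + 1 / 2 - zp ≠ 0 := sub_ne_zero.2 hxp
    have hc := cos_pi_mul_ne_zero (z := zp) (by linarith [h.re_pos]) h.ne_node
    set J := ∫ y : ℝ, f (y * I) /
      (((x : ℂ) + 1 / 2 - I * y) * ((Real.cosh (Real.pi * y) : ℝ) : ℂ))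
    rw [Complex.ofReal_div, Complex.ofReal_sin]
    push_cast
    set s := Complex.sin (Real.pi * x)
    set d := (x : ℂ) + 1 / 2 - zp
    field_simp
    ring

end PoleInterpolation

end

open PoleInterpolation in
theorem theorem2 (f : ℂ → ℂ) (zp Rp : ℂ)
    -- the only singularity in `Re z > 0` is a first order pole, not located at a sampling node
    (hzp : 0 < zp.re) (hnode : ∀ N : ℕ, zp ≠ (N : ℂ) + 1 / 2)
    (hpole : HasSimplePoleAt f zp Rp)
    (hhol : DifferentiableOn ℂ f ({z : ℂ | 0 < z.re} \ {zp}))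
    (hcont : ∀ y : ℝ, ContinuousWithinAt f {z : ℂ | 0 ≤ z.re} (Complex.I * y))
    (hcarlson : CarlsonBound f)
    (hL2 : MemLp (fun y : ℝ => f (Complex.I * y)) 2 volume)
    (hsum : Summable fun N : ℕ => ‖sample f (N + 1)‖ / ((N : ℝ) + 1)) :
    -- the series defining the coefficients converge, and so does the expansion in `L²(ℝ)`
    (∀ n : ℕ, Summable (coeffTerm f n)) ∧
    (∃ F : ℝ → ℂ, HasPsiSum (coeff f zp Rp) F) ∧
    -- the interpolation formula
    ∀ F : ℝ → ℂ, HasPsiSum (coeff f zp Rp) F →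
      ∀ x : ℝ, -(1 / 2) < x → (x : ℂ) + 1 / 2 ≠ zp →
        (Summable fun N : ℕ => sample f N * ((Real.sinc (Real.pi * (x - N)) : ℝ) : ℂ)) ∧
        Integrable (fun y : ℝ =>
          F y / (((x : ℂ) + 1 / 2 - Complex.I * y) * ((Real.cosh (Real.pi * y) : ℝ) : ℂ))) volume ∧
        f ((x : ℂ) + 1 / 2) =
          (∑' N : ℕ, sample f N * ((Real.sinc (Real.pi * (x - N)) : ℝ) : ℂ))
          - Rp / Complex.cos (Real.pi * zp) *
              (((Real.sin (Real.pi * x) : ℝ) : ℂ) / ((x : ℂ) + 1 / 2 - zp))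
          - ((Real.sin (Real.pi * x) / (2 * Real.pi) : ℝ) : ℂ) *
              ∫ y : ℝ, F y /
                (((x : ℂ) + 1 / 2 - Complex.I * y) * ((Real.cosh (Real.pi * y) : ℝ) : ℂ)) := by
  obtain ⟨g, M, h⟩ := exists_hardyWithPole hzp hnode hpole hhol hcont hcarlson hL2
  have hf : HasPsiSum (coeff f zp Rp) fun y : ℝ => f (Complex.I * y) := by
    rw [show coeff f zp Rp = _ from funext (h.coeff_eq hsum)]
    exact hasPsiSum_integral hL2
  refine ⟨summable_coeffTerm hsum, ⟨_, hf⟩, fun F hF x hx hxp =>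
    ⟨summable_sample_mul_sinc hsum x, integrable_div_mul_cosh hF.1 hx, ?_⟩⟩
  rw [h.interpolation hsum hx hxp]
  congr 2
  refine integral_congr_ae ?_
  filter_upwards [hF.ae_eq hf] with y hy
  rw [hy, mul_comm (y : ℂ)]
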